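/- **Setting.** Let $\mathbb{C}[\![\mathfrak q]\!]$ be the ring of formal power series in $\mathfrak q$. Let $(\mu^{a},\lambda)\in\mathbb{C}^2\times\mathbb{C}^2$, $\mu\neq0$, $\lambda\ne0$, be homogeneous coordinates on twistor space with the zero section removed; write $[x\,y]$ and $\langle x\,y\rangle$ for $x^0y^1-x^1y^0$, let $\varepsilon^{01}=1=-\varepsilon^{10}$ and $T_{ab}=\varepsilon_{ac}\varepsilon_{bd}T^{cd}$, put $\hat\mu=(-\bar\mu^1,\bar\mu^0)$, so that $[\mu\,\hat\mu]=|\mu^0|^2+|\mu^1|^2$, and fix spinors $\alpha,\beta$ with $\langle\alpha\beta\rangle=1$. For $c\in\mathbb{C}[\![\mathfrak q]\!]$ (a complex number, or a formal series such as a multiple of $\mathfrak q$) put $\mathfrak q(\lambda)=\mathfrak q\langle\alpha\lambda\rangle\langle\lambda\beta\rangle$, $c(\lambda)=c\,\langle\alpha\lambda\rangle\langle\lambda\beta\rangle$. On formal power series in $\mathfrak q$ of smooth functions let, with $\partial_a=\partial/\partial\mu^a$, $P=\partial_0\otimes\partial_1-\partial_1\otimes\partial_0$ and $m$ the multiplication,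 $$f\star g=\sum_{k\ge0}\frac{\mathfrak q(\lambda)^k}{2^k\,k!}\,mP^k(f\otimes g),\qquad [f,g]_{\mathfrak q}=\sum_{k\ge0}\frac{\mathfrak q(\lambda)^{2k}}{2^{2k}(2k+1)!}\,mP^{2k+1}(f\otimes g).$$ Let $\bar\nabla_{\mathfrak q}=\bar\partial+[h,\cdot\,]_{\mathfrak q}$ with $h=c^2(\lambda)\,\dfrac{[\hat\mu\,d\hat\mu]}{2[\mu\,\hat\mu]^2}$, and $X^{ab}=\mu^a\mu^b-c^2(\lambda)\,\dfrac{\hat\mu^a\hat\mu^b}{[\mu\,\hat\mu]^2}$. **Algebras.** * $\mathfrak{sl}_{2,t}$ is $\mathfrak{sl}_2$ over $\mathbb{C}[\![\mathfrak q]\!]$ with structure constants multiplied by $t$. It has generators $x^{00}=2E$, $x^{01}=x^{10}=-H$, $x^{11}=-2F$ for the standard triple $E,H,F$. Its Casimir is $C=-\frac18x^{ab}x_{ab}$. * $W(\mu;t)$, $\mu=\sigma(\sigma+1)$, is the free $\mathbb{C}[\![\mathfrak q]\!]$-module on $W[a,b]$, $a,b\ge0$, $a+b$ even, with bracket $$[W[p,q],W[r,s]]=\sum_{\ell\ge0}t^{2\ell}R_{2\ell+1}(p,q,r,s)\,\Psi_{2\ell+1}\!\left(\tfrac{p+q}2,\tfrac{r+s}2;\sigma\right)W[p+r-2\ell-1,q+s-2\ell-1],$$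 where $[x]_n=x(x-1)\cdots(x-n+1)$, $R_\ell(p,q,r,s)=\frac1{\ell!}\sum_{k=0}^{\ell}(-1)^k\binom{\ell}{k}[p]_{\ell-k}[q]_k[r]_k[s]_{\ell-k}$ and $$\Psi_\ell(m,n;\sigma)={}_4F_3\!\left(-\tfrac12-2\sigma,\ \tfrac32+2\sigma,\ -\tfrac\ell2,\ \tfrac{1-\ell}2;\ \tfrac12-m,\ \tfrac12-n,\ m+n+\tfrac32-\ell;\ 1\right).$$ * $W_{1+\infty}$ ($p_0=1$, $\sigma=-\frac12$) and $W_\infty$ ($p_0=2$, $\sigma=0$) are the centrally extended algebras over $\mathbb{C}[\![\mathfrak q]\!]$ with generators $W^p_m$ ($p\ge p_0$, $m\in\mathbb{Z}$) and a central generator $K$, and $$[W^p_m,W^q_n]=\sum_{l\ge0}\mathfrak q^{2l}f^{pq}_{2l}(m,n;\sigma)\,W^{p+q-2l-2}_{m+n}+\mathfrak q^{2(p-p_0)}k_p\prod_{j=1-p}^{p-1}(m-j)\,\delta^{pq}\,\delta_{m+n,0}\,K ,$$ $$f^{pq}_{2l}(m,n;\sigma)=\frac{\Psi_{2l+1}(p-1,q-1;\sigma)}{2(2l+1)!}\sum_{i=0}^{2l+1}(-1)^i\binom{2l+1}{i}[p-1+m]_{2l+1-i}[p-1-m]_i[q-1-n]_{2l+1-i}[q-1+n]_i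 ,$$ with $k_p=\frac{2^{2p-6}((p-1)!)^2}{(2p-3)!!(2p-1)!!}$ for $W_{1+\infty}$ and $k_p=\frac{2^{2p-7}p!(p-2)!}{(2p-3)!!(2p-1)!!}$ for $W_\infty$ (where $(-1)!!=1$). Their wedges are the spans of the $W^p_m$ with $|m|\le p-1$. * The symplecton is the $\mathbb{Z}_2$-invariant part (for $u_a\mapsto-u_a$) of the Weyl algebra over $\mathbb{C}[\![\mathfrak q]\!]$ with generators $u_0,u_1$ and relation $u_0u_1-u_1u_0=\mathfrak q$. **Theorem.** (1) For every $c\in\mathbb{C}[\![\mathfrak q]\!]$: the $X^{ab}$ stay holomorphic, $\bar\nabla_{\mathfrak q}X^{ab}=0$; they satisfy $$[X^{ab},X^{de}]_{\mathfrak q}=\varepsilon^{ad}X^{be}+\varepsilon^{ae}X^{bd}+\varepsilon^{bd}X^{ae}+\varepsilon^{be}X^{ad},\qquad X^{ab}\star X^{de}-X^{de}\star X^{ab}=\mathfrak q(\lambda)[X^{ab},X^{de}]_{\mathfrak q};$$ and $X^{ab}X_{ab}=-2c^2(\lambda)$, while $$X^{ab}\star X_{ab}=X^{ab}X_{ab}+\tfrac32\mathfrak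 q^2(\lambda)=-2c^2(\lambda)+\tfrac32\mathfrak q^2(\lambda).$$ (2) Let $c=\mathfrak q\,\tilde c$ with $\tilde c\in\mathbb{C}$, let $\mu=(4\tilde c^2-3)/16$, fix $\lambda\neq0$ with $\langle\alpha\lambda\rangle\ne0\ne\langle\lambda\beta\rangle$, and let $A_\lambda$ be the $\mathbb{C}[\![\mathfrak q]\!]$-algebra generated under $\star$ by the restrictions of $1$ and the $X^{ab}$ to the fibre over $\lambda$. Then: * $-\frac18X^{ab}\star X_{ab}=\mathfrak q^2(\lambda)\mu$, and $x^{ab}\mapsto X^{ab}$ induces an isomorphism of $\mathbb{C}[\![\mathfrak q]\!]$-algebras $U(\mathfrak{sl}_{2,\mathfrak q(\lambda)})/(C-\mathfrak q^2(\lambda)\mu)\cong A_\lambda$. * $A_\lambda$ is closed under $[\cdot,\cdot]_{\mathfrak q}$, $f\star g-g\star f=\mathfrak q(\lambda)[f,g]_{\mathfrak q}$ on $A_\lambda$, and $(A_\lambda,[\cdot,\cdot]_{\mathfrak q})$ is isomorphic as a Lie algebra over $\mathbb{C}[\![\mathfrak q]\!]$ to $W(\mu;\mathfrak q(\lambda))$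 and to $W(\mu;\mathfrak q)$ (for any $\sigma\in\mathbb{C}$ with $\sigma(\sigma+1)=\mu$). * If $\tilde c=0$ (so $\mu=-3/16$), $A_\lambda$ is isomorphic to the symplecton as a unital algebra, by $X^{ab}\mapsto\frac12\langle\alpha\lambda\rangle\langle\lambda\beta\rangle(u_au_b+u_bu_a)$. * If $\tilde c^2=-1/4$ (so $\mu=-1/4$), $(A_\lambda,[\cdot,\cdot]_{\mathfrak q})$ is isomorphic to the wedge of $W_{1+\infty}$. * If $\tilde c^2=3/4$ (so $\mu=0$), $(A_\lambda,[\cdot,\cdot]_{\mathfrak q})$ is isomorphic to the direct sum of the wedge of $W_\infty$ and the central line $\mathbb{C}[\![\mathfrak q]\!]$, which corresponds to the span of the unit $1$. -/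

import Mathlib

open scoped ContDiff PowerSeries ComplexConjugate

namespace MoyalEH

/-! ## Smooth functions on an open set, Wirtinger derivatives -/

set_option linter.unusedSectionVars false

section Smooth

variable {E F : Type} [NormedAddCommGroup E] [NormedSpace ℂ E]
  [NormedAddCommGroup F] [NormedSpace ℂ F]

/-- Extension by zero of a function on an open set (only its values on the open set matter). -/
noncomputable def ext0 (U : TopologicalSpace.Opens E) (f : U → ℂ) : E → ℂ :=
  Function.extend Subtype.val f 0

theorem ext0_apply (U : TopologicalSpace.Opens E) (f : U → ℂ) (x : U) : ext0 U f x = f x :=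
  Subtype.val_injective.extend_apply f 0 x

theorem contDiffOn_ext0 {U : TopologicalSpace.Opens E} {f : U → ℂ} {g : E → ℂ}
    (hg : ContDiffOn ℝ ∞ g U) (h : ∀ x : U, f x = g x) : ContDiffOn ℝ ∞ (ext0 U f) U :=
  hg.congr fun x hx => by rw [ext0_apply U f ⟨x, hx⟩, h]

/-- The `ℂ`-algebra of smooth (in the real sense) complex-valued functions on the open set `U`. -/
def SmoothFn (U : TopologicalSpace.Opens E) : Subalgebra ℂ (U → ℂ) where
  carrier := {f | ContDiffOn ℝ ∞ (ext0 U f) U}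
  mul_mem' {f g} hf hg := contDiffOn_ext0 (ContDiffOn.mul hf hg) fun x => by
    simp [ext0_apply]
  add_mem' {f g} hf hg := contDiffOn_ext0 (ContDiffOn.add hf hg) fun x => by
    simp [ext0_apply]
  algebraMap_mem' r := contDiffOn_ext0 (g := fun _ => r) contDiffOn_const fun x => rfl

variable {U : TopologicalSpace.Opens E}

/-- The real directional derivative of a smooth function along `v`. -/
noncomputable def dirD (v : E) (f : SmoothFn U) : SmoothFn U :=
  ⟨fun x => fderiv ℝ (ext0 U f.1) x v,
    contDiffOn_ext0 (g := fun x => fderiv ℝ (ext0 U f.1) x v)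
      ((ContDiffOn.fderiv_of_isOpen (m := ∞) f.2 U.isOpen (by simp)).clm_apply contDiffOn_const)
      fun _ => rfl⟩

/-- The Wirtinger derivative `∂_v = (D_v - i D_{iv}) / 2`. -/
noncomputable def del (v : E) (f : SmoothFn U) : SmoothFn U :=
  (1 / 2 : ℂ) • (dirD v f - Complex.I • dirD (Complex.I • v) f)

/-- The conjugate Wirtinger derivative `∂̄_v = (D_v + i D_{iv}) / 2`: the contraction of the
`(0,1)`-form `∂̄ f` with (the conjugate of) `v`. -/
noncomputable def delBar (v : E) (f : SmoothFn U) : SmoothFn U :=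
  (1 / 2 : ℂ) • (dirD v f + Complex.I • dirD (Complex.I • v) f)

/-- A complex linear form as a smooth function. -/
noncomputable def linFn (U : TopologicalSpace.Opens E) (L : E →L[ℂ] ℂ) : SmoothFn U :=
  ⟨fun x => L x, contDiffOn_ext0 (g := fun x => L x)
    (L.restrictScalars ℝ).contDiff.contDiffOn fun _ => rfl⟩

/-- The complex conjugate of a smooth function. -/
noncomputable def conjFn (f : SmoothFn U) : SmoothFn U :=
  ⟨fun x => conj (f.1 x), contDiffOn_ext0 (g := fun x => conj (ext0 U f.1 x))
    (Complex.conjCLE.contDiff.comp_contDiffOn f.2) fun x => by rw [ext0_apply]⟩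

/-- The inverse of a nowhere vanishing smooth function. -/
noncomputable def invFn (f : SmoothFn U) (hf : ∀ x, f.1 x ≠ 0) : SmoothFn U :=
  ⟨fun x => (f.1 x)⁻¹, contDiffOn_ext0 (g := fun x => (ext0 U f.1 x)⁻¹)
    (ContDiffOn.inv f.2 fun x hx => by rw [ext0_apply U f.1 ⟨x, hx⟩]; exact hf _)
    fun x => by rw [ext0_apply]⟩

/-- Pull-back of smooth functions along a smooth map sending `V` into `U`. -/
def pullback {V : TopologicalSpace.Opens F} (φ : F → E) (hφ : ContDiff ℝ ∞ φ)
    (hV : ∀ x ∈ V, φ x ∈ U) : SmoothFn U →ₐ[ℂ] SmoothFn V where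
  toFun f := ⟨fun x => f.1 ⟨φ x, hV x x.2⟩, contDiffOn_ext0 (g := fun x => ext0 U f.1 (φ x))
    (ContDiffOn.comp f.2 hφ.contDiffOn hV) fun x => (ext0_apply U f.1 ⟨φ x, hV x x.2⟩).symm⟩
  map_one' := rfl
  map_mul' _ _ := rfl
  map_zero' := rfl
  map_add' _ _ := rfl
  commutes' _ := rfl

end Smooth

/-! ## The Moyal star product with formal parameter `𝔮` -/

/-- The ground ring `ℂ⟦𝔮⟧`; the formal parameter `𝔮` is the power series variable. -/
abbrev R : Type := ℂ⟦X⟧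

/-- The formal parameter `𝔮`. -/
noncomputable abbrev qq : R := PowerSeries.X

section Moyal

variable {E : Type} [NormedAddCommGroup E] [NormedSpace ℂ E] {U : TopologicalSpace.Opens E}

/-- Formal power series in `𝔮` with smooth functions as coefficients, a `ℂ⟦𝔮⟧`-algebra under the
commutative product. -/
abbrev FormalFn (U : TopologicalSpace.Opens E) : Type := (SmoothFn U)⟦X⟧

/-- The `k`-th power of the Poisson bidifferential operator `∂₀ ⊗ ∂₁ - ∂₁ ⊗ ∂₀`, followed by
multiplication, where `∂_a` is the Wirtinger derivative along `e a`. -/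
noncomputable def poissonPow (e : Fin 2 → E) (k : ℕ) (f g : SmoothFn U) : SmoothFn U :=
  ∑ j ∈ Finset.range (k + 1), ((-1 : ℂ) ^ j * (k.choose j : ℂ)) •
    ((del (e 0))^[k - j] ((del (e 1))^[j] f) * (del (e 1))^[k - j] ((del (e 0))^[j] g))

/-- The star product `f ⋆ g = ∑ₖ (𝔮 κ / 2)ᵏ / k! · Pᵏ(f, g)`, i.e. `m ∘ exp(𝔮 π₀)` for the
Poisson structure `π₀ = (κ / 2) (∂₀ ⊗ ∂₁ - ∂₁ ⊗ ∂₀)`, extended `ℂ⟦𝔮⟧`-bilinearly. -/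
noncomputable def star (e : Fin 2 → E) (κ : SmoothFn U) (f g : FormalFn U) : FormalFn U :=
  PowerSeries.mk fun n => ∑ x ∈ Finset.HasAntidiagonal.antidiagonal n, ∑ y ∈ Finset.HasAntidiagonal.antidiagonal x.2,
    ((1 / (2 ^ x.1 * (x.1.factorial : ℂ)) : ℂ) •
      (κ ^ x.1 * poissonPow e x.1 (PowerSeries.coeff y.1 f) (PowerSeries.coeff y.2 g)))

/-- The Moyal bracket `[f, g]_𝔮 = ∑ₖ (𝔮 κ)²ᵏ / (2²ᵏ (2k+1)!) · P²ᵏ⁺¹(f, g)`, extended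
`ℂ⟦𝔮⟧`-bilinearly. It is `(f ⋆ g - g ⋆ f) / (𝔮 κ)` wherever `κ ≠ 0`. -/
noncomputable def moyalBracket (e : Fin 2 → E) (κ : SmoothFn U) (f g : FormalFn U) : FormalFn U :=
  PowerSeries.mk fun n => ∑ x ∈ Finset.HasAntidiagonal.antidiagonal n, ∑ y ∈ Finset.HasAntidiagonal.antidiagonal x.2,
    if Even x.1 then
      ((1 / (2 ^ x.1 * ((x.1 + 1).factorial : ℂ)) : ℂ) •
        (κ ^ x.1 * poissonPow e (x.1 + 1) (PowerSeries.coeff y.1 f) (PowerSeries.coeff y.2 g)))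
    else 0

end Moyal

/-! ## Twistor space -/

/-- Two-component spinors. -/
abbrev Spinor : Type := Fin 2 → ℂ

/-- The skew pairing of spinors, `[x y]` or `⟨x y⟩`. -/
def sp {A : Type} [Ring A] (x y : Fin 2 → A) : A := x 0 * y 1 - x 1 * y 0

/-- The Levi-Civita symbol `ε^{ab}` with `ε^{01} = 1`. -/
def eps (a b : Fin 2) : ℤ := if a = b then 0 else if a = 0 then 1 else -1

/-- Twistor space minus the zero section `μ = 0`, in homogeneous coordinates `(μ, λ)`. -/
def PT : TopologicalSpace.Opens (Spinor × Spinor) where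
  carrier := {z | z.1 ≠ 0 ∧ z.2 ≠ 0}
  is_open' := (isOpen_ne_fun continuous_fst continuous_const).inter
    (isOpen_ne_fun continuous_snd continuous_const)

/-- The fibre coordinates `μ^a`. -/
noncomputable def mu (a : Fin 2) : SmoothFn PT :=
  linFn PT ((ContinuousLinearMap.proj a).comp (ContinuousLinearMap.fst ℂ Spinor Spinor))

/-- The homogeneous base coordinates `λ_a`. -/
noncomputable def lam (a : Fin 2) : SmoothFn PT :=
  linFn PT ((ContinuousLinearMap.proj a).comp (ContinuousLinearMap.snd ℂ Spinor Spinor))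

/-- The quaternionic conjugation `(v⁰, v¹) ↦ (- v̄¹, v̄⁰)` on spinors. -/
def hat (v : Spinor) : Spinor := ![-conj (v 1), conj (v 0)]

/-- `μ̂`, as smooth functions. -/
noncomputable def muHat : Fin 2 → SmoothFn PT := ![-conjFn (mu 1), conjFn (mu 0)]

/-- `[μ μ̂] = |μ⁰|² + |μ¹|²`. -/
noncomputable def normMu : SmoothFn PT := sp mu muHat

theorem normMu_ne_zero (x : PT) : normMu.1 x ≠ 0 := by
  obtain ⟨⟨m, l⟩, hm, hl⟩ := x
  have key : normMu.1 ⟨(m, l), hm, hl⟩ =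
      ((Complex.normSq (m 0) + Complex.normSq (m 1) : ℝ) : ℂ) := by
    change m 0 * conj (m 0) - m 1 * -conj (m 1) = _
    rw [mul_neg, sub_neg_eq_add, Complex.mul_conj, Complex.mul_conj]
    push_cast
    rfl
  rw [key]
  intro h
  have h' := Complex.ofReal_eq_zero.mp h
  have h0 := Complex.normSq_nonneg (m 0)
  have h1 := Complex.normSq_nonneg (m 1)
  apply hm
  have e0 : m 0 = 0 := Complex.normSq_eq_zero.mp (by linarith)
  have e1 : m 1 = 0 := Complex.normSq_eq_zero.mp (by linarith)
  funext i
  fin_cases i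
  · exact e0
  · exact e1

/-- `1 / [μ μ̂]`. -/
noncomputable def invNormMu : SmoothFn PT := invFn normMu normMu_ne_zero

/-- The section `⟨α λ⟩⟨λ β⟩` of `𝒪(2)`, so that `𝔮(λ) = 𝔮 ⟨α λ⟩⟨λ β⟩`, `c(λ) = c ⟨α λ⟩⟨λ β⟩`. -/
noncomputable def kap (α β : Spinor) : SmoothFn PT :=
  sp (fun a => algebraMap ℂ _ (α a)) lam * sp lam (fun a => algebraMap ℂ _ (β a))

/-- The coordinate directions along the twistor fibres. -/
def fibDir (a : Fin 2) : Spinor × Spinor := (Pi.single a 1, 0)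

/-- The star product along the fibres of twistor space. -/
noncomputable def starPT (α β : Spinor) (f g : FormalFn PT) : FormalFn PT :=
  star fibDir (kap α β) f g

/-- The Moyal bracket along the fibres of twistor space. -/
noncomputable def bracketPT (α β : Spinor) (f g : FormalFn PT) : FormalFn PT :=
  moyalBracket fibDir (kap α β) f g

/-- The function `𝔮(λ) = 𝔮 ⟨α λ⟩⟨λ β⟩`. -/
noncomputable def qLam (α β : Spinor) : FormalFn PT := qq • PowerSeries.C (kap α β)

/-- The function `c²(λ) = (c ⟨α λ⟩⟨λ β⟩)²`, for `c ∈ ℂ⟦𝔮⟧`. -/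
noncomputable def cSqLam (α β : Spinor) (c : R) : FormalFn PT :=
  c ^ 2 • PowerSeries.C (kap α β ^ 2)

/-- The contraction with `v` of the `(0,1)`-form `h = c²(λ) [μ̂ dμ̂] / (2 [μ μ̂]²)`. -/
noncomputable def hForm (α β : Spinor) (c : R) (v : Spinor × Spinor) : FormalFn PT :=
  cSqLam α β c * PowerSeries.C ((1 / 2 : ℂ) •
    (sp muHat (fun a => algebraMap ℂ (SmoothFn PT) (hat v.1 a)) * invNormMu ^ 2))

/-- The contraction with `v` of `∇̄_𝔮 f = ∂̄ f + [h, f]_𝔮`. -/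
noncomputable def nablaBar (α β : Spinor) (c : R) (v : Spinor × Spinor) (f : FormalFn PT) :
    FormalFn PT :=
  PowerSeries.mk (fun n => delBar v (PowerSeries.coeff n f)) + bracketPT α β (hForm α β c v) f

/-- Holomorphy in the deformed non-commutative sense: `∇̄_𝔮 f = 0`. -/
def IsHolo (α β : Spinor) (c : R) (f : FormalFn PT) : Prop :=
  ∀ v : Spinor × Spinor, nablaBar α β c v f = 0

/-- `X^{ab} = μ^a μ^b - c²(λ) μ̂^a μ̂^b / [μ μ̂]²`. -/
noncomputable def XX (α β : Spinor) (c : R) (a b : Fin 2) : FormalFn PT :=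
  PowerSeries.C (mu a * mu b) -
    cSqLam α β c * PowerSeries.C (muHat a * muHat b * invNormMu ^ 2)

/-- `∑ T^{ab} T_{ab}` for a bilinear product `m`, where `T_{ab} = ε_{ac} ε_{bd} T^{cd}`. -/
noncomputable def contract {A : Type} [AddCommGroup A] (m : A → A → A)
    (T : Fin 2 → Fin 2 → A) : A :=
  ∑ a, ∑ b, ∑ c, ∑ d, (eps a c * eps b d) • m (T a b) (T c d)

/-! ## A single twistor fibre -/

/-- The fibre of twistor space over a point of the base, minus its origin. -/
def Fib : TopologicalSpace.Opens Spinor where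
  carrier := {m | m ≠ 0}
  is_open' := isOpen_ne_fun continuous_id continuous_const

/-- Restriction of functions to the fibre over `l`. -/
noncomputable def resFn (l : Spinor) (hl : l ≠ 0) : SmoothFn PT →ₐ[ℂ] SmoothFn Fib :=
  pullback (fun m => (m, l)) (contDiff_id.prodMk contDiff_const) fun _ hm => ⟨hm, hl⟩

/-- Restriction of formal power series of functions to the fibre over `l`. -/
noncomputable def res (l : Spinor) (hl : l ≠ 0) : FormalFn PT →+* FormalFn Fib :=
  PowerSeries.map (resFn l hl : SmoothFn PT →+* SmoothFn Fib)

/-- The number `⟨α λ⟩⟨λ β⟩` at `λ = l`. -/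
def kapAt (α β l : Spinor) : ℂ := sp α l * sp l β

/-- `𝔮(λ)` at `λ = l`, an element of `ℂ⟦𝔮⟧`. -/
noncomputable def qAt (α β l : Spinor) : R := PowerSeries.C (kapAt α β l) * qq

/-- The star product on the fibre over `l`. -/
noncomputable def starFib (α β l : Spinor) (f g : FormalFn Fib) : FormalFn Fib :=
  star (fun a => Pi.single a 1) (algebraMap ℂ _ (kapAt α β l)) f g

/-- The Moyal bracket on the fibre over `l`. -/
noncomputable def bracketFib (α β l : Spinor) (f g : FormalFn Fib) : FormalFn Fib :=
  moyalBracket (fun a => Pi.single a 1) (algebraMap ℂ _ (kapAt α β l)) f g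

/-- The generators `X^{ab}` restricted to the fibre over `l`. -/
noncomputable def XFib (α β : Spinor) (c : R) (l : Spinor) (hl : l ≠ 0) (a b : Fin 2) :
    FormalFn Fib :=
  res l hl (XX α β c a b)

/-- The algebra over `ℂ⟦𝔮⟧` generated under the star product by the `X^{ab}` on the fibre over
`l`: the smallest `ℂ⟦𝔮⟧`-submodule containing `1` and the `X^{ab}` and closed under `⋆`. -/
noncomputable def fibAlg (α β : Spinor) (c : R) (l : Spinor) (hl : l ≠ 0) :
    Submodule R (FormalFn Fib) :=
  sInf {S | 1 ∈ S ∧ (∀ a b, XFib α β c l hl a b ∈ S) ∧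
    ∀ f ∈ S, ∀ g ∈ S, starFib α β l f g ∈ S}

/-! ## The quotient of the enveloping algebra of `sl₂` with scaled structure constants -/

/-- The Lie algebra `L` with all structure constants multiplied by `t`. -/
def ScaledLie {K : Type} (_t : K) (L : Type) : Type := L

section Scaled

variable {K : Type} [CommRing K] (t : K) (L : Type) [LieRing L] [LieAlgebra K L]

instance : AddCommGroup (ScaledLie t L) := inferInstanceAs (AddCommGroup L)

instance : Module K (ScaledLie t L) := inferInstanceAs (Module K L)

/-- The identity map from `L` to its scaled version. -/
def toScaled : L ≃ₗ[K] ScaledLie t L := LinearEquiv.refl K L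

instance : Bracket (ScaledLie t L) (ScaledLie t L) :=
  ⟨fun x y => toScaled t L (t • ⁅(toScaled t L).symm x, (toScaled t L).symm y⁆)⟩

theorem scaled_bracket (x y : ScaledLie t L) :
    ⁅x, y⁆ = toScaled t L (t • ⁅(toScaled t L).symm x, (toScaled t L).symm y⁆) := rfl

instance : LieRing (ScaledLie t L) where
  add_lie x y z := by simp [scaled_bracket]
  lie_add x y z := by simp [scaled_bracket]
  lie_self x := by simp [scaled_bracket]
  leibniz_lie x y z := by
    simp only [scaled_bracket, LinearEquiv.symm_apply_apply, ← map_add, lie_smul, smul_lie,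
      ← smul_add]
    rw [leibniz_lie]

instance : LieAlgebra K (ScaledLie t L) where
  lie_smul r x y := by
    simp only [scaled_bracket, map_smul, lie_smul]
    rw [smul_comm]

end Scaled

/-- `sl₂` over `ℂ⟦𝔮⟧`. -/
abbrev SL2 : Type := LieAlgebra.SpecialLinear.sl (Fin 2) R

/-- The traceless matrices `(x^{ab})_{ij} = δ_{ia} ε^{bj} + δ_{ib} ε^{aj}`: in terms of the standard
triple `E, H, F` one has `x^{00} = 2 E`, `x^{01} = x^{10} = -H`, `x^{11} = -2 F`. They satisfy
`[x^{ab}, x^{cd}] = ε^{ac} x^{bd} + ε^{ad} x^{bc} + ε^{bc} x^{ad} + ε^{bd} x^{ac}`. -/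
noncomputable def xMat (a b : Fin 2) : SL2 :=
  ⟨Matrix.of fun i j => (if i = a then (eps b j : R) else 0) +
      (if i = b then (eps a j : R) else 0), by
    change Matrix.trace (n := Fin 2) (R := R) _ = 0
    rw [Matrix.trace_fin_two]
    fin_cases a <;> fin_cases b <;> simp [eps]⟩

/-- The enveloping algebra of `sl_{2,t}`. -/
abbrev USL2 (t : R) : Type := UniversalEnvelopingAlgebra R (ScaledLie t SL2)

/-- The generators `x^{ab}` in the enveloping algebra. -/
noncomputable def xU (t : R) (a b : Fin 2) : USL2 t :=
  UniversalEnvelopingAlgebra.ι R (toScaled t SL2 (xMat a b))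

/-- The Casimir `C = -x^{ab} x_{ab} / 8`. -/
noncomputable def casimir (t : R) : USL2 t :=
  (PowerSeries.C (-1 / 8) : R) • contract (fun x y => x * y) (xU t)

/-- The quotient of `U(sl_{2,t})` by the two-sided ideal generated by `C - z`. -/
abbrev UQuot (t z : R) : Type :=
  RingQuot fun x y : USL2 t => x = casimir t ∧ y = algebraMap R (USL2 t) z

/-- The generators `x^{ab}` in the quotient. -/
noncomputable def xQuot (t z : R) (a b : Fin 2) : UQuot t z :=
  RingQuot.mkAlgHom R _ (xU t a b)

/-! ## The algebras `W(μ; 𝔮)`, `W_{1+∞}` and `W_∞` -/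

/-- The descending Pochhammer symbol `[x]_n = x (x - 1) ⋯ (x - n + 1)`. -/
noncomputable def fallP (x : ℂ) (n : ℕ) : ℂ := (descPochhammer ℂ n).eval x

/-- The ascending Pochhammer symbol `(x)_n = x (x + 1) ⋯ (x + n - 1)`. -/
noncomputable def riseP (x : ℂ) (n : ℕ) : ℂ := (ascPochhammer ℂ n).eval x

/-- The generalized hypergeometric series `₄F₃(a; b; 1)`; in all the uses below one of the upper
parameters is a non-positive integer, so that only finitely many terms are non-zero. -/
noncomputable def fourF3 (a₁ a₂ a₃ a₄ b₁ b₂ b₃ : ℂ) : ℂ :=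
  ∑' j : ℕ, riseP a₁ j * riseP a₂ j * riseP a₃ j * riseP a₄ j /
    (riseP b₁ j * riseP b₂ j * riseP b₃ j * (j.factorial : ℂ))

/-- `Ψ_ℓ(m, n; σ)`. -/
noncomputable def Psi (ℓ : ℕ) (m n σ : ℂ) : ℂ :=
  fourF3 (-1 / 2 - 2 * σ) (3 / 2 + 2 * σ) (-(ℓ : ℂ) / 2) ((1 - (ℓ : ℂ)) / 2)
    (1 / 2 - m) (1 / 2 - n) (m + n + 3 / 2 - ℓ)

/-- `R_ℓ(p, q, r, s) = (1/ℓ!) ∑ₖ (-1)ᵏ (ℓ choose k) [p]_{ℓ-k} [q]_k [r]_k [s]_{ℓ-k}`. -/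
noncomputable def Rcoef (ℓ : ℕ) (p q r s : ℂ) : ℂ :=
  1 / (ℓ.factorial : ℂ) * ∑ k ∈ Finset.range (ℓ + 1), (-1) ^ k * (ℓ.choose k : ℂ) *
    fallP p (ℓ - k) * fallP q k * fallP r k * fallP s (ℓ - k)

/-- Labels of the generators `W[a, b]` of `W(μ; t)`: `a, b ≥ 0` with `a + b` even. -/
abbrev WIdx : Type := {x : ℕ × ℕ // Even (x.1 + x.2)}

/-- The free `ℂ⟦𝔮⟧`-module on the generators `W[a, b]`. -/
abbrev WMod : Type := WIdx →₀ R

/-- The bracket of two generators of `W(μ; t)`, `μ = σ (σ + 1)`: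
`[W[p,q], W[r,s]] = ∑_ℓ t^{2ℓ} R_{2ℓ+1}(p,q,r,s) Ψ_{2ℓ+1}((p+q)/2, (r+s)/2; σ)
W[p+r-2ℓ-1, q+s-2ℓ-1]`. The terms with a negative label, which are left out, have
`R_{2ℓ+1}(p,q,r,s) = 0`. -/
noncomputable def wBasisBracket (σ : ℂ) (t : R) (x y : WIdx) : WMod :=
  ∑ ℓ ∈ Finset.range (x.1.1 + y.1.1 + 1),
    if h : 2 * ℓ + 1 ≤ x.1.1 + y.1.1 ∧ 2 * ℓ + 1 ≤ x.1.2 + y.1.2 then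
      Finsupp.single
        (⟨(x.1.1 + y.1.1 - (2 * ℓ + 1), x.1.2 + y.1.2 - (2 * ℓ + 1)), by
          obtain ⟨u, hu⟩ := x.2
          obtain ⟨v, hv⟩ := y.2
          exact ⟨u + v - (2 * ℓ + 1), by dsimp only; omega⟩⟩ : WIdx)
        (t ^ (2 * ℓ) * PowerSeries.C (Rcoef (2 * ℓ + 1) x.1.1 x.1.2 y.1.1 y.1.2 *
          Psi (2 * ℓ + 1) (((x.1.1 : ℂ) + x.1.2) / 2) (((y.1.1 : ℂ) + y.1.2) / 2) σ))
    else 0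

/-- The bracket of `W(μ; t)`, `μ = σ (σ + 1)`. -/
noncomputable def wBracket (σ : ℂ) (t : R) (x y : WMod) : WMod :=
  x.sum fun i a => y.sum fun j b => (a * b) • wBasisBracket σ t i j

/-- `N^{pq}_{2l}(m, n)`. -/
noncomputable def Ncoef (l : ℕ) (p q m n : ℂ) : ℂ :=
  ∑ i ∈ Finset.range (2 * l + 2), (-1) ^ i * ((2 * l + 1).choose i : ℂ) *
    fallP (p - 1 + m) (2 * l + 1 - i) * fallP (p - 1 - m) i *
    fallP (q - 1 - n) (2 * l + 1 - i) * fallP (q - 1 + n) i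

/-- `φ^{pq}_{2l}(σ)`. -/
noncomputable def phiCoef (l : ℕ) (p q σ : ℂ) : ℂ :=
  fourF3 (-1 / 2 - 2 * σ) (3 / 2 + 2 * σ) (-(l : ℂ) - 1 / 2) (-(l : ℂ))
    (3 / 2 - p) (3 / 2 - q) (p + q - 3 / 2 - 2 * l)

/-- The structure constants `f^{pq}_{2l}(m, n; σ)`. -/
noncomputable def fCoef (l : ℕ) (p q m n σ : ℂ) : ℂ :=
  1 / (2 * ((2 * l + 1).factorial : ℂ)) * phiCoef l p q σ * Ncoef l p q m n

/-- Labels of generators `W^p_m` with spin `p ≥ p₀` and `m ∈ ℤ`. -/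
abbrev HIdx (p₀ : ℕ) : Type := {p : ℕ // p₀ ≤ p} × ℤ

/-- The free module on the generators `W^p_m`, `p ≥ p₀`, and one central generator. -/
abbrev HMod (p₀ : ℕ) : Type := (HIdx p₀ →₀ R) × R

/-- The bracket of two generators `W^p_m`, `W^q_n`:
`∑_l t^{2l} f^{pq}_{2l}(m,n;σ) W^{p+q-2l-2}_{m+n}
  + t^{2(p-p₀)} k_p ∏_{j=1-p}^{p-1} (m-j) δ^{pq} δ_{m+n,0} · (central generator)`. -/
noncomputable def hBasisBracket (p₀ : ℕ) (σ : ℂ) (k : ℕ → ℂ) (t : R) (x y : HIdx p₀) : HMod p₀ :=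
  (∑ l ∈ Finset.range (x.1.1 + y.1.1 + 1),
    if h : p₀ + (2 * l + 2) ≤ x.1.1 + y.1.1 then
      Finsupp.single
        ((⟨x.1.1 + y.1.1 - (2 * l + 2), by omega⟩, x.2 + y.2) : HIdx p₀)
        (t ^ (2 * l) * PowerSeries.C (fCoef l x.1.1 y.1.1 x.2 y.2 σ))
    else 0,
   if x.1 = y.1 ∧ x.2 + y.2 = 0 then
     t ^ (2 * (x.1.1 - p₀)) * PowerSeries.C
       (k x.1.1 * ∏ j ∈ Finset.Icc (1 - (x.1.1 : ℤ)) ((x.1.1 : ℤ) - 1), ((x.2 : ℂ) - j))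
   else 0)

/-- The bilinear extension of the bracket; the central generator has zero bracket. -/
noncomputable def hBracket (p₀ : ℕ) (σ : ℂ) (k : ℕ → ℂ) (t : R) (x y : HMod p₀) : HMod p₀ :=
  x.1.sum fun i a => y.1.sum fun j b => (a * b) • hBasisBracket p₀ σ k t i j

/-- `W_{1+∞}`: spins `p ≥ 1`, `σ = -1/2` (`μ = -1/4`), on the module `HMod 1`. (At these values the
structure constants multiplying generators of spin `< 1` vanish.) -/
noncomputable def wOnePlusInfBracket (x y : HMod 1) : HMod 1 :=
  hBracket 1 (-1 / 2) (fun p => 2 ^ (2 * (p : ℤ) - 6) * ((p - 1).factorial : ℂ) ^ 2 /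
    ((Nat.doubleFactorial (2 * p - 3) : ℂ) * (Nat.doubleFactorial (2 * p - 1) : ℂ))) qq x y

/-- `W_∞`: spins `p ≥ 2`, `σ = 0` (`μ = 0`), on the module `HMod 2`. (At these values the
structure constants multiplying generators of spin `< 2` vanish.) -/
noncomputable def wInfBracket (x y : HMod 2) : HMod 2 :=
  hBracket 2 0 (fun p => 2 ^ (2 * (p : ℤ) - 7) * (p.factorial : ℂ) * ((p - 2).factorial : ℂ) /
    ((Nat.doubleFactorial (2 * p - 3) : ℂ) * (Nat.doubleFactorial (2 * p - 1) : ℂ))) qq x y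

/-- The wedge: the span of the `W^p_m` with `1 - p ≤ m ≤ p - 1`. -/
noncomputable def wedge (p₀ : ℕ) : Submodule R (HMod p₀) :=
  Submodule.span R {w | ∃ i : HIdx p₀, 1 - (i.1.1 : ℤ) ≤ i.2 ∧ i.2 ≤ (i.1.1 : ℤ) - 1 ∧
    w = (Finsupp.single i 1, 0)}

/-! ## The Weyl algebra and the symplecton -/

/-- The Weyl algebra over `ℂ⟦𝔮⟧`: generators `u₀, u₁` with `u₀ u₁ - u₁ u₀ = 𝔮`. -/
abbrev Weyl : Type :=
  RingQuot fun x y : FreeAlgebra R (Fin 2) =>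
    x = FreeAlgebra.ι R 0 * FreeAlgebra.ι R 1 - FreeAlgebra.ι R 1 * FreeAlgebra.ι R 0 ∧
      y = algebraMap R _ qq

/-- The generators of the Weyl algebra. -/
noncomputable def wgen (a : Fin 2) : Weyl := RingQuot.mkAlgHom R _ (FreeAlgebra.ι R a)

theorem wgen_comm : wgen 0 * wgen 1 - wgen 1 * wgen 0 = algebraMap R Weyl qq := by
  have h := RingQuot.mkAlgHom_rel (S := R) (s := fun x y : FreeAlgebra R (Fin 2) =>
    x = FreeAlgebra.ι R 0 * FreeAlgebra.ι R 1 - FreeAlgebra.ι R 1 * FreeAlgebra.ι R 0 ∧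
      y = algebraMap R _ qq) ⟨rfl, rfl⟩
  rw [map_sub, map_mul, map_mul, AlgHom.commutes] at h
  exact h

/-- The `ℤ₂`-action `u_a ↦ -u_a`. -/
noncomputable def weylFlip : Weyl →ₐ[R] Weyl :=
  RingQuot.liftAlgHom R ⟨FreeAlgebra.lift R (fun a => (-1 : R) • wgen a), by
    rintro x y ⟨rfl, rfl⟩
    simp only [map_sub, map_mul, FreeAlgebra.lift_ι_apply, AlgHom.commutes]
    rw [smul_mul_smul_comm, smul_mul_smul_comm, neg_one_mul, neg_neg, one_smul, one_smul]
    exact wgen_comm⟩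

/-- The symplecton: the `ℤ₂`-invariant part of the Weyl algebra. -/
noncomputable def symplecton : Subalgebra R Weyl := AlgHom.equalizer weylFlip (AlgHom.id R Weyl)

end MoyalEH

namespace MoyalEH


/-! ### Wirtinger calculus on smooth functions. -/

section DelCalculus

variable {E F : Type} [NormedAddCommGroup E] [NormedSpace ℂ E]
  [NormedAddCommGroup F] [NormedSpace ℂ F] {U : TopologicalSpace.Opens E}

/-! The first half is a finite computation. Along a fibre, `u = μ`, the constants `w = μ̂` and `ν =
1 / [μ μ̂]` form a closed differential system (`FibreFrame`) with the single relation `[u w] ν = 1`.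
The quadratic part of `X^{ab}` is killed by three derivatives. The correction terms have no
positive-order transvectants among themselves, because the gradient of `ν` is a multiple of the
constant covector `(-w 1, w 0)`, whose skew square vanishes (`transvectant_inv_eq_zero`). So star
products of the `X^{ab}` stop at order two, Moyal brackets with them reduce to Poisson brackets, and
commutators, Casimir and holomorphy become identities modulo `[u w] ν = 1`.

For `c = 𝔮 c̃` the fibre algebra is generated by elements with the relations of `sl_{2,t}`, `t =
𝔮(λ)`, and Casimir `t² μ`. The rest is the algebra of such a `ScaledTriple` in any associative
algebra. The coefficients of the powers of `w(y) = x⁰⁰ + 2 y x⁰¹ + y² x¹¹` are the symmetrized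
monomials `symMon`. They span the generated algebra (`ScaledTriple.symSpan_eq`), because left
multiplication by a generator preserves their span.

Their product is explicit (`ScaledTriple.symMon_mul_symMon`). Left multiplication by `x¹¹` has three
terms (`ScaledTriple.two_mul_symMon`), so the product of a power of `x¹¹` and a power of `x⁰⁰` has
coefficients governed by a three-term recursion. Its solution is the hypergeometric `Ψ`
(`powerCoef_recursion`): once `Ψ` is expanded in the products `(-1/2-2σ)_j (3/2+2σ)_j`, the
recursion splits into one rational identity for each `j`. All other products follow from this
extremal one by commuting with `x⁰⁰` and `x¹¹`, since the coefficients `R_k` obey the same ladder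
relations (`transCoef_raise`, `transCoef_lower`). In a commutator only odd orders survive, and these
are the structure constants of `W(μ; t)`.

The symmetrized monomials are linearly independent on the fibre because at `𝔮 = 0` they become the
monomials in `μ⁰, μ¹` (`linearCombination_injective`, `symMap_fibTriple_injective`). Hence any
algebra generated by a triple with the same relations that maps onto the fibre algebra is isomorphic
to it. This settles the quotient of the enveloping algebra, and, after a rescaling by a square root,
the symplecton, whose symmetrized products form a triple with `μ = -3/16`.

For the wedges, `W[a, b]` is matched with spin `(a + b)/2 + 1` and mode `(a - b)/2`. The structure
constants then agree up to a factor `1/2`, absorbed by rescaling, and the central term has a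
vanishing factor. For `W_∞` the unit has spin one, below the allowed range; it is central and never
occurs in a bracket, hence splits off. -/

theorem ext0_of_notMem (f : U → ℂ) {x : E} (hx : x ∉ U) : ext0 U f x = 0 :=
  Function.extend_apply' _ _ _ fun ⟨a, ha⟩ => hx (ha ▸ a.2)

theorem ext0_add (f g : U → ℂ) : ext0 U (f + g) = ext0 U f + ext0 U g := by
  ext x
  by_cases hx : x ∈ U
  · simpa using (ext0_apply U (f + g) ⟨x, hx⟩).trans
      (congrArg₂ (· + ·) (ext0_apply U f ⟨x, hx⟩) (ext0_apply U g ⟨x, hx⟩)).symm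
  · simp [ext0_of_notMem _ hx]

theorem ext0_mul (f g : U → ℂ) : ext0 U (f * g) = ext0 U f * ext0 U g := by
  ext x
  by_cases hx : x ∈ U
  · simpa using (ext0_apply U (f * g) ⟨x, hx⟩).trans
      (congrArg₂ (· * ·) (ext0_apply U f ⟨x, hx⟩) (ext0_apply U g ⟨x, hx⟩)).symm
  · simp [ext0_of_notMem _ hx]

theorem ext0_smul (c : ℂ) (f : U → ℂ) : ext0 U (c • f) = c • ext0 U f := by
  ext x
  by_cases hx : x ∈ U
  · simpa using (ext0_apply U (c • f) ⟨x, hx⟩).trans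
      (congrArg (c • ·) (ext0_apply U f ⟨x, hx⟩)).symm
  · simp [ext0_of_notMem _ hx]

theorem differentiableAt_ext0 (f : SmoothFn U) (x : U) :
    DifferentiableAt ℝ (ext0 U f.1) x :=
  ((f.2.contDiffAt (U.isOpen.mem_nhds x.2)).differentiableAt (by simp))

theorem smoothFn_ext {f g : SmoothFn U} (h : ∀ x, f.1 x = g.1 x) : f = g :=
  Subtype.ext (funext h)

theorem dirD_apply (v : E) (f : SmoothFn U) (x : U) :
    (dirD v f).1 x = fderiv ℝ (ext0 U f.1) x v := rfl

theorem dirD_add (v : E) (f g : SmoothFn U) : dirD v (f + g) = dirD v f + dirD v g := by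
  refine smoothFn_ext fun x => ?_
  change fderiv ℝ (ext0 U (f.1 + g.1)) (x : E) v = fderiv ℝ _ (x : E) v + fderiv ℝ _ (x : E) v
  rw [ext0_add, fderiv_add (differentiableAt_ext0 f x) (differentiableAt_ext0 g x)]
  rfl

theorem dirD_smul (v : E) (c : ℂ) (f : SmoothFn U) : dirD v (c • f) = c • dirD v f := by
  refine smoothFn_ext fun x => ?_
  change fderiv ℝ (ext0 U (c • f.1)) (x : E) v = c • fderiv ℝ _ (x : E) v
  rw [ext0_smul, fderiv_const_smul (differentiableAt_ext0 f x)]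
  rfl

theorem dirD_mul (v : E) (f g : SmoothFn U) :
    dirD v (f * g) = f * dirD v g + g * dirD v f := by
  refine smoothFn_ext fun x => ?_
  change fderiv ℝ (ext0 U (f.1 * g.1)) (x : E) v = f.1 x * fderiv ℝ _ (x : E) v + g.1 x * fderiv ℝ _ (x : E) v
  rw [ext0_mul, fderiv_mul (differentiableAt_ext0 f x) (differentiableAt_ext0 g x)]
  simp [ext0_apply]

theorem dirD_comm (v w : E) (f : SmoothFn U) : dirD v (dirD w f) = dirD w (dirD v f) := by
  -- Only germs at points of `U` matter: there the inner derivative is `y ↦ Df(y) w`, so iterating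
  -- gives `D²f(v, w)`, and symmetry of the second derivative applies.
  have key : ∀ v w : E, ∀ x : U, (dirD v (dirD w f)).1 x =
      fderiv ℝ (fderiv ℝ (ext0 U f.1)) x v w := by
    intro v w x
    have h1 : ext0 U (dirD w f).1 =ᶠ[nhds (x : E)] fun y => fderiv ℝ (ext0 U f.1) y w := by
      filter_upwards [U.isOpen.mem_nhds x.2] with y hy
      rw [ext0_apply U _ ⟨y, hy⟩]; rfl
    have h2 : DifferentiableAt ℝ (fderiv ℝ (ext0 U f.1)) (x : E) :=
      ((ContDiffOn.fderiv_of_isOpen (m := ∞) f.2 U.isOpen (by simp)).contDiffAt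
        (U.isOpen.mem_nhds x.2)).differentiableAt (by simp)
    rw [dirD_apply, h1.fderiv_eq, fderiv_clm_apply h2 (differentiableAt_const w)]
    simp
  refine smoothFn_ext fun x => ?_
  rw [key, key]
  have h3 : ContDiffAt ℝ ∞ (ext0 U f.1) (x : E) := f.2.contDiffAt (U.isOpen.mem_nhds x.2)
  exact (h3.isSymmSndFDerivAt (by simpa using WithTop.coe_le_coe.2 (le_top : (2 : ℕ∞) ≤ ⊤))) v w

/-- The Wirtinger derivative as a derivation. -/
noncomputable def delDer (v : E) : Derivation ℂ (SmoothFn U) (SmoothFn U) :=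
  Derivation.mk'
    { toFun := del v
      map_add' := fun f g => by simp only [del, dirD_add]; module
      map_smul' := fun c f => by simp only [del, dirD_smul, RingHom.id_apply]; module }
    fun f g => by
      change del v (f * g) = f * del v g + g * del v f
      simp only [del, dirD_mul, mul_smul_comm, mul_sub, smul_sub, smul_add]
      abel

/-- The conjugate Wirtinger derivative as a derivation. -/
noncomputable def delBarDer (v : E) : Derivation ℂ (SmoothFn U) (SmoothFn U) :=
  Derivation.mk'
    { toFun := delBar v
      map_add' := fun f g => by simp only [delBar, dirD_add]; module
      map_smul' := fun c f => by simp only [delBar, dirD_smul, RingHom.id_apply]; module }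
    fun f g => by
      change delBar v (f * g) = f * delBar v g + g * delBar v f
      simp only [delBar, dirD_mul, mul_smul_comm, mul_add, smul_add]
      abel

theorem delDer_apply (v : E) (f : SmoothFn U) : delDer v f = del v f := rfl

theorem delBarDer_apply (v : E) (f : SmoothFn U) : delBarDer v f = delBar v f := rfl

theorem dirD_sub (v : E) (f g : SmoothFn U) : dirD v (f - g) = dirD v f - dirD v g := by
  have h := dirD_add v (f - g) g
  rw [sub_add_cancel] at h
  rw [h, add_sub_cancel_right]

theorem del_comm (v w : E) (f : SmoothFn U) : del v (del w f) = del w (del v f) := by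
  simp only [del, dirD_smul, dirD_sub]
  rw [dirD_comm v w, dirD_comm v, dirD_comm _ w, dirD_comm (Complex.I • v) (Complex.I • w)]
  module

/-- Wirtinger derivatives of a complex linear form. -/
theorem dirD_linFn (v : E) (L : E →L[ℂ] ℂ) :
    dirD v (linFn U L) = algebraMap ℂ _ (L v) := by
  refine smoothFn_ext fun x => ?_
  have h1 : ext0 U (linFn U L).1 =ᶠ[nhds (x : E)] (L.restrictScalars ℝ) := by
    filter_upwards [U.isOpen.mem_nhds x.2] with y hy
    rw [ext0_apply U _ ⟨y, hy⟩]; rfl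
  rw [dirD_apply, h1.fderiv_eq, ContinuousLinearMap.fderiv]
  rfl

theorem dirD_conjFn (v : E) (f : SmoothFn U) : dirD v (conjFn f) = conjFn (dirD v f) := by
  refine smoothFn_ext fun x => ?_
  have h1 : ext0 U (conjFn f).1 =ᶠ[nhds (x : E)]
      ((Complex.conjCLE : ℂ →L[ℝ] ℂ) ∘ ext0 U f.1) := by
    filter_upwards [U.isOpen.mem_nhds x.2] with y hy
    rw [ext0_apply U _ ⟨y, hy⟩, Function.comp_apply, ext0_apply U _ ⟨y, hy⟩]; rfl
  rw [dirD_apply, h1.fderiv_eq, fderiv_comp _ (ContinuousLinearMap.differentiableAt _)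
    (differentiableAt_ext0 f x), ContinuousLinearMap.fderiv]
  rfl

theorem del_linFn (v : E) (L : E →L[ℂ] ℂ) : del v (linFn U L) = algebraMap ℂ _ (L v) := by
  rw [del, dirD_linFn, dirD_linFn, map_smul, Algebra.smul_def, Algebra.smul_def, ← map_mul,
    ← map_sub, ← map_mul]
  congr 1
  rw [smul_eq_mul, ← mul_assoc, Complex.I_mul_I]; ring

theorem delBar_linFn (v : E) (L : E →L[ℂ] ℂ) : delBar v (linFn U L) = 0 := by
  rw [delBar, dirD_linFn, dirD_linFn, map_smul, Algebra.smul_def, Algebra.smul_def, ← map_mul,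
    ← map_add, ← map_mul, smul_eq_mul, ← mul_assoc, Complex.I_mul_I, ← map_zero (algebraMap ℂ _)]
  congr 1
  ring

theorem conjFn_algebraMap (c : ℂ) :
    conjFn (algebraMap ℂ (SmoothFn U) c) = algebraMap ℂ _ (conj c) :=
  smoothFn_ext fun _ => rfl

/-- Conjugation makes the form antilinear, so the direction `i v` contributes with the opposite sign
and the two halves cancel. -/
theorem del_conj_linFn (v : E) (L : E →L[ℂ] ℂ) : del v (conjFn (linFn U L)) = 0 := by
  rw [del, dirD_conjFn, dirD_conjFn, dirD_linFn, dirD_linFn, conjFn_algebraMap, conjFn_algebraMap,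
    Algebra.smul_def, Algebra.smul_def, ← map_mul, ← map_sub, ← map_mul,
    ← map_zero (algebraMap ℂ _), map_smul, smul_eq_mul, map_mul conj, Complex.conj_I, ← mul_assoc,
    mul_neg, Complex.I_mul_I]
  congr 1
  ring

theorem delBar_conj_linFn (v : E) (L : E →L[ℂ] ℂ) :
    delBar v (conjFn (linFn U L)) = algebraMap ℂ _ (conj (L v)) := by
  rw [delBar, dirD_conjFn, dirD_conjFn, dirD_linFn, dirD_linFn, conjFn_algebraMap,
    conjFn_algebraMap,
    Algebra.smul_def, Algebra.smul_def, ← map_mul, ← map_add, ← map_mul, map_smul, smul_eq_mul,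
    map_mul conj, Complex.conj_I, ← mul_assoc, mul_neg, Complex.I_mul_I]
  congr 1
  ring

theorem mul_invFn (f : SmoothFn U) (hf : ∀ x, f.1 x ≠ 0) : f * invFn f hf = 1 :=
  smoothFn_ext fun x => mul_inv_cancel₀ (hf x)

/-- The derivative of an inverse. -/
theorem derivation_inv {B : Type} [CommRing B] [Algebra ℂ B] (D : Derivation ℂ B B) {a b : B}
    (h : a * b = 1) : D b = -(D a * b ^ 2) := by
  have h1 := congrArg D h
  rw [D.leibniz, D.map_one_eq_zero, smul_eq_mul, smul_eq_mul] at h1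
  linear_combination b * h1 - D b * h

theorem dirD_pullback {V : TopologicalSpace.Opens F} (φ : F → E) (hφ : ContDiff ℝ ∞ φ)
    (hV : ∀ x ∈ V, φ x ∈ U) (v : F) (w : E) (hw : ∀ x, fderiv ℝ φ x v = w) (f : SmoothFn U) :
    dirD v (pullback φ hφ hV f) = pullback φ hφ hV (dirD w f) := by
  refine smoothFn_ext fun x => ?_
  have h1 : ext0 V (pullback φ hφ hV f).1 =ᶠ[nhds (x : F)] ext0 U f.1 ∘ φ := by
    filter_upwards [V.isOpen.mem_nhds x.2] with y hy
    rw [ext0_apply V _ ⟨y, hy⟩, Function.comp_apply, ext0_apply U _ ⟨φ y, hV y hy⟩]; rfl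
  rw [dirD_apply, h1.fderiv_eq, fderiv_comp (x : F) (differentiableAt_ext0 f ⟨φ x, hV x x.2⟩)
    (hφ.differentiable (by simp) _), ContinuousLinearMap.comp_apply, hw]
  rfl

/-- The map is only assumed real smooth, so the compatibility of its derivative with multiplication
by `i` is asked for separately in the direction concerned. -/
theorem del_pullback {V : TopologicalSpace.Opens F} (φ : F → E) (hφ : ContDiff ℝ ∞ φ)
    (hV : ∀ x ∈ V, φ x ∈ U) (v : F) (w : E) (hw : ∀ x, fderiv ℝ φ x v = w)
    (hw' : ∀ x, fderiv ℝ φ x (Complex.I • v) = Complex.I • w) (f : SmoothFn U) :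
    del v (pullback φ hφ hV f) = pullback φ hφ hV (del w f) := by
  simp only [del, dirD_pullback φ hφ hV v w hw, dirD_pullback φ hφ hV _ _ hw', map_smul, map_sub]

end DelCalculus


/-! ### Transvectants and the identity behind associativity. -/

section Bidifferential

open scoped TensorProduct

open TensorProduct Finset.HasAntidiagonal

variable {B : Type} [CommRing B] [Algebra ℂ B] (D : Fin 2 → Derivation ℂ B B)

/-- The Poisson bidifferential operator `∂₀ ⊗ ∂₁ - ∂₁ ⊗ ∂₀`. -/
noncomputable def bidiff : Module.End ℂ (B ⊗[ℂ] B) :=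
  map (D 0).toLinearMap (D 1).toLinearMap - map (D 1).toLinearMap (D 0).toLinearMap

/-- The powers of the Poisson bidifferential operator, followed by multiplication. -/
noncomputable def transvectant (k : ℕ) (f g : B) : B :=
  LinearMap.mul' ℂ B ((bidiff D ^ k) (f ⊗ₜ g))

theorem bidiff_tmul (f g : B) :
    bidiff D (f ⊗ₜ g) = D 0 f ⊗ₜ D 1 g - D 1 f ⊗ₜ D 0 g := rfl

@[simp] theorem transvectant_zero (f g : B) : transvectant D 0 f g = f * g := by
  simp [transvectant]

theorem transvectant_one (f g : B) :
    transvectant D 1 f g = D 0 f * D 1 g - D 1 f * D 0 g := by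
  simp [transvectant, bidiff_tmul]

/-- Peels off the factor of the Poisson operator that acts first; the later inductions on the order
run through this recursion. -/
theorem transvectant_succ (k : ℕ) (f g : B) : transvectant D (k + 1) f g =
    transvectant D k (D 0 f) (D 1 g) - transvectant D k (D 1 f) (D 0 g) := by
  simp [transvectant, pow_succ, bidiff_tmul]

theorem transvectant_add_left (k : ℕ) (f f' g : B) :
    transvectant D k (f + f') g = transvectant D k f g + transvectant D k f' g := by
  simp [transvectant, add_tmul]

theorem transvectant_add_right (k : ℕ) (f g g' : B) :
    transvectant D k f (g + g') = transvectant D k f g + transvectant D k f g' := by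
  simp [transvectant, tmul_add]

theorem transvectant_sub_left (k : ℕ) (f f' g : B) :
    transvectant D k (f - f') g = transvectant D k f g - transvectant D k f' g := by
  simp [transvectant, sub_tmul]

theorem transvectant_sub_right (k : ℕ) (f g g' : B) :
    transvectant D k f (g - g') = transvectant D k f g - transvectant D k f g' := by
  simp [transvectant, tmul_sub]

@[simp] theorem transvectant_zero_left (k : ℕ) (g : B) : transvectant D k 0 g = 0 := by
  simp [transvectant]

@[simp] theorem transvectant_zero_right (k : ℕ) (g : B) : transvectant D k g 0 = 0 := by
  simp [transvectant]

theorem transvectant_smul_left (k : ℕ) (c : ℂ) (f g : B) :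
    transvectant D k (c • f) g = c • transvectant D k f g := by
  rw [transvectant, ← smul_tmul', map_smul, map_smul, transvectant]

theorem transvectant_smul_right (k : ℕ) (c : ℂ) (f g : B) :
    transvectant D k f (c • g) = c • transvectant D k f g := by
  simp [transvectant]

theorem transvectant_const_mul_left {c : B} (hc : ∀ a, D a c = 0) (k : ℕ) (f g : B) :
    transvectant D k (c * f) g = c * transvectant D k f g := by
  induction k generalizing f g with
  | zero => simp [mul_assoc]
  | succ k ih => simp [transvectant_succ, hc, ih, mul_sub]

theorem transvectant_const_mul_right {c : B} (hc : ∀ a, D a c = 0) (k : ℕ) (f g : B) :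
    transvectant D k f (c * g) = c * transvectant D k f g := by
  induction k generalizing f g with
  | zero => simp [mul_left_comm]
  | succ k ih => simp [transvectant_succ, hc, ih, mul_sub]

/-- Exchanging the two tensor factors reverses the sign of the Poisson operator. -/
theorem transvectant_swap (k : ℕ) (f g : B) :
    transvectant D k g f = (-1) ^ k * transvectant D k f g := by
  induction k generalizing f g with
  | zero => simp [mul_comm]
  | succ k ih =>
    rw [transvectant_succ, transvectant_succ, ih, ih (D 0 f)]
    ring

theorem transvectant_one_left (k : ℕ) (g : B) : transvectant D (k + 1) 1 g = 0 := by
  simp [transvectant_succ]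

theorem transvectant_one_right (k : ℕ) (g : B) : transvectant D (k + 1) g 1 = 0 := by
  simp [transvectant_succ]

variable {D}

/-- Pascal's rule for alternating sums. -/
theorem sum_alternating_choose_succ {M : Type} [AddCommGroup M] [Module ℂ M] (a : ℕ → ℕ → M)
    (k : ℕ) :
    ∑ j ∈ Finset.range (k + 2), ((-1 : ℂ) ^ j * ((k + 1).choose j : ℂ)) • a (k + 1 - j) j =
      ∑ j ∈ Finset.range (k + 1), ((-1 : ℂ) ^ j * (k.choose j : ℂ)) • a (k - j + 1) j -
      ∑ j ∈ Finset.range (k + 1), ((-1 : ℂ) ^ j * (k.choose j : ℂ)) • a (k - j) (j + 1) := by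
  have h1 : ∑ j ∈ Finset.range (k + 1), ((-1 : ℂ) ^ j * (k.choose j : ℂ)) • a (k - j + 1) j =
      ∑ j ∈ Finset.range (k + 1), ((-1 : ℂ) ^ (j + 1) * (k.choose (j + 1) : ℂ)) • a (k - j) (j + 1)
        + a (k + 1) 0 := by
    rw [Finset.sum_range_succ']
    simp only [pow_zero, Nat.choose_zero_right, Nat.cast_one, mul_one, one_smul, Nat.sub_zero]
    congr 1
    -- The index shift creates one extra term, weighted by `choose k (k + 1) = 0`.
    rw [Finset.sum_range_succ, Nat.choose_succ_self, Nat.cast_zero, mul_zero, zero_smul, add_zero]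
    refine Finset.sum_congr rfl fun j hj => ?_
    rw [Finset.mem_range] at hj
    rw [show k - (j + 1) + 1 = k - j by omega]
  rw [h1, Finset.sum_range_succ', add_sub_right_comm, ← Finset.sum_sub_distrib]
  simp only [pow_zero, Nat.choose_zero_right, Nat.cast_one, mul_one, one_smul, Nat.sub_zero]
  congr 1
  refine Finset.sum_congr rfl fun j _ => ?_
  rw [Nat.add_sub_add_right, Nat.choose_succ_succ, Nat.cast_add, pow_succ, ← sub_smul]
  congr 1
  ring

/-- The binomial theorem for a difference of two operators, which commute because the derivations
do. It links the operator form to the explicit sum defining `poissonPow`. -/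
theorem transvectant_eq_sum (hD : ∀ f, D 0 (D 1 f) = D 1 (D 0 f)) (k : ℕ) (f g : B) :
    transvectant D k f g = ∑ j ∈ Finset.range (k + 1), ((-1 : ℂ) ^ j * (k.choose j : ℂ)) •
      ((D 0)^[k - j] ((D 1)^[j] f) * (D 1)^[k - j] ((D 0)^[j] g)) := by
  induction k generalizing f g with
  | zero => simp
  | succ k ih =>
    rw [transvectant_succ, ih, ih]
    rw [sum_alternating_choose_succ (M := B) fun i j =>
      (D 0)^[i] ((D 1)^[j] f) * (D 1)^[i] ((D 0)^[j] g)]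
    have c1 : ∀ j (f : B), (D 1)^[j] (D 0 f) = D 0 ((D 1)^[j] f) := fun j f =>
      ((show Function.Commute (D 1) (D 0) from fun f => (hD f).symm).iterate_left j) f
    have c0 : ∀ j (f : B), (D 0)^[j] (D 1 f) = D 1 ((D 0)^[j] f) := fun j f =>
      ((show Function.Commute (D 0) (D 1) from fun f => hD f).iterate_left j) f
    simp only [c1, c0, ← Function.iterate_succ_apply]

section Associativity

variable (D)

/-- `Pᵢⱼ` acting on a threefold tensor product, where `x`, `y` list the two derivations acting on
the two factors in question. -/
noncomputable def crossOp {M : Type} [AddCommGroup M] [Module ℂ M]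
    (x y : Fin 2 → Module.End ℂ M) : Module.End ℂ M := x 0 * y 1 - x 1 * y 0

/-- The derivations acting on one of the factors of a threefold tensor product. -/
noncomputable def factorOp (i : Fin 3) (a : Fin 2) : Module.End ℂ (B ⊗[ℂ] (B ⊗[ℂ] B)) :=
  match i with
  | 0 => map (D a).toLinearMap LinearMap.id
  | 1 => map LinearMap.id (map (D a).toLinearMap LinearMap.id)
  | 2 => map LinearMap.id (map LinearMap.id (D a).toLinearMap)

variable {D}

theorem factorOp_commute (hD : ∀ f, D 0 (D 1 f) = D 1 (D 0 f)) (i j : Fin 3) (a b : Fin 2) :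
    Commute (factorOp D i a) (factorOp D j b) := by
  fin_cases i <;> fin_cases j <;> fin_cases a <;> fin_cases b <;>
    (ext f g h; simp [factorOp, hD])

theorem crossOp_commute (hD : ∀ f, D 0 (D 1 f) = D 1 (D 0 f)) (i j k l : Fin 3) :
    Commute (crossOp (factorOp D i) (factorOp D j)) (crossOp (factorOp D k) (factorOp D l)) := by
  have h := factorOp_commute hD
  have h1 : ∀ (i : Fin 3) (a : Fin 2),
      Commute (factorOp D i a) (crossOp (factorOp D k) (factorOp D l)) := fun i a => by
    unfold crossOp
    exact Commute.sub_right (R := Module.End ℂ (B ⊗[ℂ] (B ⊗[ℂ] B))) ((h i k a 0).mul_right (h i l a 1))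
      ((h i k a 1).mul_right (h i l a 0))
  rw [crossOp]
  exact Commute.sub_left (R := Module.End ℂ (B ⊗[ℂ] (B ⊗[ℂ] B))) ((h1 i 0).mul_left (h1 j 1)) ((h1 i 1).mul_left (h1 j 0))

theorem comp_pow_of_comp_eq {M N : Type} [AddCommGroup M] [Module ℂ M] [AddCommGroup N]
    [Module ℂ N] {m : M →ₗ[ℂ] N} {P : Module.End ℂ M} {Q : Module.End ℂ N}
    (h : ∀ x, Q (m x) = m (P x)) (k : ℕ) (x : M) : (Q ^ k) (m x) = m ((P ^ k) x) := by
  induction k generalizing x with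
  | zero => rfl
  | succ k ih => rw [pow_succ, pow_succ, Module.End.mul_apply, Module.End.mul_apply, h, ih]

/-- By the Leibniz rule, multiplying the last two factors intertwines `P` with `P₀₁ + P₀₂`. Nested
transvectants thereby become polynomials in the `Pᵢⱼ`, applied before one total multiplication. -/
theorem transvectant_nested_right (k l : ℕ) (f g h : B) :
    transvectant D k f (transvectant D l g h) =
      LinearMap.mul' ℂ B (map LinearMap.id (LinearMap.mul' ℂ B)
        (((crossOp (factorOp D 0) (factorOp D 1) + crossOp (factorOp D 0) (factorOp D 2)) ^ k)
          ((crossOp (factorOp D 1) (factorOp D 2) ^ l) (f ⊗ₜ (g ⊗ₜ h))))) := by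
  rw [← comp_pow_of_comp_eq (Q := bidiff D), transvectant, transvectant]
  · congr 2
    have h2 : ∀ x : B ⊗[ℂ] B, (crossOp (factorOp D 1) (factorOp D 2)) (f ⊗ₜ x) =
        f ⊗ₜ (bidiff D x) := fun x => by
      induction x with
      | zero => simp
      | add x y hx hy => rw [tmul_add, map_add, hx, hy, map_add, tmul_add]
      | tmul g h => simp [crossOp, factorOp, bidiff_tmul, tmul_sub]
    have h3 := comp_pow_of_comp_eq (m := TensorProduct.mk ℂ B (B ⊗[ℂ] B) f) h2 l (g ⊗ₜ h)
    rw [TensorProduct.mk_apply, TensorProduct.mk_apply] at h3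
    rw [h3]
    simp
  · intro x
    induction x with
    | zero => simp
    | add x y hx hy => simp only [map_add, hx, hy]
    | tmul f y =>
      induction y with
      | zero => simp
      | add x y hx hy => simp only [tmul_add, map_add, hx, hy]
      | tmul g h =>
        simp [crossOp, factorOp, bidiff_tmul, tmul_add, mul_comm]
        abel

theorem transvectant_nested_left (k l : ℕ) (f g h : B) :
    transvectant D k (transvectant D l f g) h =
      LinearMap.mul' ℂ B (map LinearMap.id (LinearMap.mul' ℂ B)
        (((crossOp (factorOp D 0) (factorOp D 2) + crossOp (factorOp D 1) (factorOp D 2)) ^ k)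
          ((crossOp (factorOp D 0) (factorOp D 1) ^ l) (f ⊗ₜ (g ⊗ₜ h))))) := by
  -- Here the first two factors must be multiplied first; associativity of `B` makes the total
  -- multiplication the same.
  let m12 : B ⊗[ℂ] (B ⊗[ℂ] B) →ₗ[ℂ] B ⊗[ℂ] B :=
    map (LinearMap.mul' ℂ B) LinearMap.id ∘ₗ (TensorProduct.assoc ℂ B B B).symm.toLinearMap
  have hm : ∀ x, LinearMap.mul' ℂ B (map LinearMap.id (LinearMap.mul' ℂ B) x) =
      LinearMap.mul' ℂ B (m12 x) := by
    refine LinearMap.congr_fun (f := LinearMap.mul' ℂ B ∘ₗ map LinearMap.id (LinearMap.mul' ℂ B))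
      (g := LinearMap.mul' ℂ B ∘ₗ m12) ?_
    ext f g h
    simp [m12, mul_assoc]
  rw [hm, ← comp_pow_of_comp_eq (Q := bidiff D), transvectant, transvectant]
  · congr 2
    have h2 : ∀ x : B ⊗[ℂ] B, (crossOp (factorOp D 0) (factorOp D 1))
        (TensorProduct.assoc ℂ B B B (x ⊗ₜ h)) =
        TensorProduct.assoc ℂ B B B (bidiff D x ⊗ₜ h) := fun x => by
      induction x with
      | zero => simp
      | add x y hx hy => rw [add_tmul, map_add, map_add, hx, hy, map_add, add_tmul, map_add]
      | tmul f g => simp [crossOp, factorOp, bidiff_tmul, sub_tmul]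
    have h3 := comp_pow_of_comp_eq (m := (TensorProduct.assoc ℂ B B B).toLinearMap ∘ₗ
      (TensorProduct.mk ℂ (B ⊗[ℂ] B) B).flip h) h2 l (f ⊗ₜ g)
    simp only [LinearMap.comp_apply, LinearMap.flip_apply, TensorProduct.mk_apply,
      LinearEquiv.coe_coe, assoc_tmul] at h3
    rw [h3]
    simp [m12]
  · intro x
    induction x with
    | zero => simp
    | add x y hx hy => simp only [map_add, hx, hy]
    | tmul f y =>
      induction y with
      | zero => simp
      | add x y hx hy => simp only [tmul_add, map_add, hx, hy]
      | tmul g h =>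
        simp [crossOp, factorOp, bidiff_tmul, add_tmul, mul_comm, m12]
        abel

/-- The degree `n` part of `exp (x + y) = exp x exp y` for commuting operators. -/
theorem add_pow_div_factorial {M : Type} [AddCommGroup M] [Module ℂ M] {x y : Module.End ℂ M}
    (h : Commute x y) (n : ℕ) (v : M) :
    ∑ p ∈ antidiagonal n, (1 / ((p.1.factorial : ℂ) * p.2.factorial)) • (x ^ p.1) ((y ^ p.2) v) =
      (1 / (n.factorial : ℂ)) • ((x + y) ^ n) v := by
  rw [h.add_pow', LinearMap.sum_apply, Finset.smul_sum]
  refine Finset.sum_congr rfl fun p hp => ?_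
  rw [mem_antidiagonal] at hp
  rw [LinearMap.smul_apply, Module.End.mul_apply, ← Nat.cast_smul_eq_nsmul ℂ, smul_smul]
  congr 1
  subst hp
  rw [← Nat.add_choose_mul_factorial_mul_factorial p.1 p.2, ← Nat.choose_symm_add]
  have := Nat.factorial_ne_zero p.1
  have := Nat.factorial_ne_zero p.2
  have := (Nat.choose_pos (Nat.le_add_right p.1 p.2)).ne'
  push_cast
  field_simp

/-- The identity behind the associativity of the Moyal product. -/
theorem sum_transvectant_assoc (hD : ∀ f, D 0 (D 1 f) = D 1 (D 0 f)) (n : ℕ) (f g h : B) :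
    ∑ p ∈ antidiagonal n, (1 / ((p.1.factorial : ℂ) * p.2.factorial)) •
        transvectant D p.1 (transvectant D p.2 f g) h =
      ∑ p ∈ antidiagonal n, (1 / ((p.1.factorial : ℂ) * p.2.factorial)) •
        transvectant D p.1 f (transvectant D p.2 g h) := by
  -- Both nestings equal the `n`-th divided power of `P₀₁ + P₀₂ + P₁₂`, since the `Pᵢⱼ` commute.
  have h1 := congrArg (fun x => LinearMap.mul' ℂ B (map LinearMap.id (LinearMap.mul' ℂ B) x))
    (add_pow_div_factorial ((crossOp_commute hD 0 2 0 1).add_left (crossOp_commute hD 1 2 0 1)) n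
      (f ⊗ₜ (g ⊗ₜ h)))
  have h2 := congrArg (fun x => LinearMap.mul' ℂ B (map LinearMap.id (LinearMap.mul' ℂ B) x))
    (add_pow_div_factorial ((crossOp_commute hD 0 1 1 2).add_left (crossOp_commute hD 0 2 1 2)) n
      (f ⊗ₜ (g ⊗ₜ h)))
  simp only [map_sum, map_smul, ← transvectant_nested_right, ← transvectant_nested_left] at h1 h2
  rw [h1, h2]
  congr 5
  abel

end Associativity

end Bidifferential


/-! ### The star product on formal power series. -/

section Formal

variable {A : Type} [CommRing A] [Algebra ℂ A]

/-- A derivation acting coefficientwise on formal power series. -/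
noncomputable def formalDer (d : Derivation ℂ A A) : Derivation ℂ A⟦X⟧ A⟦X⟧ :=
  Derivation.mk'
    { toFun := fun f => PowerSeries.mk fun n => d (PowerSeries.coeff n f)
      map_add' := fun f g => by ext n; simp
      map_smul' := fun c f => by ext n; simp }
    fun f g => by
      ext n
      simp only [LinearMap.coe_mk, AddHom.coe_mk, PowerSeries.coeff_mk, PowerSeries.coeff_mul,
        map_sum, Derivation.leibniz, smul_eq_mul, map_add, Finset.sum_add_distrib]
      congr 1
      rw [← Finset.Nat.sum_antidiagonal_swap]
      rfl

@[simp] theorem coeff_formalDer (d : Derivation ℂ A A) (n : ℕ) (f : A⟦X⟧) :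
    PowerSeries.coeff n (formalDer d f) = d (PowerSeries.coeff n f) :=
  PowerSeries.coeff_mk n fun n => d (PowerSeries.coeff n f)

@[simp] theorem formalDer_C (d : Derivation ℂ A A) (a : A) :
    formalDer d (PowerSeries.C a) = PowerSeries.C (d a) := by
  ext n
  rw [coeff_formalDer, PowerSeries.coeff_C, PowerSeries.coeff_C]
  split_ifs <;> simp

theorem formalDer_map (d : Derivation ℂ A A) (r : R) :
    formalDer d (PowerSeries.map (algebraMap ℂ A) r) = 0 := by
  ext n
  simp

@[simp] theorem formalDer_X (d : Derivation ℂ A A) : formalDer d (PowerSeries.X : A⟦X⟧) = 0 := by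
  ext n
  rw [coeff_formalDer, PowerSeries.coeff_X]
  split_ifs <;> simp

theorem formalDer_smul (d : Derivation ℂ A A) (r : R) (f : A⟦X⟧) :
    formalDer d (r • f) = r • formalDer d f := by
  change formalDer d (PowerSeries.map (algebraMap ℂ A) r * f) =
    PowerSeries.map (algebraMap ℂ A) r * formalDer d f
  rw [Derivation.leibniz, formalDer_map]
  simp

theorem coeff_transvectant (d : Fin 2 → Derivation ℂ A A) (k n : ℕ) (f g : A⟦X⟧) :
    PowerSeries.coeff n (transvectant (fun a => formalDer (d a)) k f g) =
      ∑ y ∈ Finset.HasAntidiagonal.antidiagonal n,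
        transvectant d k (PowerSeries.coeff y.1 f) (PowerSeries.coeff y.2 g) := by
  induction k generalizing f g with
  | zero => simp [PowerSeries.coeff_mul]
  | succ k ih => simp [transvectant_succ, ih, Finset.sum_sub_distrib]


/-- The star product of formal power series over an algebra with two derivations. -/
noncomputable def formalStar (d : Fin 2 → Derivation ℂ A A) (κ : A) (f g : A⟦X⟧) : A⟦X⟧ :=
  PowerSeries.mk fun n => ∑ x ∈ Finset.HasAntidiagonal.antidiagonal n,
    ∑ y ∈ Finset.HasAntidiagonal.antidiagonal x.2,
    ((1 / (2 ^ x.1 * (x.1.factorial : ℂ)) : ℂ) •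
      (κ ^ x.1 * transvectant d x.1 (PowerSeries.coeff y.1 f) (PowerSeries.coeff y.2 g)))

/-- The Moyal bracket of formal power series over an algebra with two derivations. -/
noncomputable def formalBracket (d : Fin 2 → Derivation ℂ A A) (κ : A) (f g : A⟦X⟧) : A⟦X⟧ :=
  PowerSeries.mk fun n => ∑ x ∈ Finset.HasAntidiagonal.antidiagonal n,
    ∑ y ∈ Finset.HasAntidiagonal.antidiagonal x.2,
    if Even x.1 then
      ((1 / (2 ^ x.1 * ((x.1 + 1).factorial : ℂ)) : ℂ) •
        (κ ^ x.1 * transvectant d (x.1 + 1) (PowerSeries.coeff y.1 f) (PowerSeries.coeff y.2 g)))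
    else 0

/-- The transvectants of formal power series. -/
noncomputable abbrev formalTransvectant (d : Fin 2 → Derivation ℂ A A) (k : ℕ) (f g : A⟦X⟧) :
    A⟦X⟧ :=
  transvectant (fun a => formalDer (d a)) k f g

theorem formalDer_comm {d : Fin 2 → Derivation ℂ A A} (hd : ∀ f, d 0 (d 1 f) = d 1 (d 0 f))
    (f : A⟦X⟧) : formalDer (d 0) (formalDer (d 1) f) = formalDer (d 1) (formalDer (d 0) f) := by
  ext1 n
  simp [hd]

/-- The function `𝔮 κ`. -/
noncomputable def qkap (κ : A) : A⟦X⟧ := PowerSeries.X * PowerSeries.C κ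

theorem qkap_pow_mul (κ : A) (k : ℕ) (c : ℂ) (f : A⟦X⟧) :
    c • (qkap κ ^ k * f) = PowerSeries.X ^ k * PowerSeries.C (c • κ ^ k) * f := by
  have h : PowerSeries.C (c • κ ^ k) = c • (PowerSeries.C (κ ^ k) : A⟦X⟧) := by
    ext1 n
    rw [PowerSeries.coeff_C, PowerSeries.coeff_smul, PowerSeries.coeff_C]
    split_ifs <;> simp
  rw [h, qkap, mul_pow, map_pow, mul_smul_comm, smul_mul_assoc]

/-- The `k`-th summand is divisible by `X ^ k`, so any truncation beyond `n` gives the right `n`-th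
coefficient. -/
theorem coeff_sum_qkap (κ : A) (c : ℕ → ℂ) (F : ℕ → A⟦X⟧) (n N : ℕ) (h : n < N) :
    PowerSeries.coeff n (∑ k ∈ Finset.range N, c k • (qkap κ ^ k * F k)) =
      ∑ x ∈ Finset.HasAntidiagonal.antidiagonal n,
        c x.1 • (κ ^ x.1 * PowerSeries.coeff x.2 (F x.1)) := by
  rw [Finset.Nat.sum_antidiagonal_eq_sum_range_succ
    (fun i j => c i • (κ ^ i * PowerSeries.coeff j (F i))), map_sum]
  have h1 : ∀ k, PowerSeries.coeff n (c k • (qkap κ ^ k * F k)) =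
      if k ≤ n then c k • (κ ^ k * PowerSeries.coeff (n - k) (F k)) else 0 := by
    intro k
    rw [qkap_pow_mul, mul_assoc, PowerSeries.coeff_X_pow_mul', PowerSeries.coeff_C_mul,
      smul_mul_assoc]
  simp only [h1]
  rw [← Finset.sum_filter]
  refine Finset.sum_congr ?_ fun _ _ => rfl
  ext k
  simp only [Finset.mem_filter, Finset.mem_range]
  omega

variable (d : Fin 2 → Derivation ℂ A A) (κ : A)

/-- The first terms of the star product. -/
noncomputable def starTrunc (N : ℕ) (f g : A⟦X⟧) : A⟦X⟧ :=
  ∑ k ∈ Finset.range N, (1 / (2 ^ k * (k.factorial : ℂ)) : ℂ) •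
    (qkap κ ^ k * formalTransvectant d k f g)

theorem coeff_star_eq (f g : A⟦X⟧) {n N : ℕ} (h : n < N) :
    PowerSeries.coeff n (formalStar d κ f g) = PowerSeries.coeff n (starTrunc d κ N f g) := by
  rw [formalStar, PowerSeries.coeff_mk, starTrunc, coeff_sum_qkap κ _ _ n N h]
  simp only [coeff_transvectant, Finset.mul_sum, Finset.smul_sum]

/-- `X`-adic approximation by finite sums: bilinearity over constants and associativity are checked
modulo every `X ^ N` and then lifted by `formal_ext_of_dvd`. -/
theorem X_pow_dvd_star_sub (N : ℕ) (f g : A⟦X⟧) :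
    (PowerSeries.X : A⟦X⟧) ^ N ∣ formalStar d κ f g - starTrunc d κ N f g := by
  rw [PowerSeries.X_pow_dvd_iff]
  intro n hn
  rw [map_sub, coeff_star_eq d κ f g hn, sub_self]

theorem formal_ext_of_dvd {f g : A⟦X⟧}
    (h : ∀ N : ℕ, (PowerSeries.X : A⟦X⟧) ^ N ∣ f - g) : f = g := by
  rw [← sub_eq_zero]
  ext1 n
  exact PowerSeries.X_pow_dvd_iff.1 (h (n + 1)) n (Nat.lt_succ_self n)

/-- If the transvectants of order at least `N` vanish, the star product is a finite sum. -/
theorem star_eq_starTrunc {f g : A⟦X⟧} {N : ℕ}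
    (h : ∀ k, N ≤ k → formalTransvectant d k f g = 0) : formalStar d κ f g = starTrunc d κ N f g := by
  ext1 n
  -- The cut-off `N + (n + 1)` exceeds `n` and also has the first `N` terms as an initial segment.
  rw [coeff_star_eq d κ f g (show n < N + (n + 1) by omega), starTrunc, starTrunc,
    Finset.sum_range_add]
  rw [Finset.sum_eq_zero (s := Finset.range (n + 1)), add_zero]
  intro k _
  rw [h _ (Nat.le_add_right _ _), mul_zero, smul_zero]

theorem formalBracket_coeff_eq (f g : A⟦X⟧) {n N : ℕ} (h : n < N) :
    PowerSeries.coeff n (formalBracket d κ f g) = PowerSeries.coeff n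
      (∑ k ∈ Finset.range N, (if Even k then 1 / (2 ^ k * ((k + 1).factorial : ℂ)) else 0 : ℂ) •
        (qkap κ ^ k * formalTransvectant d (k + 1) f g)) := by
  rw [formalBracket, PowerSeries.coeff_mk, coeff_sum_qkap κ _ _ n N h]
  simp only [coeff_transvectant, Finset.mul_sum, Finset.smul_sum]
  refine Finset.sum_congr rfl fun x _ => Finset.sum_congr rfl fun y _ => ?_
  split_ifs
  · rfl
  · rw [zero_smul]

/-- If the transvectants of order at least three vanish, the Moyal bracket is the Poisson
bracket. -/
theorem formalBracket_eq_poisson {f g : A⟦X⟧}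
    (h : ∀ k, 3 ≤ k → formalTransvectant d k f g = 0) :
    formalBracket d κ f g = formalTransvectant d 1 f g := by
  ext1 n
  rw [formalBracket_coeff_eq d κ f g (show n < 1 + (n + 1) by omega), Finset.sum_range_add,
    Finset.sum_range_one]
  rw [Finset.sum_eq_zero (s := Finset.range (n + 1)), add_zero]
  · simp
  intro k _
  rcases Nat.eq_zero_or_pos k with rfl | hk
  · simp
  · rw [h _ (by omega), mul_zero, smul_zero]

/-- Even transvectants are symmetric and cancel, odd ones double. For even `k` the coefficient `2 /
(2^(k+1) (k+1)!)` is that of the bracket, once one factor `𝔮 κ` is pulled out. -/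
theorem star_sub_star (f g : A⟦X⟧) :
    formalStar d κ f g - formalStar d κ g f = qkap κ * formalBracket d κ f g := by
  ext1 n
  rw [map_sub, coeff_star_eq d κ f g (show n < n + 2 by omega),
    coeff_star_eq d κ g f (show n < n + 2 by omega), starTrunc, starTrunc, ← map_sub,
    ← Finset.sum_sub_distrib, show qkap κ * formalBracket d κ f g =
      PowerSeries.X * (PowerSeries.C κ * formalBracket d κ f g) from mul_assoc _ _ _]
  rw [show (PowerSeries.X : A⟦X⟧) * (PowerSeries.C κ * formalBracket d κ f g) =
    PowerSeries.X ^ 1 * (PowerSeries.C κ * formalBracket d κ f g) by rw [pow_one],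
    PowerSeries.coeff_X_pow_mul', PowerSeries.coeff_C_mul]
  rw [Finset.sum_range_succ']
  have h0 : formalTransvectant d 0 g f = formalTransvectant d 0 f g := by simp [mul_comm]
  rw [h0, sub_self, add_zero]
  have h1 : ∀ k, (1 / (2 ^ (k + 1) * ((k + 1).factorial : ℂ)) : ℂ) •
      (qkap κ ^ (k + 1) * formalTransvectant d (k + 1) f g) -
      (1 / (2 ^ (k + 1) * ((k + 1).factorial : ℂ)) : ℂ) •
        (qkap κ ^ (k + 1) * formalTransvectant d (k + 1) g f) =
      PowerSeries.X ^ 1 * (PowerSeries.C κ *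
        ((if Even k then 1 / (2 ^ k * ((k + 1).factorial : ℂ)) else 0 : ℂ) •
        (qkap κ ^ k * formalTransvectant d (k + 1) f g))) := by
    intro k
    have h2 : formalTransvectant d (k + 1) g f = (-1) ^ (k + 1) * formalTransvectant d (k + 1) f g :=
      transvectant_swap _ _ _ _
    rw [h2, pow_one, ← mul_assoc PowerSeries.X, ← qkap, mul_smul_comm, ← mul_assoc (qkap κ),
      ← pow_succ']
    rcases Nat.even_or_odd k with hk | hk
    · have h3 : (-1 : A⟦X⟧) ^ (k + 1) = -1 := hk.add_one.neg_one_pow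
      rw [h3, if_pos hk, neg_one_mul, mul_neg, smul_neg, sub_neg_eq_add,
        ← add_smul]
      congr 1
      have := Nat.factorial_ne_zero (k + 1)
      field_simp
      ring
    · have h3 : (-1 : A⟦X⟧) ^ (k + 1) = 1 := hk.add_one.neg_one_pow
      rw [h3, one_mul, sub_self, if_neg (Nat.not_even_iff_odd.2 hk), zero_smul]
  rw [Finset.sum_congr rfl fun k _ => h1 k, ← Finset.mul_sum, ← Finset.mul_sum,
    PowerSeries.coeff_X_pow_mul', PowerSeries.coeff_C_mul]
  split_ifs
  · rw [formalBracket_coeff_eq d κ f g (show n - 1 < n + 1 by omega)]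
  · rfl

variable {κ}

theorem formalTransvectant_dvd_left (k N : ℕ) {f f' g : A⟦X⟧}
    (h : (PowerSeries.X : A⟦X⟧) ^ N ∣ f - f') :
    (PowerSeries.X : A⟦X⟧) ^ N ∣ formalTransvectant d k f g - formalTransvectant d k f' g := by
  obtain ⟨x, hx⟩ := h
  rw [← transvectant_sub_left, hx, transvectant_const_mul_left]
  · exact dvd_mul_right _ _
  · intro a
    simp [Derivation.leibniz_pow]

theorem formalTransvectant_dvd_right (k N : ℕ) {f g g' : A⟦X⟧}
    (h : (PowerSeries.X : A⟦X⟧) ^ N ∣ g - g') :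
    (PowerSeries.X : A⟦X⟧) ^ N ∣ formalTransvectant d k f g - formalTransvectant d k f g' := by
  obtain ⟨x, hx⟩ := h
  rw [← transvectant_sub_right, hx, transvectant_const_mul_right]
  · exact dvd_mul_right _ _
  · intro a
    simp [Derivation.leibniz_pow]

theorem dvd_smul_formal {x y : A⟦X⟧} (c : ℂ) (h : x ∣ y) : x ∣ c • y := by
  obtain ⟨z, rfl⟩ := h
  exact ⟨c • z, by rw [mul_smul_comm]⟩

theorem starTrunc_dvd_left (N : ℕ) {f f' g : A⟦X⟧}
    (h : (PowerSeries.X : A⟦X⟧) ^ N ∣ f - f') :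
    (PowerSeries.X : A⟦X⟧) ^ N ∣ starTrunc d κ N f g - starTrunc d κ N f' g := by
  rw [starTrunc, starTrunc, ← Finset.sum_sub_distrib]
  refine Finset.dvd_sum fun k _ => ?_
  rw [← smul_sub, ← mul_sub]
  exact dvd_smul_formal _ ((formalTransvectant_dvd_left d k N h).mul_left _)

theorem starTrunc_dvd_right (N : ℕ) {f g g' : A⟦X⟧}
    (h : (PowerSeries.X : A⟦X⟧) ^ N ∣ g - g') :
    (PowerSeries.X : A⟦X⟧) ^ N ∣ starTrunc d κ N f g - starTrunc d κ N f g' := by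
  rw [starTrunc, starTrunc, ← Finset.sum_sub_distrib]
  refine Finset.dvd_sum fun k _ => ?_
  rw [← smul_sub, ← mul_sub]
  exact dvd_smul_formal _ ((formalTransvectant_dvd_right d k N h).mul_left _)

theorem transvectant_sum_left {B : Type} [CommRing B] [Algebra ℂ B] (D : Fin 2 → Derivation ℂ B B)
    {ι : Type} (s : Finset ι) (k : ℕ) (f : ι → B) (g : B) :
    transvectant D k (∑ i ∈ s, f i) g = ∑ i ∈ s, transvectant D k (f i) g := by
  simp [transvectant, TensorProduct.sum_tmul]

theorem transvectant_sum_right {B : Type} [CommRing B] [Algebra ℂ B] (D : Fin 2 → Derivation ℂ B B)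
    {ι : Type} (s : Finset ι) (k : ℕ) (f : ι → B) (g : B) :
    transvectant D k g (∑ i ∈ s, f i) = ∑ i ∈ s, transvectant D k g (f i) := by
  simp [transvectant, TensorProduct.tmul_sum]

theorem X_pow_dvd_qkap_pow (k N : ℕ) (h : N ≤ k) :
    (PowerSeries.X : A⟦X⟧) ^ N ∣ qkap κ ^ k := by
  rw [qkap, mul_pow]
  exact (pow_dvd_pow _ h).mul_right _

/-- A truncated double sum, reorganized by total degree. -/
theorem X_pow_dvd_double_sum (N : ℕ) (F : ℕ → ℕ → A⟦X⟧) :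
    (PowerSeries.X : A⟦X⟧) ^ N ∣
      ∑ k ∈ Finset.range N, ∑ l ∈ Finset.range N, qkap κ ^ (k + l) * F k l -
      ∑ n ∈ Finset.range N, qkap κ ^ n * ∑ p ∈ Finset.HasAntidiagonal.antidiagonal n, F p.1 p.2 := by
  have h1 : ∑ n ∈ Finset.range N, qkap κ ^ n *
      ∑ p ∈ Finset.HasAntidiagonal.antidiagonal n, F p.1 p.2 =
      ∑ k ∈ Finset.range N, ∑ l ∈ Finset.range (N - k), qkap κ ^ (k + l) * F k l := by
    rw [← Finset.sum_range_diag_flip]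
    refine Finset.sum_congr rfl fun n _ => ?_
    rw [Finset.Nat.sum_antidiagonal_eq_sum_range_succ (fun i j => F i j), Finset.mul_sum]
    refine Finset.sum_congr rfl fun k hk => ?_
    rw [Finset.mem_range] at hk
    rw [Nat.add_sub_cancel' (by omega)]
  rw [h1, ← Finset.sum_sub_distrib]
  refine Finset.dvd_sum fun k hk => ?_
  rw [Finset.mem_range] at hk
  -- The terms outside the triangle have second index at least `m = N - k`, hence total degree at
  -- least `N`.
  obtain ⟨m, rfl⟩ := Nat.exists_eq_add_of_le hk.le
  rw [show k + m = m + k from add_comm _ _, Finset.sum_range_add, Nat.add_sub_cancel,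
    add_sub_cancel_left]
  exact Finset.dvd_sum fun l _ => (X_pow_dvd_qkap_pow _ _ (by omega)).mul_right _

variable {d}

theorem dvd_sub_of_mul {B : Type} [CommRing B] {x a b c y : B} (h1 : x ∣ a - c * b)
    (h2 : x ∣ c * (y - b)) : x ∣ a - c * y := by
  have e : a - c * y = a - c * b - c * (y - b) := by ring
  exact e ▸ h1.sub h2

theorem dvd_sub_of_chain {B : Type} [CommRing B] {x a b c a' b' c' y : B} (h1 : x ∣ a - b)
    (h2 : x ∣ b - c) (h3 : x ∣ c - y) (h1' : x ∣ a' - b') (h2' : x ∣ b' - c')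
    (h3' : x ∣ c' - y) : x ∣ a - a' := by
  have e : a - a' = (a - b) + (b - c) + (c - y) - ((a' - b') + (b' - c') + (c' - y)) := by ring
  exact e ▸ ((h1.add h2).add h3).sub ((h1'.add h2').add h3')

/-- Associativity of the Moyal product. -/
theorem star_assoc (hd : ∀ f, d 0 (d 1 f) = d 1 (d 0 f)) (hκ : ∀ a, d a κ = 0) (f g h : A⟦X⟧) :
    formalStar d κ (formalStar d κ f g) h = formalStar d κ f (formalStar d κ g h) := by
  have hq : ∀ n a, formalDer (d a) (qkap κ ^ n) = 0 := by
    intro n a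
    simp [qkap, Derivation.leibniz_pow, hκ]
  let c : ℕ → ℂ := fun k => 1 / (2 ^ k * (k.factorial : ℂ))
  have hc : ∀ p : ℕ × ℕ, c p.1 * c p.2 =
      (1 / 2 ^ (p.1 + p.2)) * (1 / ((p.1.factorial : ℂ) * p.2.factorial)) := by
    intro p
    simp only [c, pow_add]
    have := Nat.factorial_ne_zero p.1
    have := Nat.factorial_ne_zero p.2
    field_simp
  have hl : ∀ N, starTrunc d κ N (starTrunc d κ N f g) h =
      ∑ k ∈ Finset.range N, ∑ l ∈ Finset.range N, qkap κ ^ (k + l) * ((c k * c l) •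
        formalTransvectant d k (formalTransvectant d l f g) h) := by
    intro N
    simp only [starTrunc, formalTransvectant, transvectant_sum_left, transvectant_smul_left,
      transvectant_const_mul_left _ (hq _), Finset.mul_sum, Finset.smul_sum]
    refine Finset.sum_congr rfl fun k _ => Finset.sum_congr rfl fun l _ => ?_
    rw [mul_smul_comm, smul_smul, mul_smul_comm, pow_add, mul_assoc]
  have hr : ∀ N, starTrunc d κ N f (starTrunc d κ N g h) =
      ∑ k ∈ Finset.range N, ∑ l ∈ Finset.range N, qkap κ ^ (k + l) * ((c k * c l) •
        formalTransvectant d k f (formalTransvectant d l g h)) := by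
    intro N
    simp only [starTrunc, formalTransvectant, transvectant_sum_right, transvectant_smul_right,
      transvectant_const_mul_right _ (hq _), Finset.mul_sum, Finset.smul_sum]
    refine Finset.sum_congr rfl fun k _ => Finset.sum_congr rfl fun l _ => ?_
    rw [mul_smul_comm, smul_smul, mul_smul_comm, pow_add, mul_assoc]
  have hm : ∀ n, ∑ p ∈ Finset.HasAntidiagonal.antidiagonal n, (c p.1 * c p.2) •
        formalTransvectant d p.1 (formalTransvectant d p.2 f g) h =
      ∑ p ∈ Finset.HasAntidiagonal.antidiagonal n, (c p.1 * c p.2) •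
        formalTransvectant d p.1 f (formalTransvectant d p.2 g h) := by
    intro n
    have h1 := congrArg (fun x => (1 / 2 ^ n : ℂ) • x)
      (sum_transvectant_assoc (D := fun a => formalDer (d a)) (formalDer_comm hd) n f g h)
    simp only [Finset.smul_sum, smul_smul] at h1
    refine (Finset.sum_congr rfl fun p hp => ?_).trans
      (h1.trans (Finset.sum_congr rfl fun p hp => ?_)) <;>
    · rw [Finset.HasAntidiagonal.mem_antidiagonal] at hp
      rw [hc, hp]
  -- Modulo `X ^ N` either bracketing is a double truncated sum; collected by total degree, the two
  -- agree by `hm`.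
  refine formal_ext_of_dvd fun N => ?_
  have d1 := X_pow_dvd_star_sub d κ N (formalStar d κ f g) h
  have d2 := starTrunc_dvd_left d (κ := κ) N (g := h) (X_pow_dvd_star_sub d κ N f g)
  have d3 := X_pow_dvd_star_sub d κ N f (formalStar d κ g h)
  have d4 := starTrunc_dvd_right d (κ := κ) N (f := f) (X_pow_dvd_star_sub d κ N g h)
  have d5 := X_pow_dvd_double_sum (κ := κ) N fun k l => (c k * c l) •
    formalTransvectant d k (formalTransvectant d l f g) h
  have d6 := X_pow_dvd_double_sum (κ := κ) N fun k l => (c k * c l) •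
    formalTransvectant d k f (formalTransvectant d l g h)
  rw [← hl] at d5
  rw [← hr] at d6
  simp only [hm] at d5
  exact dvd_sub_of_chain d1 d2 d5 d3 d4 d6

variable (d κ)

theorem star_add_left (f f' g : A⟦X⟧) :
    formalStar d κ (f + f') g = formalStar d κ f g + formalStar d κ f' g := by
  ext1 n
  rw [map_add, coeff_star_eq d κ _ _ n.lt_succ_self, coeff_star_eq d κ _ _ n.lt_succ_self,
    coeff_star_eq d κ _ _ n.lt_succ_self, ← map_add]
  simp only [starTrunc, transvectant_add_left, mul_add, smul_add, Finset.sum_add_distrib]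

theorem star_add_right (f g g' : A⟦X⟧) :
    formalStar d κ f (g + g') = formalStar d κ f g + formalStar d κ f g' := by
  ext1 n
  rw [map_add, coeff_star_eq d κ _ _ n.lt_succ_self, coeff_star_eq d κ _ _ n.lt_succ_self,
    coeff_star_eq d κ _ _ n.lt_succ_self, ← map_add]
  simp only [starTrunc, transvectant_add_right, mul_add, smul_add, Finset.sum_add_distrib]

theorem star_const_mul_left {c : A⟦X⟧} (hc : ∀ a, formalDer (d a) c = 0) (f g : A⟦X⟧) :
    formalStar d κ (c * f) g = c * formalStar d κ f g := by
  refine formal_ext_of_dvd fun N => ?_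
  have d1 := X_pow_dvd_star_sub d κ N (c * f) g
  have d2 := (X_pow_dvd_star_sub d κ N f g).mul_left c
  have h1 : starTrunc d κ N (c * f) g = c * starTrunc d κ N f g := by
    simp only [starTrunc, formalTransvectant, transvectant_const_mul_left _ hc, Finset.mul_sum]
    refine Finset.sum_congr rfl fun k _ => ?_
    rw [mul_smul_comm, mul_left_comm]
  rw [h1] at d1
  exact dvd_sub_of_mul d1 d2

theorem star_const_mul_right {c : A⟦X⟧} (hc : ∀ a, formalDer (d a) c = 0) (f g : A⟦X⟧) :
    formalStar d κ f (c * g) = c * formalStar d κ f g := by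
  refine formal_ext_of_dvd fun N => ?_
  have d1 := X_pow_dvd_star_sub d κ N f (c * g)
  have d2 := (X_pow_dvd_star_sub d κ N f g).mul_left c
  have h1 : starTrunc d κ N f (c * g) = c * starTrunc d κ N f g := by
    simp only [starTrunc, formalTransvectant, transvectant_const_mul_right _ hc, Finset.mul_sum]
    refine Finset.sum_congr rfl fun k _ => ?_
    rw [mul_smul_comm, mul_left_comm]
  rw [h1] at d1
  exact dvd_sub_of_mul d1 d2

theorem star_smul_left (r : R) (f g : A⟦X⟧) : formalStar d κ (r • f) g = r • formalStar d κ f g :=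
  star_const_mul_left d κ (fun _ => formalDer_map _ r) f g

theorem star_smul_right (r : R) (f g : A⟦X⟧) : formalStar d κ f (r • g) = r • formalStar d κ f g :=
  star_const_mul_right d κ (fun _ => formalDer_map _ r) f g

theorem star_one_left (g : A⟦X⟧) : formalStar d κ 1 g = g := by
  rw [star_eq_starTrunc d κ (N := 1)]
  · simp [starTrunc]
  · intro k hk
    obtain ⟨k, rfl⟩ := Nat.exists_eq_add_of_le' hk
    exact transvectant_one_left _ k g

theorem star_one_right (g : A⟦X⟧) : formalStar d κ g 1 = g := by
  rw [star_eq_starTrunc d κ (N := 1)]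
  · simp [starTrunc]
  · intro k hk
    obtain ⟨k, rfl⟩ := Nat.exists_eq_add_of_le' hk
    exact transvectant_one_right _ k g

theorem coeff_zero_star (f g : A⟦X⟧) : PowerSeries.coeff 0 (formalStar d κ f g) =
    PowerSeries.coeff 0 f * PowerSeries.coeff 0 g := by
  rw [coeff_star_eq d κ f g (Nat.lt_succ_self 0)]
  simp [starTrunc, PowerSeries.coeff_mul]

end Formal


/-! ### Identification with the analytic star product and bracket. -/

section StarProduct

variable {E : Type} [NormedAddCommGroup E] [NormedSpace ℂ E] {U : TopologicalSpace.Opens E}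

theorem poissonPow_eq (e : Fin 2 → E) (k : ℕ) (f g : SmoothFn U) :
    poissonPow e k f g = transvectant (B := SmoothFn U) (fun a => delDer (e a)) k f g := by
  have h : ∀ v : E, ⇑(delDer v : Derivation ℂ (SmoothFn U) (SmoothFn U)) = del v := fun _ => rfl
  rw [transvectant_eq_sum, poissonPow]
  · simp only [h]
  · intro f
    simp only [h]
    exact del_comm _ _ f

theorem star_eq (e : Fin 2 → E) (κ : SmoothFn U) :
    star e κ = formalStar (A := SmoothFn U) (fun a => delDer (e a)) κ := by
  funext f g
  rw [star, formalStar]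
  simp only [poissonPow_eq]

theorem moyalBracket_eq (e : Fin 2 → E) (κ : SmoothFn U) :
    moyalBracket e κ = formalBracket (A := SmoothFn U) (fun a => delDer (e a)) κ := by
  funext f g
  rw [moyalBracket, formalBracket]
  simp only [poissonPow_eq]

end StarProduct


/-! ### Fibre frames: Poisson brackets and contractions of the generators. -/

section Frame

variable {B : Type} [CommRing B] [Algebra ℂ B] {D : Fin 2 → Derivation ℂ B B}

/-- Holomorphic fibre coordinates `u`, constants `w` (the conjugate coordinates) and
`ν = 1 / [u w]`, with their derivatives along the fibre. -/
structure FibreFrame (D : Fin 2 → Derivation ℂ B B) (u w : Fin 2 → B) (ν K : B) : Prop where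
  der_u : ∀ a b, D a (u b) = if a = b then 1 else 0
  der_w : ∀ a b, D a (w b) = 0
  der_K : ∀ a, D a K = 0
  der_ν_zero : D 0 ν = -(w 1 * ν ^ 2)
  der_ν_one : D 1 ν = w 0 * ν ^ 2
  norm : (u 0 * w 1 - u 1 * w 0) * ν = 1

/-- `u^a u^b - K w^a w^b ν²`. -/
def quadFn (u w : Fin 2 → B) (ν K : B) (a b : Fin 2) : B :=
  u a * u b - K * (w a * w b * ν ^ 2)

/-- A single Poisson factor already gives zero: both gradients are multiples of the same constant
covector `(-w 1, w 0)`, and the two resulting terms are equal. -/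
theorem transvectant_inv_eq_zero {w : Fin 2 → B} {ν : B} (hw : ∀ a b, D a (w b) = 0)
    (h0 : D 0 ν = -(w 1 * ν ^ 2)) (h1 : D 1 ν = w 0 * ν ^ 2) {c c' : B} (hc : ∀ a, D a c = 0)
    (hc' : ∀ a, D a c' = 0) (k : ℕ) :
    transvectant D (k + 1) (c * ν ^ 2) (c' * ν ^ 2) = 0 := by
  rw [transvectant_const_mul_left _ hc, transvectant_const_mul_right _ hc', transvectant_succ]
  have e0 : D 0 (ν ^ 2) = w 1 * (-2 * ν ^ 3) := by
    simp [Derivation.leibniz_pow, h0]; ring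
  have e1 : D 1 (ν ^ 2) = w 0 * (2 * ν ^ 3) := by
    simp [Derivation.leibniz_pow, h1]; ring
  rw [e0, e1, transvectant_const_mul_left _ (fun a => hw a 1),
    transvectant_const_mul_right _ (fun a => hw a 0),
    transvectant_const_mul_left _ (fun a => hw a 0),
    transvectant_const_mul_right _ (fun a => hw a 1)]
  rw [transvectant_const_mul_left _ (c := -2) (fun a => by
      rw [map_neg]; simpa using (D a).map_natCast 2),
    transvectant_const_mul_right _ (c := 2) (fun a => by simpa using (D a).map_natCast 2),
    transvectant_const_mul_left _ (c := 2) (fun a => by simpa using (D a).map_natCast 2),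
    transvectant_const_mul_right _ (c := -2) (fun a => by
      rw [map_neg]; simpa using (D a).map_natCast 2)]
  ring

variable {u w : Fin 2 → B} {ν K : B}

theorem FibreFrame.transvectant_quad_left (hu : ∀ a b, D a (u b) = if a = b then 1 else 0)
    (a b : Fin 2) (g : B) (k : ℕ) : transvectant D (k + 3) (u a * u b) g = 0 := by
  simp only [transvectant_succ, Derivation.leibniz, smul_eq_mul, hu, map_add]
  fin_cases a <;> fin_cases b <;> simp

theorem FibreFrame.transvectant_quad_right (hu : ∀ a b, D a (u b) = if a = b then 1 else 0)
    (a b : Fin 2) (g : B) (k : ℕ) : transvectant D (k + 3) g (u a * u b) = 0 := by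
  rw [transvectant_swap, FibreFrame.transvectant_quad_left hu, mul_zero]

variable (h : FibreFrame D u w ν K)

include h

theorem FibreFrame.der_mul (c d : Fin 2) (a : Fin 2) : D a (w c * w d) = 0 := by
  simp [h.der_w]

theorem FibreFrame.transvectant_quadFn (a b d e : Fin 2) (k : ℕ) (hk : 3 ≤ k) :
    transvectant D k (quadFn u w ν K a b) (quadFn u w ν K d e) = 0 := by
  obtain ⟨k, rfl⟩ := Nat.exists_eq_add_of_le' hk
  rw [quadFn, quadFn, transvectant_sub_left, FibreFrame.transvectant_quad_left h.der_u,
    transvectant_sub_right, FibreFrame.transvectant_quad_right h.der_u,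
    transvectant_const_mul_left _ h.der_K, transvectant_const_mul_right _ h.der_K,
    transvectant_inv_eq_zero h.der_w h.der_ν_zero h.der_ν_one (h.der_mul _ _) (h.der_mul _ _)]
  simp

theorem FibreFrame.der_quadFn_zero (a b : Fin 2) : D 0 (quadFn u w ν K a b) =
    (if (0 : Fin 2) = a then u b else 0) + (if (0 : Fin 2) = b then u a else 0) +
      2 * K * w 1 * (w a * w b * ν ^ 3) := by
  simp only [quadFn, map_sub, Derivation.leibniz, Derivation.leibniz_pow, smul_eq_mul, h.der_u,
    h.der_K, h.der_w, h.der_ν_zero, mul_ite, mul_one, mul_zero, nsmul_eq_mul]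
  push_cast
  ring

theorem FibreFrame.der_quadFn_one (a b : Fin 2) : D 1 (quadFn u w ν K a b) =
    (if (1 : Fin 2) = a then u b else 0) + (if (1 : Fin 2) = b then u a else 0) -
      2 * K * w 0 * (w a * w b * ν ^ 3) := by
  simp only [quadFn, map_sub, Derivation.leibniz, Derivation.leibniz_pow, smul_eq_mul, h.der_u,
    h.der_K, h.der_w, h.der_ν_one, mul_ite, mul_one, mul_zero, nsmul_eq_mul]
  push_cast
  ring

theorem FibreFrame.poisson_quadFn (a b d e : Fin 2) :
    transvectant D 1 (quadFn u w ν K a b) (quadFn u w ν K d e) =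
      eps a d • quadFn u w ν K b e + eps a e • quadFn u w ν K b d +
        eps b d • quadFn u w ν K a e + eps b e • quadFn u w ν K a d := by
  rw [transvectant_one, h.der_quadFn_zero, h.der_quadFn_one, h.der_quadFn_zero, h.der_quadFn_one]
  have hN := h.norm
  simp only [quadFn, zsmul_eq_mul]
  have h2 : ∀ x : Fin 2, x = 0 ∨ x = 1 := by decide
  rw [← sub_eq_zero]
  -- The difference of the two sides is this explicit multiple of `[u w] ν - 1`; what remains is a
  -- ring identity for each choice of indices.
  refine Eq.trans ?_ (show (-K * ν ^ 2 * (eps a d * (w b * w e) + eps a e * (w b * w d) +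
    eps b d * (w a * w e) + eps b e * (w a * w d))) *
      ((u 0 * w 1 - u 1 * w 0) * ν - 1) = 0 by rw [hN, sub_self, mul_zero])
  rcases h2 a with rfl | rfl <;> rcases h2 b with rfl | rfl <;> rcases h2 d with rfl | rfl <;>
    rcases h2 e with rfl | rfl <;>
  · simp [eps]
    try ring

theorem FibreFrame.contract_mul :
    contract (fun f g => f * g) (quadFn u w ν K) = (-2 : ℤ) • K := by
  have hN := h.norm
  simp only [contract, quadFn, Fin.sum_univ_two, eps, zsmul_eq_mul, Fin.isValue, if_true,
    zero_ne_one, one_ne_zero, if_false]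
  push_cast
  -- The `u u u u` and `w w w w` terms contract to zero. With `Z = [u w] ν` the difference of the
  -- sides is `-2 K (Z² - 1)`, which factors through `Z - 1`.
  linear_combination (-2 * K * ((u 0 * w 1 - u 1 * w 0) * ν + 1)) * hN

/-- The contraction is symmetric in its two arguments, while the first transvectant is
antisymmetric. -/
theorem FibreFrame.contract_transvectant_one :
    contract (transvectant D 1) (quadFn u w ν K) = 0 := by
  simp only [contract, Fin.sum_univ_two, h.poisson_quadFn, eps]
  simp [quadFn]
  ring

/-- Only the quadratic parts `u u` contribute. Second derivatives of `ν²` are proportional to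
products of two `w`'s, so each term involving the correction contains a contraction of `w` with
itself. -/
theorem FibreFrame.contract_transvectant_two :
    contract (transvectant D 2) (quadFn u w ν K) = 12 := by
  have hN := h.norm
  have e0 : ∀ x y : Fin 2, D 0 (if x = y then (1 : B) else 0) = 0 := by
    intro x y; split_ifs <;> simp
  simp only [contract, Fin.sum_univ_two, eps, transvectant_succ, h.der_quadFn_zero,
    h.der_quadFn_one, transvectant_zero, zsmul_eq_mul, Fin.isValue, if_true,
    zero_ne_one, one_ne_zero, if_false, map_add, map_sub, Derivation.leibniz,
    Derivation.leibniz_pow, smul_eq_mul, h.der_u,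
    h.der_K, h.der_w, h.der_ν_zero, h.der_ν_one, mul_one, mul_zero, nsmul_eq_mul, map_zero]
  push_cast
  simp
  ring_nf

end Frame


/-! ### The deformed Cauchy–Riemann equation in a frame. -/

section Holomorphy

variable {B : Type} [CommRing B] [Algebra ℂ B] {D : Fin 2 → Derivation ℂ B B}
  {u w : Fin 2 → B} {ν K : B}

theorem FibreFrame.transvectant_inv_quadFn (h : FibreFrame D u w ν K) {c : B}
    (hc : ∀ a, D a c = 0) (a b : Fin 2) (k : ℕ) (hk : 3 ≤ k) :
    transvectant D k (K * (c * ν ^ 2)) (quadFn u w ν K a b) = 0 := by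
  obtain ⟨k, rfl⟩ := Nat.exists_eq_add_of_le' hk
  rw [quadFn, transvectant_const_mul_left _ h.der_K,
    transvectant_sub_right, FibreFrame.transvectant_quad_right h.der_u,
    transvectant_const_mul_right _ h.der_K,
    transvectant_inv_eq_zero h.der_w h.der_ν_zero h.der_ν_one hc (h.der_mul _ _)]
  simp

/-- `∂̄ X^{ab} + {h, X^{ab}} = 0`. -/
theorem FibreFrame.holomorphy (h : FibreFrame D u w ν K) (δ : Derivation ℂ B B) {ξ : Fin 2 → B}
    {c : B} (hu : ∀ a, δ (u a) = 0) (hw : ∀ a, δ (w a) = ξ a) (hK : δ K = 0)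
    (hν : δ ν = -((u 0 * ξ 1 - u 1 * ξ 0) * ν ^ 2)) (hc : ∀ a, D a c = 0)
    (hcξ : 2 * c = w 0 * ξ 1 - w 1 * ξ 0) (a b : Fin 2) :
    δ (quadFn u w ν K a b) + transvectant D 1 (K * (c * ν ^ 2)) (quadFn u w ν K a b) = 0 := by
  have h0 : transvectant D 1 (c * ν ^ 2) (w a * w b * ν ^ 2) = 0 :=
    transvectant_inv_eq_zero h.der_w h.der_ν_zero h.der_ν_one hc (h.der_mul _ _) 0
  have hN := h.norm
  rw [quadFn, transvectant_const_mul_left _ h.der_K, transvectant_sub_right,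
    transvectant_const_mul_right _ h.der_K, h0, transvectant_one]
  simp only [map_sub, Derivation.leibniz, Derivation.leibniz_pow, smul_eq_mul, h.der_u, hu, hw, hK,
    hν, hc, h.der_ν_zero, h.der_ν_one, mul_zero, add_zero, zero_sub, nsmul_eq_mul, mul_ite, mul_one]
  push_cast
  -- The sum is a combination of the frame relation `[u w] ν = 1` and of the relation `2 c = [w ξ]`
  -- that fixes the form `h`.
  refine Eq.trans ?_ (show (K * ν ^ 2 * (ξ a * w b + ξ b * w a)) *
      ((u 0 * w 1 - u 1 * w 0) * ν - 1) - (K * ν ^ 3 * (w a * u b + w b * u a)) *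
      (2 * c - (w 0 * ξ 1 - w 1 * ξ 0)) = 0 by rw [hN, hcξ]; ring)
  have h2 : ∀ x : Fin 2, x = 0 ∨ x = 1 := by decide
  rcases h2 a with rfl | rfl <;> rcases h2 b with rfl | rfl <;>
  · simp
    ring

end Holomorphy

/-! ### Star products truncated at second order. -/

section FormalFrame

variable {A : Type} [CommRing A] [Algebra ℂ A] {d : Fin 2 → Derivation ℂ A A}

theorem C_smul_formal (z : ℂ) (f : A⟦X⟧) : (PowerSeries.C z : R) • f = z • f := by
  change PowerSeries.map (algebraMap ℂ A) (PowerSeries.C z) * f = _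
  ext1 n
  rw [PowerSeries.map_C, PowerSeries.coeff_C_mul, PowerSeries.coeff_smul, Algebra.smul_def]

theorem formalStar_eq_of_transvectant (κ : A) {f g : A⟦X⟧}
    (h : ∀ k, 3 ≤ k → formalTransvectant d k f g = 0) :
    formalStar d κ f g = f * g + (1 / 2 : ℂ) • (qkap κ * formalTransvectant d 1 f g) +
      (1 / 8 : ℂ) • (qkap κ ^ 2 * formalTransvectant d 2 f g) := by
  rw [star_eq_starTrunc _ _ h, starTrunc]
  simp only [Finset.sum_range_succ, Finset.sum_range_zero]
  norm_num [Nat.factorial]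

/-- The second-order weight `1 / (2² 2!) = 1/8` times the contraction `12` gives `3/2`. -/
theorem contract_formalStar (κ : A) {T : Fin 2 → Fin 2 → A⟦X⟧}
    (h : ∀ a b c e k, 3 ≤ k → formalTransvectant d k (T a b) (T c e) = 0)
    (h1 : contract (formalTransvectant d 1) T = 0)
    (h2 : contract (formalTransvectant d 2) T = 12) :
    contract (formalStar d κ) T = contract (fun f g => f * g) T +
      (PowerSeries.C (3 / 2) : R) • qkap κ ^ 2 := by
  have key : contract (formalStar d κ) T = contract (fun f g => f * g) T +
      (1 / 2 : ℂ) • (qkap κ * contract (formalTransvectant d 1) T) +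
      (1 / 8 : ℂ) • (qkap κ ^ 2 * contract (formalTransvectant d 2) T) := by
    simp only [contract, formalStar_eq_of_transvectant κ (h _ _ _ _), smul_add,
      Finset.sum_add_distrib, Finset.mul_sum, Finset.smul_sum, mul_smul_comm,
      smul_comm (_ : ℤ) (_ : ℂ)]
  rw [key, h1, h2, mul_zero, smul_zero, add_zero, C_smul_formal,
    show (12 : A⟦X⟧) = (12 : ℂ) • 1 by rw [Algebra.smul_def, map_ofNat, mul_one], mul_smul_comm,
    smul_smul, mul_one]
  norm_num

theorem FibreFrame.formal_holomorphy {u w : Fin 2 → A⟦X⟧} {ν K : A⟦X⟧} (κ : A)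
    (h : FibreFrame (fun a => formalDer (d a)) u w ν K) (δ : Derivation ℂ A⟦X⟧ A⟦X⟧)
    {ξ : Fin 2 → A⟦X⟧} {c : A⟦X⟧} (hu : ∀ a, δ (u a) = 0) (hw : ∀ a, δ (w a) = ξ a) (hK : δ K = 0)
    (hν : δ ν = -((u 0 * ξ 1 - u 1 * ξ 0) * ν ^ 2)) (hc : ∀ a, formalDer (d a) c = 0)
    (hcξ : 2 * c = w 0 * ξ 1 - w 1 * ξ 0) (a b : Fin 2) :
    δ (quadFn u w ν K a b) + formalBracket d κ (K * (c * ν ^ 2)) (quadFn u w ν K a b) = 0 := by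
  rw [formalBracket_eq_poisson _ _ (h.transvectant_inv_quadFn hc a b)]
  exact h.holomorphy δ hu hw hK hν hc hcξ a b

end FormalFrame

/-! ### The generators on twistor space. -/

section TwistorSpace

/-- The holomorphic derivatives along the fibres of twistor space. -/
noncomputable abbrev ptDer (a : Fin 2) : Derivation ℂ (SmoothFn PT) (SmoothFn PT) :=
  delDer (fibDir a)

theorem delDer_mu (a b : Fin 2) : delDer (fibDir a) (mu b) = if a = b then 1 else 0 := by
  rw [delDer_apply, mu, del_linFn]
  change algebraMap ℂ _ ((Pi.single a 1 : Spinor) b) = _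
  rw [Pi.single_apply]
  simp only [eq_comm (a := b)]
  split_ifs <;> simp

theorem delDer_muHat (a b : Fin 2) : delDer (fibDir a) (muHat b) = 0 := by
  fin_cases b
  · change delDer _ (-conjFn (mu 1)) = 0
    rw [map_neg, delDer_apply, mu, del_conj_linFn, neg_zero]
  · exact del_conj_linFn _ _

theorem normMu_mul_inv : (mu 0 * muHat 1 - mu 1 * muHat 0) * invNormMu = 1 :=
  mul_invFn _ _

theorem delDer_invNormMu_zero : delDer (fibDir 0) invNormMu = -(muHat 1 * invNormMu ^ 2) := by
  rw [derivation_inv _ normMu_mul_inv]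
  simp [delDer_mu, delDer_muHat]

theorem delDer_invNormMu_one : delDer (fibDir 1) invNormMu = muHat 0 * invNormMu ^ 2 := by
  rw [derivation_inv _ normMu_mul_inv]
  simp [delDer_mu, delDer_muHat]
  ring

theorem delDer_kap (α β : Spinor) (a : Fin 2) : delDer (fibDir a) (kap α β) = 0 := by
  have h : ∀ b, delDer (fibDir a) (lam b) = 0 := fun b => by
    rw [delDer_apply, lam, del_linFn]
    exact map_zero _
  simp [kap, sp, h]

theorem formalDer_cSqLam (α β : Spinor) (c : R) (d : Derivation ℂ (SmoothFn PT) (SmoothFn PT))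
    (h : d (kap α β) = 0) : formalDer d (cSqLam α β c) = 0 := by
  rw [cSqLam, formalDer_smul, formalDer_C, Derivation.leibniz_pow, h]
  simp

/-- The coordinate frame of the twistor fibres. -/
theorem twistorFrame (α β : Spinor) (c : R) :
    FibreFrame (fun a => formalDer (ptDer a)) (fun a => PowerSeries.C (mu a))
      (fun a => PowerSeries.C (muHat a)) (PowerSeries.C invNormMu) (cSqLam α β c) where
  der_u a b := by
    rw [formalDer_C, delDer_mu]
    split_ifs <;> simp
  der_w a b := by rw [formalDer_C, delDer_muHat, map_zero]
  der_K a := formalDer_cSqLam α β c _ (delDer_kap α β a)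
  der_ν_zero := by rw [formalDer_C, delDer_invNormMu_zero]; simp
  der_ν_one := by rw [formalDer_C, delDer_invNormMu_one]; simp
  norm := by simp only [← map_mul, ← map_sub, normMu_mul_inv, map_one]

theorem XX_eq_quadFn (α β : Spinor) (c : R) (a b : Fin 2) : XX α β c a b =
    quadFn (fun a => PowerSeries.C (mu a)) (fun a => PowerSeries.C (muHat a))
      (PowerSeries.C invNormMu) (cSqLam α β c) a b := by
  simp only [XX, quadFn, map_mul, map_pow]

theorem XX_eq_quadFn' (α β : Spinor) (c : R) : XX α β c =
    quadFn (fun a => PowerSeries.C (mu a)) (fun a => PowerSeries.C (muHat a))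
      (PowerSeries.C invNormMu) (cSqLam α β c) := by
  funext a b
  exact XX_eq_quadFn α β c a b

theorem qLam_eq (α β : Spinor) : qLam α β = qkap (kap α β) := by
  change PowerSeries.map (algebraMap ℂ (SmoothFn PT)) PowerSeries.X * _ = _
  rw [PowerSeries.map_X]
  rfl

theorem starPT_eq (α β : Spinor) :
    starPT α β = formalStar ptDer (kap α β) := star_eq _ _

theorem bracketPT_eq (α β : Spinor) :
    bracketPT α β = formalBracket ptDer (kap α β) := moyalBracket_eq _ _

theorem transvectant_XX (α β : Spinor) (c : R) (a b d e : Fin 2) (k : ℕ) (hk : 3 ≤ k) :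
    formalTransvectant ptDer k (XX α β c a b) (XX α β c d e) = 0 := by
  rw [XX_eq_quadFn, XX_eq_quadFn]
  exact (twistorFrame α β c).transvectant_quadFn a b d e k hk

theorem bracket_XX (α β : Spinor) (c : R) (a b d e : Fin 2) :
    bracketPT α β (XX α β c a b) (XX α β c d e) =
      eps a d • XX α β c b e + eps a e • XX α β c b d +
        eps b d • XX α β c a e + eps b e • XX α β c a d := by
  rw [bracketPT_eq, formalBracket_eq_poisson]
  · simp only [XX_eq_quadFn]
    exact (twistorFrame α β c).poisson_quadFn a b d e
  · exact transvectant_XX α β c a b d e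

theorem star_commutator_PT (α β : Spinor) (f g : FormalFn PT) :
    starPT α β f g - starPT α β g f = qLam α β * bracketPT α β f g := by
  rw [starPT_eq, bracketPT_eq, qLam_eq]
  exact star_sub_star _ _ _ _

theorem contract_mul_XX (α β : Spinor) (c : R) :
    contract (fun f g => f * g) (XX α β c) = (-2 : ℤ) • cSqLam α β c := by
  rw [XX_eq_quadFn']
  exact (twistorFrame α β c).contract_mul

theorem contract_star_XX (α β : Spinor) (c : R) :
    contract (starPT α β) (XX α β c) = contract (fun f g => f * g) (XX α β c) +
      (PowerSeries.C (3 / 2) : R) • qLam α β ^ 2 := by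
  have h1 := (twistorFrame α β c).contract_transvectant_one
  have h2 := (twistorFrame α β c).contract_transvectant_two
  rw [← XX_eq_quadFn'] at h1 h2
  rw [starPT_eq, qLam_eq]
  exact contract_formalStar _ (transvectant_XX α β c) h1 h2

theorem delBarDer_mu (v : Spinor × Spinor) (b : Fin 2) : delBarDer v (mu b) = 0 :=
  delBar_linFn _ _

theorem delBarDer_muHat (v : Spinor × Spinor) (b : Fin 2) :
    delBarDer v (muHat b) = algebraMap ℂ _ (hat v.1 b) := by
  fin_cases b
  · change delBarDer v (-conjFn (mu 1)) = algebraMap ℂ _ (-conj (v.1 1))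
    rw [map_neg, delBarDer_apply, mu, delBar_conj_linFn, map_neg]
    rfl
  · exact delBar_conj_linFn _ _

theorem delBarDer_kap (α β : Spinor) (v : Spinor × Spinor) : delBarDer v (kap α β) = 0 := by
  have h : ∀ b, delBarDer v (lam b) = 0 := fun b => delBar_linFn _ _
  simp [kap, sp, h]

theorem delBarDer_invNormMu (v : Spinor × Spinor) : delBarDer v invNormMu =
    -((mu 0 * algebraMap ℂ _ (hat v.1 1) - mu 1 * algebraMap ℂ _ (hat v.1 0)) *
      invNormMu ^ 2) := by
  rw [derivation_inv _ normMu_mul_inv]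
  simp [delBarDer_mu, delBarDer_muHat]

/-- The coefficient `[μ̂ dμ̂] / 2` of the form `h`, contracted with a vector. -/
noncomputable def halfMuHat (v : Spinor × Spinor) : SmoothFn PT :=
  (1 / 2 : ℂ) • sp muHat (fun a => algebraMap ℂ (SmoothFn PT) (hat v.1 a))

theorem delDer_halfMuHat (v : Spinor × Spinor) (a : Fin 2) :
    delDer (fibDir a) (halfMuHat v) = 0 := by
  simp [halfMuHat, sp, delDer_muHat]

theorem two_mul_halfMuHat (v : Spinor × Spinor) : 2 * halfMuHat v =
    muHat 0 * algebraMap ℂ _ (hat v.1 1) - muHat 1 * algebraMap ℂ _ (hat v.1 0) := by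
  rw [halfMuHat, sp, mul_smul_comm, ← map_ofNat (algebraMap ℂ (SmoothFn PT)) 2,
    ← Algebra.smul_def, smul_smul]
  norm_num

theorem hForm_eq (α β : Spinor) (c : R) (v : Spinor × Spinor) :
    hForm α β c v =
      cSqLam α β c * (PowerSeries.C (halfMuHat v) * PowerSeries.C invNormMu ^ 2) := by
  rw [hForm, ← map_pow, ← map_mul, halfMuHat, smul_mul_assoc]

theorem nablaBar_eq (α β : Spinor) (c : R) (v : Spinor × Spinor) (f : FormalFn PT) :
    nablaBar α β c v f = formalDer (A := SmoothFn PT) (delBarDer v) f +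
      formalBracket ptDer (kap α β)
        (cSqLam α β c * (PowerSeries.C (halfMuHat v) * PowerSeries.C invNormMu ^ 2)) f := by
  rw [← hForm_eq, ← bracketPT_eq]
  refine congrArg (· + bracketPT α β (hForm α β c v) f) ?_
  ext1 n
  rw [coeff_formalDer, PowerSeries.coeff_mk, delBarDer_apply]

theorem isHolo_XX (α β : Spinor) (c : R) (a b : Fin 2) : IsHolo α β c (XX α β c a b) := by
  intro v
  rw [nablaBar_eq, XX_eq_quadFn]
  -- Contracted with `v`, the operator `∂̄` annihilates `μ` and `λ` and sends `μ̂` to the constant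
  -- `hat v.1`, which plays the role of `ξ`.
  refine (twistorFrame α β c).formal_holomorphy (kap α β) (formalDer (A := SmoothFn PT) (delBarDer v))
    (ξ := fun a => PowerSeries.C (algebraMap ℂ _ (hat v.1 a))) (fun a => ?_) (fun a => ?_)
    (formalDer_cSqLam α β c _ (delBarDer_kap α β v)) ?_ (fun a => ?_) ?_ a b
  · rw [formalDer_C, delBarDer_mu, map_zero]
  · rw [formalDer_C, delBarDer_muHat]
  · rw [formalDer_C, delBarDer_invNormMu]
    simp only [map_neg, map_mul, map_sub, map_pow]
  · rw [formalDer_C, delDer_halfMuHat, map_zero]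
  · rw [← map_ofNat PowerSeries.C 2, ← map_mul, two_mul_halfMuHat]
    simp only [map_mul, map_sub]

end TwistorSpace

/-! ### Restriction to a fibre. -/

section Restriction

variable {A A' : Type} [CommRing A] [Algebra ℂ A] [CommRing A'] [Algebra ℂ A']

theorem map_transvectant {d : Fin 2 → Derivation ℂ A A} {d' : Fin 2 → Derivation ℂ A' A'}
    (ρ : A →ₐ[ℂ] A') (h : ∀ a f, ρ (d a f) = d' a (ρ f)) (k : ℕ) (f g : A) :
    ρ (transvectant d k f g) = transvectant d' k (ρ f) (ρ g) := by
  induction k generalizing f g with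
  | zero => simp
  | succ k ih => simp [transvectant_succ, ih, h]

theorem map_formalStar {d : Fin 2 → Derivation ℂ A A} {d' : Fin 2 → Derivation ℂ A' A'}
    (ρ : A →ₐ[ℂ] A') (h : ∀ a f, ρ (d a f) = d' a (ρ f)) (κ : A) (f g : A⟦X⟧) :
    PowerSeries.map (ρ : A →+* A') (formalStar d κ f g) =
      formalStar d' (ρ κ) (PowerSeries.map (ρ : A →+* A') f)
        (PowerSeries.map (ρ : A →+* A') g) := by
  ext1 n
  simp [formalStar, map_transvectant ρ h]

theorem map_formalBracket {d : Fin 2 → Derivation ℂ A A} {d' : Fin 2 → Derivation ℂ A' A'}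
    (ρ : A →ₐ[ℂ] A') (h : ∀ a f, ρ (d a f) = d' a (ρ f)) (κ : A) (f g : A⟦X⟧) :
    PowerSeries.map (ρ : A →+* A') (formalBracket d κ f g) =
      formalBracket d' (ρ κ) (PowerSeries.map (ρ : A →+* A') f)
        (PowerSeries.map (ρ : A →+* A') g) := by
  ext1 n
  simp [formalBracket, map_transvectant ρ h, apply_ite ρ]

theorem resFn_delDer (l : Spinor) (hl : l ≠ 0) (a : Fin 2) (f : SmoothFn PT) :
    resFn l hl (delDer (fibDir a) f) = delDer (Pi.single a 1) (resFn l hl f) := by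
  have h : ∀ x v : Spinor, fderiv ℝ (fun m : Spinor => (m, l)) x v = (v, 0) := fun x v => by
    have h1 : HasFDerivAt (fun m : Spinor => (m, l)) ((ContinuousLinearMap.id ℝ Spinor).prod 0) x :=
      (hasFDerivAt_id x).prodMk (hasFDerivAt_const l x)
    rw [h1.fderiv]
    rfl
  refine (del_pullback _ _ _ _ _ (fun x => h x _) (fun x => ?_) f).symm
  rw [h]
  simp

theorem res_star (α β l : Spinor) (hl : l ≠ 0) (f g : FormalFn PT) :
    res l hl (starPT α β f g) = starFib α β l (res l hl f) (res l hl g) := by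
  rw [starPT_eq, starFib, star_eq]
  exact map_formalStar (resFn l hl) (resFn_delDer l hl) _ f g

theorem res_bracket (α β l : Spinor) (hl : l ≠ 0) (f g : FormalFn PT) :
    res l hl (bracketPT α β f g) = bracketFib α β l (res l hl f) (res l hl g) := by
  rw [bracketPT_eq, bracketFib, moyalBracket_eq]
  exact map_formalBracket (resFn l hl) (resFn_delDer l hl) _ f g

end Restriction


/-! ### Triples with the relations of `sl_{2,t}` and their generating polynomial. -/

section Triple

variable {K : Type} [CommRing K] {A : Type} [Ring A] [Algebra K A]

/-- Elements `x 0, x 1, x 2` (that is, `x⁰⁰, x⁰¹, x¹¹`) of an associative algebra that satisfy the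
relations of `sl_{2,t}`, with Casimir `t² z`. -/
structure ScaledTriple (x : Fin 3 → A) (t z : K) : Prop where
  comm01 : x 0 * x 1 - x 1 * x 0 = (2 * t) • x 0
  comm02 : x 0 * x 2 - x 2 * x 0 = (4 * t) • x 1
  comm12 : x 1 * x 2 - x 2 * x 1 = (2 * t) • x 2
  casimir : x 0 * x 2 + x 2 * x 0 - (2 : K) • (x 1 * x 1) =
    (-8 * (z * t ^ 2)) • (1 : A)

/-- The relations between a generating polynomial and its derivatives. -/
structure TripleRelations {P : Type} [Ring P] [Algebra K P] (e h f : P) (t z : K) :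
    Prop where
  he : h * e = e * h - (4 * t) • e
  fe : f * e = e * f - (4 * t) • h
  hh : h * h = e * f + f * e + (16 * (z * t ^ 2)) • 1

section NormalOrder

variable {P : Type} [Ring P] [Algebra K P] {e h f : P} {t z : K}
  (r : TripleRelations e h f t z)

include r

theorem TripleRelations.h_mul_pow (m : ℕ) :
    h * e ^ m = e ^ m * h - (4 * t * m) • e ^ m := by
  induction m with
  | zero => simp
  | succ m ih =>
    rw [pow_succ, ← mul_assoc, ih, sub_mul, mul_assoc, r.he, smul_mul_assoc, mul_sub,
      mul_smul_comm, mul_assoc]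
    rw [← mul_assoc]
    push_cast
    module

theorem TripleRelations.f_mul_pow (m : ℕ) : f * e ^ (m + 1) = e ^ (m + 1) * f -
    (4 * t * (m + 1)) • (e ^ m * h) + (8 * t ^ 2 * (m * (m + 1))) • e ^ m := by
  induction m with
  | zero => simp [r.fe]
  | succ m ih =>
    rw [pow_succ, ← mul_assoc, ih, add_mul, sub_mul, smul_mul_assoc, smul_mul_assoc, mul_assoc,
      mul_assoc (e ^ m) h e, r.he, r.fe, ← pow_succ]
    simp only [mul_sub, mul_smul_comm, ← mul_assoc, ← pow_succ]
    push_cast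
    module

end NormalOrder

/-- `f` acting on a power of `e`, in terms of a derivation `d` with `e ↦ h ↦ f ↦ 0`. -/
theorem TripleRelations.f_mul_pow_eq {P : Type} [Ring P] [Algebra K P] {e h f : P} {t z : K}
    (r : TripleRelations e h f t z) (d : P →ₗ[K] P) (hd : ∀ a b, d (a * b) = d a * b + a * d b)
    (de : d e = h) (dh : d h = f) (m : ℕ) :
    (((m : K) + 2) * (2 * m + 3)) • (f * e ^ (m + 1)) = d (d (e ^ (m + 2))) -
      (2 * t * ((m + 2) * (2 * m + 3))) • d (e ^ (m + 1)) +
      (4 * t ^ 2 * ((m + 1) * (m + 2) * ((m + 1) ^ 2 - (4 * z + 1)))) • e ^ m := by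
  have hpow : ∀ m : ℕ, d (e ^ (m + 1)) = ((m : K) + 1) • (e ^ m * h) -
      (2 * t * (m * (m + 1))) • e ^ m := by
    intro m
    induction m with
    | zero => simp [de]
    | succ m ih =>
      rw [pow_succ, hd, ih, de, sub_mul, smul_mul_assoc, smul_mul_assoc, mul_assoc, r.he]
      simp only [mul_sub, mul_smul_comm, ← mul_assoc, ← pow_succ]
      push_cast
      module
  -- The second derivative produces `h * h`; this is the only place where the Casimir relation
  -- `r.hh` enters.
  have h1 : d (e ^ (m + 1) * h) = ((m : K) + 1) • (2 • (e ^ (m + 1) * f) - (4 * t) • (e ^ m * h) +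
      (16 * (z * t ^ 2)) • e ^ m) - (2 * t * (m * (m + 1))) • (e ^ m * h) +
      e ^ (m + 1) * f := by
    rw [hd, dh, hpow, sub_mul, smul_mul_assoc, smul_mul_assoc, mul_assoc (e ^ m), r.hh, r.fe]
    simp only [mul_sub, mul_add, mul_smul_comm, ← mul_assoc, ← pow_succ, mul_one]
    module
  rw [hpow (m + 1), map_sub, map_smul, map_smul, h1, hpow m, r.f_mul_pow]
  push_cast
  module

theorem TripleRelations.h_mul_pow_eq {P : Type} [Ring P] [Algebra K P] {e h f : P} {t z : K}
    (r : TripleRelations e h f t z) (d : P →ₗ[K] P) (hd : ∀ a b, d (a * b) = d a * b + a * d b)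
    (de : d e = h) (m : ℕ) :
    ((m : K) + 1) • (h * e ^ m) = d (e ^ (m + 1)) - (2 * t * (m * (m + 1))) • e ^ m := by
  have hpow : ∀ m : ℕ, d (e ^ (m + 1)) = ((m : K) + 1) • (e ^ m * h) -
      (2 * t * (m * (m + 1))) • e ^ m := by
    intro m
    induction m with
    | zero => simp [de]
    | succ m ih =>
      rw [pow_succ, hd, ih, de, sub_mul, smul_mul_assoc, smul_mul_assoc, mul_assoc, r.he]
      simp only [mul_sub, mul_smul_comm, ← mul_assoc, ← pow_succ]
      push_cast
      module
  rw [hpow, r.h_mul_pow]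
  module

section Generating

open Polynomial

variable (x : Fin 3 → A) {t z : K}

/-- The generating polynomial `x⁰⁰ + 2 y x⁰¹ + y² x¹¹`. -/
noncomputable def genPoly : A[X] :=
  monomial 0 (x 0) + monomial 1 (x 1 + x 1) + monomial 2 (x 2)

theorem derivative_genPoly :
    derivative (genPoly x) = monomial 0 (x 1 + x 1) + monomial 1 (x 2 + x 2) := by
  simp [genPoly, derivative_monomial, mul_two, one_add_one_eq_two]

theorem derivative_derivative_genPoly :
    derivative (derivative (genPoly x)) = monomial 0 (x 2 + x 2) := by
  simp [derivative_genPoly, derivative_monomial]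

variable {x}

/-- Up to the factor `-2 t`, commuting with `x¹¹` is differentiation in `y`, so these relations are
translates of the ones at `y = 0`; they are checked coefficient by coefficient. The relation for `h
* h` says that the discriminant of the generating polynomial is the Casimir. -/
theorem ScaledTriple.relations (hx : ScaledTriple x t z) :
    TripleRelations (genPoly x) (derivative (genPoly x)) (derivative (derivative (genPoly x)))
      t z := by
  have h01 := hx.comm01
  have h02 := hx.comm02
  have h12 := hx.comm12
  have hc := hx.casimir
  have e01 : x 1 * x 0 = x 0 * x 1 - (2 * t) • x 0 := by rw [← h01]; abel
  have e02 : x 2 * x 0 = x 0 * x 2 - (4 * t) • x 1 := by rw [← h02]; abel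
  have e12 : x 2 * x 1 = x 1 * x 2 - (2 * t) • x 2 := by rw [← h12]; abel
  rw [derivative_derivative_genPoly, derivative_genPoly, genPoly]
  constructor
  · simp only [add_mul, mul_add, monomial_mul_monomial, smul_add, smul_monomial]
    ext n
    match n with
    | 0 | 1 | 2 | 3 | n + 4 =>
      simp [coeff_monomial, add_mul, mul_add, e01, e02, e12]
      try module
  · simp only [add_mul, mul_add, monomial_mul_monomial, smul_add, smul_monomial]
    ext n
    match n with
    | 0 | 1 | 2 | 3 | n + 4 =>
      simp [coeff_monomial, add_mul, mul_add, e01, e02, e12]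
      try module
  · simp only [add_mul, mul_add, monomial_mul_monomial, smul_add, smul_monomial]
    ext n
    match n with
    | 0 =>
      -- At `y = 0` one has `h = 2 x⁰¹` and `f = 2 x¹¹`, so `h h - e f - f e` is `-2` times the
      -- Casimir expression.
      have h2 := congrArg (fun y => (-2 : K) • y) hc
      simp [coeff_monomial, coeff_one, add_mul, mul_add]
      rw [← sub_eq_zero] at h2 ⊢
      rw [← h2]
      module
    | 1 | 2 | 3 | n + 4 =>
      simp [coeff_monomial, coeff_one, add_mul, mul_add, e01, e02, e12]
      try module

/-- The derivative of polynomials as a linear map over the ground ring. -/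
noncomputable def polyDer : A[X] →ₗ[K] A[X] where
  toFun := derivative
  map_add' _ _ := derivative_add
  map_smul' c p := by
    ext n
    simp [coeff_derivative]

theorem ScaledTriple.f_mul_pow (hx : ScaledTriple x t z) (m : ℕ) :
    (((m : K) + 2) * (2 * m + 3)) • (derivative (derivative (genPoly x)) * genPoly x ^ (m + 1)) =
      derivative (derivative (genPoly x ^ (m + 2))) -
      (2 * t * ((m + 2) * (2 * m + 3))) • derivative (genPoly x ^ (m + 1)) +
      (4 * t ^ 2 * ((m + 1) * (m + 2) * ((m + 1) ^ 2 - (4 * z + 1)))) • genPoly x ^ m :=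
  hx.relations.f_mul_pow_eq polyDer (fun _ _ => derivative_mul) rfl rfl m

theorem ScaledTriple.h_mul_pow (hx : ScaledTriple x t z) (m : ℕ) :
    ((m : K) + 1) • (derivative (genPoly x) * genPoly x ^ m) =
      derivative (genPoly x ^ (m + 1)) - (2 * t * (m * (m + 1))) • genPoly x ^ m :=
  hx.relations.h_mul_pow_eq polyDer (fun _ _ => derivative_mul) rfl m

/-- Both sides are derivations up to a central factor, so agreement on `e` propagates to its powers.
-/
theorem commutator_pow {P : Type} [Ring P] (y e : P) (m : ℕ) (d : P → P) (c : P)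
    (hd1 : d 1 = 0) (hd : ∀ b, d (b * e) = d b * e + b * d e)
    (hc : ∀ b, c * b = b * c) (h : y * e - e * y = c * d e) :
    y * e ^ m - e ^ m * y = c * d (e ^ m) := by
  induction m with
  | zero => simp [hd1]
  | succ m ih =>
    have h2 : y * e ^ (m + 1) - e ^ (m + 1) * y =
      (y * e ^ m - e ^ m * y) * e + e ^ m * (y * e - e * y) := by
      rw [pow_succ]; noncomm_ring
    rw [h2, ih, h, pow_succ, hd, mul_add, ← mul_assoc (e ^ m), ← hc, mul_assoc, mul_assoc]

/-- `[x¹¹, w^m] = -2 t (w^m)'`. -/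
theorem ScaledTriple.comm_two_pow (hx : ScaledTriple x t z) (m : ℕ) :
    monomial 0 (x 2) * genPoly x ^ m - genPoly x ^ m * monomial 0 (x 2) =
      (-2 * t) • derivative (genPoly x ^ m) := by
  have e02 : x 2 * x 0 = x 0 * x 2 - (4 * t) • x 1 := by rw [← hx.comm02]; abel
  have e12 : x 2 * x 1 = x 1 * x 2 - (2 * t) • x 2 := by rw [← hx.comm12]; abel
  have := commutator_pow (monomial 0 (x 2)) (genPoly x) m derivative
    (algebraMap K A[X] (-2 * t)) (by simp) (fun b => derivative_mul)
    (fun b => Algebra.commutes _ b) ?_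
  · rw [this, Algebra.smul_def]
  · rw [derivative_genPoly, genPoly, ← Algebra.smul_def]
    simp only [add_mul, mul_add, monomial_mul_monomial, smul_add, smul_monomial]
    ext n
    match n with
    | 0 | 1 | 2 | n + 3 =>
      simp [coeff_monomial, add_mul, mul_add, e02, e12]
      try module

/-- `[x⁰⁰, w^m] = 2 t (2 m y w^m - y² (w^m)')`. -/
theorem ScaledTriple.comm_zero_pow (hx : ScaledTriple x t z) (m : ℕ) :
    monomial 0 (x 0) * genPoly x ^ m - genPoly x ^ m * monomial 0 (x 0) =
      (2 * t) • ((2 * m : K) • (genPoly x ^ m * X) - derivative (genPoly x ^ m) * X ^ 2) := by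
  have e01 : x 1 * x 0 = x 0 * x 1 - (2 * t) • x 0 := by rw [← hx.comm01]; abel
  have e02 : x 2 * x 0 = x 0 * x 2 - (4 * t) • x 1 := by rw [← hx.comm02]; abel
  have base : monomial 0 (x 0) * genPoly x - genPoly x * monomial 0 (x 0) =
      (2 * t) • ((2 : K) • (genPoly x * X) - derivative (genPoly x) * X ^ 2) := by
    rw [derivative_genPoly, genPoly, X_pow_eq_monomial, ← monomial_one_one_eq_X]
    simp only [add_mul, mul_add, monomial_mul_monomial, smul_add, smul_sub, smul_monomial]
    ext n
    match n with
    | 0 | 1 | 2 | 3 | n + 4 =>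
      simp [coeff_monomial, add_mul, mul_add, e01, e02]
      try module
  induction m with
  | zero => simp
  | succ m ih =>
    have h2 : monomial 0 (x 0) * genPoly x ^ (m + 1) - genPoly x ^ (m + 1) * monomial 0 (x 0) =
        (monomial 0 (x 0) * genPoly x ^ m - genPoly x ^ m * monomial 0 (x 0)) * genPoly x +
          genPoly x ^ m * (monomial 0 (x 0) * genPoly x - genPoly x * monomial 0 (x 0)) := by
      rw [pow_succ]; noncomm_ring
    rw [h2, ih, base, pow_succ (genPoly x) m, derivative_mul]
    simp only [smul_mul_assoc, mul_smul_comm, sub_mul, mul_sub, mul_assoc, add_mul]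
    rw [X_mul, ← X_pow_mul (n := 2) (p := genPoly x)]
    push_cast
    module

end Generating

end Triple


/-! ### Symmetrized monomials and multiplication by the generators. -/

section SymmetricBasis

open Polynomial

variable {K : Type} [CommRing K] [Algebra ℂ K] {A : Type} [Ring A] [Algebra K A]

/-- The ground ring contains `ℂ`, so nonzero integers are units; binomial normalizations are removed
this way. -/
theorem natCast_smul_cancel {n : ℕ} (hn : n ≠ 0) {a b : A} (h : (n : K) • a = (n : K) • b) :
    a = b := by
  have h1 : (algebraMap ℂ K ((n : ℂ)⁻¹)) * (n : K) = 1 := by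
    rw [← map_natCast (algebraMap ℂ K), ← map_mul, inv_mul_cancel₀ (Nat.cast_ne_zero.2 hn),
      map_one]
  have h2 := congrArg (fun y => (algebraMap ℂ K ((n : ℂ)⁻¹)) • y) h
  simpa only [smul_smul, h1, one_smul] using h2

variable (K) (x : Fin 3 → A) {t : K} {μ : ℂ}

/-- The symmetrized monomial `u₀^p u₁^q`, a normalized coefficient of a power of the generating
polynomial. -/
noncomputable def symMon (p q : ℕ) : A :=
  algebraMap ℂ K (((p + q).choose q : ℂ)⁻¹) • (genPoly x ^ ((p + q) / 2)).coeff q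

theorem coeff_genPoly_pow_eq_zero {m i : ℕ} (h : 2 * m < i) : (genPoly x ^ m).coeff i = 0 := by
  refine coeff_eq_zero_of_natDegree_lt (lt_of_le_of_lt (natDegree_pow_le_of_le m ?_)
    (by omega : m * 2 < i))
  refine natDegree_add_le_of_degree_le (natDegree_add_le_of_degree_le ?_ ?_) ?_ <;>
    exact (natDegree_monomial_le _).trans (by norm_num)

theorem coeff_genPoly_pow (m i : ℕ) :
    (genPoly x ^ m).coeff i = ((2 * m).choose i : K) • symMon K x (2 * m - i) i := by
  rcases lt_or_ge (2 * m) i with h | h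
  · rw [coeff_genPoly_pow_eq_zero x h, Nat.choose_eq_zero_of_lt h]
    simp
  · rw [symMon, Nat.sub_add_cancel h, Nat.mul_div_cancel_left m two_pos, smul_smul,
      ← map_natCast (algebraMap ℂ K), ← map_mul,
      mul_inv_cancel₀ (Nat.cast_ne_zero.2 (Nat.choose_pos h).ne'), map_one, one_smul]

theorem choose_smul_symMon {m p q : ℕ} (h : p + q = 2 * m) :
    ((2 * m).choose q : K) • symMon K x p q = (genPoly x ^ m).coeff q := by
  rw [coeff_genPoly_pow K x, show 2 * m - q = p by omega]

@[simp] theorem symMon_zero_zero : symMon K x 0 0 = 1 := by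
  simp [symMon]

theorem symMon_zero_two : symMon K x 0 2 = x 2 := by
  simp [symMon, genPoly, coeff_monomial]

theorem symMon_bot (m : ℕ) : symMon K x 0 (2 * m) = x 2 ^ m := by
  have h := choose_smul_symMon K x (m := m) (p := 0) (q := 2 * m) (by simp)
  rw [Nat.choose_self, Nat.cast_one, one_smul] at h
  rw [h]
  have hd : (genPoly x).natDegree ≤ 2 :=
    natDegree_add_le_of_degree_le (natDegree_add_le_of_degree_le
      ((natDegree_monomial_le _).trans (by norm_num))
      ((natDegree_monomial_le _).trans (by norm_num))) (natDegree_monomial_le _)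
  rw [mul_comm, coeff_pow_of_natDegree_le hd]
  simp [genPoly, coeff_monomial]

theorem coeff_derivative_smul (P : A[X]) (n : ℕ) :
    (derivative P).coeff n = ((n : K) + 1) • P.coeff (n + 1) := by
  rw [coeff_derivative, ← Nat.cast_succ, ← Nat.cast_succ, ← Nat.cast_comm, Algebra.smul_def,
    map_natCast]

variable {K x}

/-- The coefficient of the lowest term in `x¹¹ u₀^p u₁^q`, where `p + q = 2 n`. -/
noncomputable def lowCoef (μ n : ℂ) : ℂ := (n ^ 2 - (4 * μ + 1)) / (n ^ 2 - 1 / 4)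

theorem sq_sub_quarter_ne_zero (m : ℕ) : ((m : ℂ) ^ 2 - 1 / 4) ≠ 0 := by
  intro h
  have h1 : ((4 * m ^ 2 : ℕ) : ℂ) = ((1 : ℕ) : ℂ) := by
    push_cast
    linear_combination 4 * h
  have h2 := Nat.cast_injective h1
  omega

/-- Left multiplication by `x¹¹`. -/
theorem ScaledTriple.two_mul_symMon (hx : ScaledTriple x t (algebraMap ℂ K μ)) {m p q : ℕ}
    (h : p + q = 2 * m) : x 2 * symMon K x p q = symMon K x p (q + 2) -
      (t * p) • symMon K x (p - 1) (q + 1) +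
      (t ^ 2 * algebraMap ℂ K (lowCoef μ m * (p * (p - 1)) / 4)) • symMon K x (p - 2) q := by
  rcases m with _ | k
  · obtain ⟨rfl, rfl⟩ : p = 0 ∧ q = 0 := by omega
    simp [symMon_zero_two]
  -- Since `w'' = 2 x¹¹`, the coefficient of `y^q` in the formula for `w'' w^(k+1)` describes left
  -- multiplication by `x¹¹`.
  have key := congrArg (fun P => P.coeff q) (hx.f_mul_pow k)
  simp only [derivative_derivative_genPoly, coeff_smul, coeff_add, coeff_sub, coeff_derivative_smul (K := K)]
    at key
  rw [show (monomial 0 (x 2 + x 2) : A[X]) = C (x 2 + x 2) from rfl, coeff_C_mul,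
    coeff_genPoly_pow K x (k + 1) q, coeff_genPoly_pow K x (k + 2), coeff_genPoly_pow K x (k + 1),
    coeff_genPoly_pow K x k, show 2 * (k + 1) - q = p by omega,
    show 2 * (k + 2) - (q + 1 + 1) = p by omega, show 2 * (k + 1) - (q + 1) = p - 1 by omega,
    show 2 * k - q = p - 2 by omega] at key
  have hq : q ≤ 2 * (k + 1) := by omega
  -- `e3`, `e2` and `e0` express the binomial weights of the three resulting monomials through the
  -- single weight `choose (2 (k + 1)) q` of the left-hand side.
  have e3 : ((q : K) + 1) * (q + 2) * ((2 * (k + 2)).choose (q + 1 + 1) : ℕ) =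
      (2 * k + 4) * (2 * k + 3) * ((2 * (k + 1)).choose q : ℕ) := by
    have h1 := Nat.add_one_mul_choose_eq (2 * (k + 1)) q
    have h2 := Nat.add_one_mul_choose_eq (2 * (k + 1) + 1) (q + 1)
    have h1' := congrArg (Nat.cast (R := K)) h1
    have h2' := congrArg (Nat.cast (R := K)) h2
    push_cast at h1' h2'
    rw [show 2 * (k + 2) = 2 * (k + 1) + 1 + 1 by ring]
    linear_combination -((q : K) + 1) * h2' - (2 * (k : K) + 4) * h1'
  have e2 : ((q : K) + 1) * ((2 * (k + 1)).choose (q + 1) : ℕ) =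
      ((2 * (k + 1)).choose q : ℕ) * p := by
    have h1 := Nat.choose_succ_right_eq (2 * (k + 1)) q
    rw [show 2 * (k + 1) - q = p by omega] at h1
    have h1' := congrArg (Nat.cast (R := K)) h1
    push_cast at h1'
    linear_combination h1'
  have e0 : ((2 * k).choose q : ℂ) * ((2 * k + 2) * (2 * k + 1)) =
      ((2 * (k + 1)).choose q : ℕ) * (p * (p - 1)) := by
    have h1 := Nat.choose_mul_succ_eq (2 * k) q
    have h2 := Nat.choose_mul_succ_eq (2 * k + 1) q
    rw [show 2 * k + 1 + 1 - q = p by omega] at h2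
    have h1' := congrArg (Nat.cast (R := ℂ)) h1
    have h2' := congrArg (Nat.cast (R := ℂ)) h2
    rw [show 2 * (k + 1) = 2 * k + 1 + 1 by ring]
    rcases Nat.eq_zero_or_pos p with rfl | hp
    · have : (2 * k).choose q = 0 := Nat.choose_eq_zero_of_lt (by omega)
      simp [this]
    · rw [show 2 * k + 1 - q = p - 1 by omega, Nat.cast_mul, Nat.cast_mul, Nat.cast_pred hp] at h1'
      push_cast at h1' h2' ⊢
      linear_combination (2 * (k : ℂ) + 2) * h1' + ((p : ℂ) - 1) * h2'
  have e0' : 4 * (((k : K) + 1) * (k + 2) * ((k + 1) ^ 2 - (4 * algebraMap ℂ K μ + 1))) *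
      ((2 * k).choose q : ℕ) = 2 * (k + 2) * (2 * k + 3) * ((2 * (k + 1)).choose q : ℕ) *
        algebraMap ℂ K (lowCoef μ (k + 1 : ℕ) * (p * (p - 1)) / 4) := by
    have h1 : 4 * (((k : ℂ) + 1) * (k + 2) * ((k + 1) ^ 2 - (4 * μ + 1))) *
      ((2 * k).choose q : ℕ) = 2 * (k + 2) * (2 * k + 3) * ((2 * (k + 1)).choose q : ℕ) *
        (lowCoef μ (k + 1 : ℕ) * (p * (p - 1)) / 4) := by
      have h2 : lowCoef μ (k + 1 : ℕ) * (((k : ℂ) + 1) ^ 2 - 1 / 4) =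
          (k + 1) ^ 2 - (4 * μ + 1) := by
        have := sq_sub_quarter_ne_zero (k + 1)
        push_cast at this
        rw [lowCoef]
        push_cast
        exact div_mul_cancel₀ _ this
      rw [← h2]
      linear_combination lowCoef μ (k + 1 : ℕ) * (k + 2) * (2 * k + 3) / 2 * e0
    have h2 := congrArg (algebraMap ℂ K) h1
    simpa only [map_mul, map_add, map_sub, map_pow, map_natCast, map_one, map_ofNat] using h2
  -- All terms now share this integer factor, nonzero because `q ≤ 2 (k + 1)`.
  refine natCast_smul_cancel (K := K) (n := 2 * (k + 2) * (2 * k + 3) * (2 * (k + 1)).choose q)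
    (by have := (Nat.choose_pos hq).ne'; positivity) ?_
  rw [add_mul (x 2) (x 2), mul_smul_comm] at key
  push_cast at key ⊢
  simp only [smul_smul] at key
  linear_combination (norm := module) key + e3 • symMon K x p (q + 2) -
    (2 * t * ((k + 2) * (2 * k + 3))) • (e2 • symMon K x (p - 1) (q + 1)) +
    t ^ 2 • (e0' • symMon K x (p - 2) q)

/-- `[x¹¹, u₀^p u₁^q] = -2 t p u₀^(p-1) u₁^(q+1)`. -/
theorem ScaledTriple.comm_two_symMon (hx : ScaledTriple x t (algebraMap ℂ K μ)) {m p q : ℕ}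
    (h : p + q = 2 * m) : x 2 * symMon K x p q - symMon K x p q * x 2 =
      (-2 * t * p) • symMon K x (p - 1) (q + 1) := by
  have hq : q ≤ 2 * m := by omega
  have e2 : ((q : K) + 1) * ((2 * m).choose (q + 1) : ℕ) = ((2 * m).choose q : ℕ) * p := by
    have h1 := Nat.choose_succ_right_eq (2 * m) q
    rw [show 2 * m - q = p by omega] at h1
    have h1' := congrArg (Nat.cast (R := K)) h1
    push_cast at h1'
    linear_combination h1'
  have key := congrArg (fun P => P.coeff q) (hx.comm_two_pow m)
  simp only [coeff_smul, coeff_sub, coeff_derivative_smul (K := K)] at key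
  rw [show (monomial 0 (x 2) : A[X]) = C (x 2) from rfl, coeff_C_mul, coeff_mul_C, coeff_genPoly_pow K x m,
    coeff_genPoly_pow K x m, show 2 * m - q = p by omega, show 2 * m - (q + 1) = p - 1 by omega,
    mul_smul_comm, smul_mul_assoc] at key
  refine natCast_smul_cancel (K := K) (n := (2 * m).choose q) (Nat.choose_pos hq).ne' ?_
  linear_combination (norm := module) key - (2 * t) • (e2 • symMon K x (p - 1) (q + 1))

/-- Read off from the coefficient of `y^q` in `comm_zero_pow`, where multiplication by `y` and by
`y²` followed by one derivative both lower the index by one. -/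
theorem ScaledTriple.comm_zero_symMon (hx : ScaledTriple x t (algebraMap ℂ K μ)) {m p q : ℕ}
    (h : p + q = 2 * m) : x 0 * symMon K x p q - symMon K x p q * x 0 =
      (2 * t * q) • symMon K x (p + 1) (q - 1) := by
  have key := congrArg (fun P => P.coeff q) (hx.comm_zero_pow m)
  simp only [coeff_smul, coeff_sub, coeff_derivative_smul (K := K)] at key
  rw [show (monomial 0 (x 0) : A[X]) = C (x 0) from rfl, coeff_C_mul, coeff_mul_C] at key
  have hq : q ≤ 2 * m := by omega
  refine natCast_smul_cancel (K := K) (n := (2 * m).choose q) (Nat.choose_pos hq).ne' ?_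
  -- For `q = 0` the label `q - 1` is truncated and carries the coefficient zero, so this case is
  -- separate.
  rcases q with _ | q
  · simp only [mul_coeff_zero, coeff_X_zero, coeff_X_pow] at key
    rw [coeff_genPoly_pow K x m, show 2 * m - 0 = p by omega] at key
    simpa using key
  have e2 : ((q : K) + 1) * ((2 * m).choose (q + 1) : ℕ) = ((2 * m).choose q : ℕ) * (p + 1) := by
    have h1 := Nat.choose_succ_right_eq (2 * m) q
    rw [show 2 * m - q = p + 1 by omega] at h1
    have h1' := congrArg (Nat.cast (R := K)) h1
    push_cast at h1'
    linear_combination h1'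
  have e3 : (2 * m : K) = p + q + 1 := by
    have := congrArg (Nat.cast (R := K)) h
    push_cast at this
    linear_combination -this
  have hX : (derivative (genPoly x ^ m) * X ^ 2).coeff (q + 1) =
      (q : K) • (genPoly x ^ m).coeff q := by
    rcases q with _ | q
    · simp [pow_two, ← mul_assoc]
    · rw [coeff_mul_X_pow, coeff_derivative_smul (K := K)]
      push_cast
      rfl
  rw [coeff_mul_X, hX, coeff_genPoly_pow K x m q, coeff_genPoly_pow K x m,
    show 2 * m - (q + 1) = p by omega, show 2 * m - q = p + 1 by omega,
    mul_smul_comm, smul_mul_assoc] at key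
  rw [Nat.add_sub_cancel]
  push_cast
  linear_combination (norm := module) key - (2 * t) • (e2 • symMon K x (p + 1) q) +
    (2 * t * ((2 * m).choose q : ℕ)) • (e3 • symMon K x (p + 1) q)

end SymmetricBasis

/-! ### The hypergeometric coefficients and their three-term recursion. -/

section Hypergeometric

theorem fallP_succ_left (x : ℂ) (n : ℕ) : fallP x (n + 1) = x * fallP (x - 1) n := by
  simp [fallP, descPochhammer_succ_left]

theorem fallP_succ_right (x : ℂ) (n : ℕ) : fallP x (n + 1) = fallP x n * (x - n) := by
  simp [fallP, descPochhammer_succ_right]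

@[simp] theorem fallP_zero (x : ℂ) : fallP x 0 = 1 := by simp [fallP]

theorem fallP_natCast_eq_zero {m n : ℕ} (h : m < n) : fallP m n = 0 := by
  rw [fallP, descPochhammer_eval_eq_descFactorial, Nat.descFactorial_eq_zero_iff_lt.2 h]
  simp

theorem riseP_succ_left (x : ℂ) (n : ℕ) : riseP x (n + 1) = x * riseP (x + 1) n := by
  simp [riseP, ascPochhammer_succ_left]

theorem riseP_succ_right (x : ℂ) (n : ℕ) : riseP x (n + 1) = riseP x n * (x + n) := by
  simp [riseP, ascPochhammer_succ_right]

@[simp] theorem riseP_zero (x : ℂ) : riseP x 0 = 1 := by simp [riseP]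

theorem riseP_shift (x : ℂ) (n : ℕ) : x * riseP (x + 1) n = riseP x n * (x + n) := by
  rw [← riseP_succ_left, riseP_succ_right]

theorem riseP_ne_zero {x : ℂ} (h : ∀ i : ℕ, x + i ≠ 0) (n : ℕ) : riseP x n ≠ 0 := by
  induction n with
  | zero => simp
  | succ n ih =>
    rw [riseP_succ_right]
    exact mul_ne_zero ih (h n)

/-- A parity argument. The lower parameters of `Ψ` are half-integers for integral `m`, `n`, so their
Pochhammer symbols never vanish. -/
theorem half_add_int_ne_zero (i : ℤ) : (1 / 2 + i : ℂ) ≠ 0 := by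
  intro h
  have h1 : ((1 + 2 * i : ℤ) : ℂ) = ((0 : ℤ) : ℂ) := by
    push_cast
    linear_combination 2 * h
  have h2 := Int.cast_injective h1
  omega

/-- `(-k/2)_j ((1-k)/2)_j = [k]_{2j} / 4^j`. -/
theorem riseP_half_mul (k : ℂ) (j : ℕ) :
    riseP (-k / 2) j * riseP ((1 - k) / 2) j = fallP k (2 * j) / 4 ^ j := by
  induction j with
  | zero => simp
  | succ j ih =>
    rw [riseP_succ_right, riseP_succ_right, Nat.mul_succ, fallP_succ_right, fallP_succ_right]
    have h : fallP k (2 * j) = 4 ^ j * (riseP (-k / 2) j * riseP ((1 - k) / 2) j) := by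
      rw [ih]; field_simp
    rw [h, pow_succ]
    push_cast
    field_simp
    ring

/-- The coefficients of the expansion of `Ψ` in the products `(-1/2-2σ)_j (3/2+2σ)_j`, multiplied by
the coefficient of the transvectant of two pure powers. -/
noncomputable def expCoef (k j : ℕ) (m n : ℂ) : ℂ :=
  (-1 / 2) ^ k * fallP (2 * m) k * fallP (2 * n) k * (fallP k (2 * j) / k.factorial) /
    (4 ^ j * j.factorial * riseP (1 / 2 - m) j * riseP (1 / 2 - n) j *
      riseP (m + n + 3 / 2 - k) j)

/-- The products `(-1/2-2σ)_j (3/2+2σ)_j`. -/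
noncomputable def sigmaProd (σ : ℂ) (j : ℕ) : ℂ :=
  riseP (-1 / 2 - 2 * σ) j * riseP (3 / 2 + 2 * σ) j

theorem sigmaProd_succ (σ : ℂ) (j : ℕ) : sigmaProd σ (j + 1) =
    sigmaProd σ j * (((j : ℂ) + 1 / 2) ^ 2 - (4 * (σ * (σ + 1)) + 1)) := by
  rw [sigmaProd, sigmaProd, riseP_succ_right, riseP_succ_right]
  ring

theorem expCoef_eq_zero {k j : ℕ} (h : k < 2 * j) (m n : ℂ) : expCoef k j m n = 0 := by
  rw [expCoef, fallP_natCast_eq_zero h]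
  simp

/-- The coefficient of the `k`-th term in the product of two pure powers. -/
noncomputable def powerCoef (σ : ℂ) (k : ℕ) (m n : ℂ) : ℂ :=
  (-1 / 2) ^ k / (k.factorial : ℂ) * fallP (2 * m) k * fallP (2 * n) k * Psi k m n σ

/-- The upper parameters `-k/2` and `(1-k)/2` combine to `[k]_{2j} / 4^j`, which vanishes for `2 j >
k`. The dependence on `σ` is isolated in `sigmaProd`. -/
theorem powerCoef_eq_sum (σ : ℂ) (k : ℕ) (m n : ℂ) {J : ℕ} (h : k < 2 * J) :
    powerCoef σ k m n = ∑ j ∈ Finset.range J, expCoef k j m n * sigmaProd σ j := by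
  rw [powerCoef, Psi, fourF3, tsum_eq_sum (s := Finset.range J), Finset.mul_sum]
  · refine Finset.sum_congr rfl fun j _ => ?_
    rw [mul_assoc (riseP _ j * riseP _ j), riseP_half_mul, expCoef, sigmaProd]
    have := Nat.factorial_ne_zero k
    field_simp
  · intro j hj
    rw [Finset.mem_range, not_lt] at hj
    rw [mul_assoc (riseP _ j * riseP _ j), riseP_half_mul, fallP_natCast_eq_zero (by omega)]
    simp

theorem factor_shift (k j : ℕ) : fallP ((k : ℂ) + 1) (2 * j) / (k + 1).factorial * (k + 1 - 2 * j) =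
    fallP k (2 * j) / k.factorial := by
  have h1 := fallP_succ_left ((k : ℂ) + 1) (2 * j)
  rw [fallP_succ_right, add_sub_cancel_right] at h1
  have := Nat.factorial_ne_zero k
  have h2 : (k : ℂ) + 1 ≠ 0 := by exact_mod_cast Nat.succ_ne_zero k
  rw [Nat.factorial_succ]
  push_cast at h1 ⊢
  field_simp
  linear_combination h1

theorem factor_shift_two (k j : ℕ) :
    fallP ((k : ℂ) + 1 + 1) (2 * (j + 1)) / (k + 1 + 1).factorial =
      fallP k (2 * j) / k.factorial := by
  rw [Nat.mul_succ, fallP_succ_left, fallP_succ_left, Nat.factorial_succ, Nat.factorial_succ]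
  have := Nat.factorial_ne_zero k
  have h2 : (k : ℂ) + 1 ≠ 0 := by exact_mod_cast Nat.succ_ne_zero k
  have h3 : (k : ℂ) + 1 + 1 ≠ 0 := by exact_mod_cast Nat.succ_ne_zero (k + 1)
  push_cast
  rw [show (k : ℂ) + 1 + 1 - 1 - 1 = k by ring]
  field_simp
  ring

/-- The rational identity behind the three-term recursion. -/
theorem recursion_identity_core {m n k j y u v : ℂ} (hk : k = m + n - 1 / 2 - y)
    (hu : u = 1 / 2 - m + j) (hv : v = 1 / 2 - n + j) (h1 : u ≠ 0) (h2 : v ≠ 0)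
    (h4 : y ≠ 0) (h5 : y + 1 ≠ 0) (hj : j + 1 ≠ 0) :
    -(m + 1) / ((j + 1) * v * (y + 1)) =
      (2 * m - k) * (2 * m - k - 1) * (y + 1 + j) / (4 * ((j + 1) * u * v * (y * (y + 1)))) +
      (2 * m - k) * (k - 2 * j) / (2 * ((j + 1) * u * v * (y + 1))) +
      (1 / (y * (y + 1)) + (y - j - 1) * (k - 1 - 2 * j) * (k - 2 * j) /
        (4 * ((j + 1) * u * v * (y * (y + 1))))) := by
  field_simp
  subst hk hu hv
  ring

/-- All terms share a common prefactor; dividing it out leaves the rational identity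
`recursion_identity_core`. -/
theorem recursion_identity {a b c p f f' g m n k j y : ℂ} (hk : k = m + n - 1 / 2 - y)
    (ha : a ≠ 0) (hb : b ≠ 0) (hc : c ≠ 0) (h1 : 1 / 2 - m + j ≠ 0) (h2 : 1 / 2 - n + j ≠ 0)
    (h3 : -1 / 2 - m ≠ 0) (h4 : y ≠ 0) (h5 : y + 1 ≠ 0) (h6 : y + 1 + j ≠ 0)
    (h7 : y + 2 + j ≠ 0) (F : ℂ) (hF : F ≠ 0) (hj : j + 1 ≠ 0) :
    p * (1 / 4) * ((2 * m + 2) * (2 * m + 1) * f) * (f' * (2 * n - k) * (2 * n - k - 1)) * g /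
        (4 * F * (j + 1) * ((-1 / 2 - m) * a) * (b * (1 / 2 - n + j)) * ((y + 1) * c)) =
      p * (1 / 4) * (f * (2 * m - k) * (2 * m - k - 1)) * (f' * (2 * n - k) * (2 * n - k - 1)) * g /
        (4 * F * (j + 1) * (a * (1 / 2 - m + j)) * (b * (1 / 2 - n + j)) *
          (y * (c * (y + 1) / (y + 1 + j)))) -
      (2 * n - k - 1) * (p * (-1 / 2) * (f * (2 * m - k)) * (f' * (2 * n - k)) *
        ((k - 2 * j) * g) / (4 * F * (j + 1) * (a * (1 / 2 - m + j)) * (b * (1 / 2 - n + j)) *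
          ((y + 1) * c))) +
      (2 * n - k) * (2 * n - k - 1) / (4 * (y * (y + 1))) *
        (p * f * f' * g / (F * a * b * c) +
          (y - j - 1) * (y + j + 2) * (p * f * f' * ((k - 1 - 2 * j) * ((k - 2 * j) * g)) /
            (4 * F * (j + 1) * (a * (1 / 2 - m + j)) * (b * (1 / 2 - n + j)) *
              (c * (y + 2 + j))))) := by
  have core := recursion_identity_core hk rfl rfl h1 h2 h4 h5 hj
  set u := 1 / 2 - m + j
  set v := 1 / 2 - n + j
  have hm : 2 * m + 1 = -2 * (-1 / 2 - m) := by ring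
  set x := -1 / 2 - m
  rw [hm, show y + j + 2 = y + 2 + j by ring]
  set s := y + 2 + j
  set A := 2 * n - k
  set B := 2 * n - k - 1
  set C := 2 * m - k
  set D := 2 * m - k - 1
  set G := k - 1 - 2 * j
  set H := k - 2 * j
  set y1 := y + 1
  set yj := y1 + j
  set z := y - j - 1
  set J := j + 1
  -- From here the linear factors are independent atoms, so clearing denominators does not expand
  -- them.
  clear_value u v x s A B C D G H y1 yj z J
  calc _ = p * f * f' * g * A * B / (4 * F * a * b * c) * (-(m + 1) / (J * v * y1)) := by
        field_simp; ring
    _ = _ := by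
        rw [core]
        have e1 : p * (1 / 4) * (f * C * D) * (f' * A * B) * g /
          (4 * F * J * (a * u) * (b * v) * (y * (c * y1 / yj))) =
          p * f * f' * g * A * B / (4 * F * a * b * c) * (C * D * yj / (4 * (J * u * v * (y * y1)))) := by
          field_simp
        have e2 : B * (p * (-1 / 2) * (f * C) * (f' * A) * (H * g) / (4 * F * J * (a * u) * (b * v) * (y1 * c))) =
          - (p * f * f' * g * A * B / (4 * F * a * b * c) * (C * H / (2 * (J * u * v * y1)))) := by
          field_simp
        have e3 : A * B / (4 * (y * y1)) * (p * f * f' * g / (F * a * b * c)) =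
          p * f * f' * g * A * B / (4 * F * a * b * c) * (1 / (y * y1)) := by
          field_simp
        have e4 : A * B / (4 * (y * y1)) * (z * s * (p * f * f' * (G * (H * g)) / (4 * F * J * (a * u) * (b * v) * (c * s)))) =
          p * f * f' * g * A * B / (4 * F * a * b * c) * (z * G * H / (4 * (J * u * v * (y * y1)))) := by
          field_simp
        rw [e1, e2, mul_add (A * B / _), e3, e4]
        ring

/-- The three-term recursion, separately for each `j`. -/
theorem expCoef_recursion (k j m n : ℕ) :
    expCoef (k + 2) (j + 1) (m + 1) n = expCoef (k + 2) (j + 1) m n -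
      (2 * n - k - 1) * expCoef (k + 1) (j + 1) m n +
      (2 * n - k) * (2 * n - k - 1) / (4 * (((n : ℂ) + m - k) ^ 2 - 1 / 4)) *
        (expCoef k j m n +
          (((n : ℂ) + m - k) ^ 2 - (((j + 1 : ℕ) : ℂ) + 1 / 2) ^ 2) * expCoef k (j + 1) m n) := by
  -- For orders `k + 2`, `k + 1` and `k` the last lower parameter is then `y`, `y + 1` and `y + 2`;
  -- being a half-integer, `y` never meets an integer.
  set y : ℂ := (m : ℂ) + n - 1 / 2 - k with hy
  have hyi : ∀ i : ℤ, y + i ≠ 0 := fun i => by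
    have := half_add_int_ne_zero ((m : ℤ) + n - k - 1 + i)
    push_cast at this
    convert this using 1
    rw [hy]; ring
  have hmi : ∀ (m : ℕ) (i : ℤ), 1 / 2 - (m : ℂ) + i ≠ 0 := fun m i => by
    have := half_add_int_ne_zero (-m + i)
    push_cast at this
    convert this using 1
    ring
  have r1 : riseP (1 / 2 - ((m : ℂ) + 1)) (j + 1) = (-1 / 2 - m) * riseP (1 / 2 - m) j := by
    rw [riseP_succ_left, show (1 / 2 - ((m : ℂ) + 1)) = -1 / 2 - m by ring,
      show (-1 / 2 - (m : ℂ) + 1) = 1 / 2 - m by ring]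
  have h6 : y + 1 + j ≠ 0 := by
    have := hyi (1 + j); push_cast at this; rwa [← add_assoc] at this
  have c0 : riseP (m + n + 3 / 2 - ((k + 2 : ℕ) : ℂ)) (j + 1) =
      y * (riseP (y + 2) j * (y + 1) / (y + 1 + j)) := by
    have hs := riseP_shift (y + 1) j
    rw [show (m : ℂ) + n + 3 / 2 - ((k + 2 : ℕ) : ℂ) = y by push_cast; rw [hy]; ring,
      riseP_succ_left]
    congr 1
    rw [eq_div_iff h6, ← hs, add_assoc, one_add_one_eq_two]
    ring
  have c1 : riseP (m + n + 3 / 2 - ((k + 1 : ℕ) : ℂ)) (j + 1) = (y + 1) * riseP (y + 2) j := by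
    rw [show (m : ℂ) + n + 3 / 2 - ((k + 1 : ℕ) : ℂ) = y + 1 by push_cast; rw [hy]; ring,
      riseP_succ_left, add_assoc, one_add_one_eq_two]
  have c1' : riseP ((m : ℂ) + 1 + n + 3 / 2 - ((k + 2 : ℕ) : ℂ)) (j + 1) =
      (y + 1) * riseP (y + 2) j := by
    rw [show (m : ℂ) + 1 + n + 3 / 2 - ((k + 2 : ℕ) : ℂ) = y + 1 by push_cast; rw [hy]; ring,
      riseP_succ_left, add_assoc, one_add_one_eq_two]
  have c2 : ((m : ℂ) + n + 3 / 2 - k) = y + 2 := by rw [hy]; ring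
  have f1 : fallP (2 * ((m : ℂ) + 1)) (k + 2) = (2 * m + 2) * (2 * m + 1) * fallP (2 * m) k := by
    rw [fallP_succ_left, fallP_succ_left, show 2 * ((m : ℂ) + 1) - 1 - 1 = 2 * m by ring]
    ring
  have f2 : ∀ x : ℂ, fallP x (k + 2) = fallP x k * (x - k) * (x - k - 1) := fun x => by
    rw [fallP_succ_right, fallP_succ_right]
    push_cast
    ring
  have g0 := factor_shift_two k j
  have g1 := factor_shift (k + 1) (j + 1)
  have g2 := factor_shift k (j + 1)
  have hN : ((n : ℂ) + m - k) ^ 2 - 1 / 4 = y * (y + 1) := by rw [hy]; ring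
  have hN2 : ((n : ℂ) + m - k) ^ 2 - (((j + 1 : ℕ) : ℂ) + 1 / 2) ^ 2 =
      (y - j - 1) * (y + j + 2) := by rw [hy]; push_cast; ring
  have g0' : fallP ((k + 2 : ℕ) : ℂ) (2 * (j + 1)) / (k + 2).factorial =
      fallP k (2 * j) / k.factorial := by
    rw [← g0]; push_cast; rw [add_assoc, one_add_one_eq_two]
  have g1' : fallP ((k + 1 : ℕ) : ℂ) (2 * (j + 1)) / (k + 1).factorial =
      (k - 2 * j) * (fallP k (2 * j) / k.factorial) := by
    rw [← g1, ← g0]; push_cast; ring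
  have g2' : fallP (k : ℂ) (2 * (j + 1)) / k.factorial =
      (k - 1 - 2 * j) * ((k - 2 * j) * (fallP k (2 * j) / k.factorial)) := by
    rw [← g1', ← g2]; push_cast; ring
  have hjj : ((j + 1).factorial : ℂ) = (j + 1) * j.factorial := by
    rw [Nat.factorial_succ]; push_cast; ring
  simp only [expCoef]
  push_cast only [Nat.cast_add, Nat.cast_one] at *
  rw [hN, hN2, g0', g1', g2', r1, c0, c1, c1', c2, f1, f2, f2, fallP_succ_right, fallP_succ_right,
    riseP_succ_right (1 / 2 - (m : ℂ)), riseP_succ_right (1 / 2 - (n : ℂ)),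
    riseP_succ_right (y + 2), hjj]
  have := recursion_identity (a := riseP (1 / 2 - m) j) (b := riseP (1 / 2 - n) j)
    (c := riseP (y + 2) j) (p := (-1 / 2) ^ k) (f := fallP (2 * m) k) (f' := fallP (2 * n) k)
    (g := fallP k (2 * j) / k.factorial) (m := m) (n := n) (k := k) (j := j) (y := y)
    (by rw [hy]; ring) (riseP_ne_zero (fun i => hmi m i) j) (riseP_ne_zero (fun i => hmi n i) j)
    (riseP_ne_zero (fun i => by
      have := hyi (2 + i); push_cast at this; rwa [← add_assoc] at this) j)
    (hmi m j) (hmi n j)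
    (by have := hmi m (-1); push_cast at this; convert this using 1; ring)
    (by simpa using hyi 0) (by simpa using hyi 1) h6
    (by have := hyi (2 + j); push_cast at this; rwa [← add_assoc] at this)
    (4 ^ j * j.factorial) (mul_ne_zero (pow_ne_zero _ (by norm_num))
      (Nat.cast_ne_zero.2 (Nat.factorial_ne_zero j)))
    (by exact_mod_cast Nat.succ_ne_zero j)
  convert this using 2 <;> ring_nf

theorem int_sq_sub_quarter_ne_zero (N : ℤ) : ((N : ℂ) ^ 2 - 1 / 4) ≠ 0 := by
  have h1 := half_add_int_ne_zero N
  have h2 := half_add_int_ne_zero (-N)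
  push_cast at h2
  intro h
  refine mul_ne_zero h1 h2 ?_
  linear_combination -h

/-- The lowest case lacks the contribution from `j - 1` and so does not follow the general pattern.
-/
theorem expCoef_recursion_zero (k m n : ℕ) :
    expCoef (k + 2) 0 (m + 1) n = expCoef (k + 2) 0 m n -
      (2 * n - k - 1) * expCoef (k + 1) 0 m n +
      (2 * n - k) * (2 * n - k - 1) / (4 * (((n : ℂ) + m - k) ^ 2 - 1 / 4)) *
        ((((n : ℂ) + m - k) ^ 2 - (((0 : ℕ) : ℂ) + 1 / 2) ^ 2) * expCoef k 0 m n) := by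
  have hN := int_sq_sub_quarter_ne_zero ((n : ℤ) + m - k)
  push_cast at hN
  have f1 : fallP (2 * ((m : ℂ) + 1)) (k + 2) = (2 * m + 2) * (2 * m + 1) * fallP (2 * m) k := by
    rw [fallP_succ_left, fallP_succ_left, show 2 * ((m : ℂ) + 1) - 1 - 1 = 2 * m by ring]
    ring
  have f2 : ∀ x : ℂ, fallP x (k + 2) = fallP x k * (x - k) * (x - k - 1) := fun x => by
    rw [fallP_succ_right, fallP_succ_right]
    push_cast
    ring
  have hk := Nat.factorial_ne_zero k
  have h2 : (k : ℂ) + 1 ≠ 0 := by exact_mod_cast Nat.succ_ne_zero k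
  have h3 : (k : ℂ) + 1 + 1 ≠ 0 := by exact_mod_cast Nat.succ_ne_zero (k + 1)
  have e : (((0 : ℕ) : ℂ) + 1 / 2) ^ 2 = 1 / 4 := by norm_num
  rw [e]
  set N := ((n : ℂ) + m - k) ^ 2 - 1 / 4
  clear_value N
  simp only [expCoef, mul_zero, fallP_zero, riseP_zero, pow_zero, Nat.factorial_zero, Nat.cast_one,
    mul_one, div_one]
  rw [f1, f2, f2, fallP_succ_right, fallP_succ_right, Nat.factorial_succ, Nat.factorial_succ]
  push_cast
  field_simp
  ring


/-- This is the condition imposed by one more left multiplication by `x¹¹`, in the form given by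
`two_mul_symMon`. It is proved by comparing the coefficients of `sigmaProd σ j` on both sides. -/
theorem powerCoef_recursion (σ : ℂ) (k m n : ℕ) :
    powerCoef σ (k + 2) (m + 1) n = powerCoef σ (k + 2) m n -
      (2 * n - k - 1) * powerCoef σ (k + 1) m n +
      lowCoef (σ * (σ + 1)) ((n : ℂ) + m - k) * ((2 * n - k) * (2 * n - k - 1)) / 4 *
        powerCoef σ k m n := by
  rw [powerCoef_eq_sum σ (k + 2) _ _ (J := k + 3) (by omega),
    powerCoef_eq_sum σ (k + 2) _ _ (J := k + 3) (by omega),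
    powerCoef_eq_sum σ (k + 1) _ _ (J := k + 3) (by omega)]
  set w : ℂ := (2 * n - k) * (2 * n - k - 1) / (4 * (((n : ℂ) + m - k) ^ 2 - 1 / 4)) with hw
  set N : ℂ := (n : ℂ) + m - k with hN
  have hN0 : N ^ 2 - 1 / 4 ≠ 0 := by
    have := int_sq_sub_quarter_ne_zero ((n : ℤ) + m - k)
    push_cast at this
    exact this
  have h1 : lowCoef (σ * (σ + 1)) N * ((2 * n - k) * (2 * n - k - 1)) / 4 =
      w * (N ^ 2 - (4 * (σ * (σ + 1)) + 1)) := by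
    rw [lowCoef, hw]
    field_simp
  -- Split `N² - (4μ + 1)` as `((j + 1/2)² - (4μ + 1)) + (N² - (j + 1/2)²)`: the first part turns
  -- `sigmaProd σ j` into `sigmaProd σ (j + 1)`, the second does not involve `σ`.
  have h2 : (N ^ 2 - (4 * (σ * (σ + 1)) + 1)) * powerCoef σ k m n =
      ∑ j ∈ Finset.range (k + 2), expCoef k j m n * sigmaProd σ (j + 1) +
      ∑ j ∈ Finset.range (k + 3), (N ^ 2 - ((j : ℂ) + 1 / 2) ^ 2) * expCoef k j m n *
        sigmaProd σ j := by
    rw [Finset.sum_range_succ _ (k + 2), expCoef_eq_zero (k := k) (j := k + 2) (by omega),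
      mul_zero, zero_mul, add_zero, ← Finset.sum_add_distrib,
      powerCoef_eq_sum σ k _ _ (J := k + 2) (by omega), Finset.mul_sum]
    refine Finset.sum_congr rfl fun j _ => ?_
    rw [sigmaProd_succ]
    ring
  rw [h1, mul_assoc w, h2, Finset.sum_range_succ' _ (k + 2), Finset.sum_range_succ' _ (k + 2),
    Finset.sum_range_succ' _ (k + 2), Finset.sum_range_succ' _ (k + 2)]
  have e0 := expCoef_recursion_zero k m n
  have e1 : ∑ j ∈ Finset.range (k + 2), expCoef (k + 2) (j + 1) (m + 1) n * sigmaProd σ (j + 1) =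
      ∑ j ∈ Finset.range (k + 2), (expCoef (k + 2) (j + 1) m n -
      (2 * n - k - 1) * expCoef (k + 1) (j + 1) m n + w * (expCoef k j m n +
          (N ^ 2 - (((j + 1 : ℕ) : ℂ) + 1 / 2) ^ 2) * expCoef k (j + 1) m n)) *
        sigmaProd σ (j + 1) :=
    Finset.sum_congr rfl fun j _ => by rw [expCoef_recursion]
  rw [e1, e0]
  simp only [add_mul, sub_mul, mul_add, mul_sub, Finset.sum_add_distrib, Finset.sum_sub_distrib,
    Finset.mul_sum, mul_assoc]
  ring

theorem powerCoef_zero (σ m n : ℂ) : powerCoef σ 0 m n = 1 := by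
  rw [powerCoef_eq_sum σ 0 m n (J := 1) (by omega)]
  simp [expCoef, sigmaProd]

theorem powerCoef_one (σ m n : ℂ) : powerCoef σ 1 m n = -(2 * m * n) := by
  rw [powerCoef_eq_sum σ 1 m n (J := 1) (by omega)]
  simp [expCoef, sigmaProd, fallP_succ_left]
  ring

end Hypergeometric

/-! ### Transvectant coefficients of monomials. -/

section TransvectantCoefficients

/-- `k! R_k(p, q, r, s)`, the coefficient of the `k`-th transvectant of two monomials. -/
noncomputable def transCoef (k : ℕ) (p q r s : ℂ) : ℂ :=
  ∑ j ∈ Finset.range (k + 1), ((-1 : ℂ) ^ j * (k.choose j : ℂ)) •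
    (fallP p (k - j) * fallP s (k - j) * (fallP q j * fallP r j))

theorem Rcoef_eq (k : ℕ) (p q r s : ℂ) : Rcoef k p q r s = transCoef k p q r s / k.factorial := by
  rw [Rcoef, transCoef, Finset.mul_sum, Finset.sum_div]
  refine Finset.sum_congr rfl fun j _ => ?_
  rw [smul_eq_mul]
  ring

/-- The counterpart of `transvectant_succ` for monomials in `u₀, u₁`, valid for complex exponents.
-/
theorem transCoef_succ (k : ℕ) (p q r s : ℂ) : transCoef (k + 1) p q r s =
    p * s * transCoef k (p - 1) q r (s - 1) - q * r * transCoef k p (q - 1) (r - 1) s := by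
  rw [transCoef, sum_alternating_choose_succ (M := ℂ) fun i j =>
    fallP p i * fallP s i * (fallP q j * fallP r j)]
  simp only [transCoef, Finset.mul_sum, smul_eq_mul, fallP_succ_left]
  congr 1 <;> exact Finset.sum_congr rfl fun j _ => by ring

theorem transCoef_zero (p q r s : ℂ) : transCoef 0 p q r s = 1 := by
  simp [transCoef]

theorem transCoef_swap (k : ℕ) (p q r s : ℂ) :
    transCoef k q p s r = (-1) ^ k * transCoef k p q r s := by
  induction k generalizing p q r s with
  | zero => simp [transCoef_zero]
  | succ k ih =>
    rw [transCoef_succ, transCoef_succ, ih p (q - 1) (r - 1) s, ih (p - 1) q r (s - 1)]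
    ring

theorem transCoef_comm (k : ℕ) (p q r s : ℂ) :
    transCoef k r s p q = (-1) ^ k * transCoef k p q r s := by
  induction k generalizing p q r s with
  | zero => simp [transCoef_zero]
  | succ k ih =>
    rw [transCoef_succ, transCoef_succ, ih p (q - 1) (r - 1) s, ih (p - 1) q r (s - 1)]
    ring

/-- Transvectants are `sl₂`-equivariant: this is the action of `u₀ ∂₁` on both sides, the result
having degree `q + s - k` in `u₁`. -/
theorem transCoef_raise (k : ℕ) (p q r s : ℂ) :
    q * transCoef k (p + 1) (q - 1) r s + s * transCoef k p q (r + 1) (s - 1) =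
      (q + s - k) * transCoef k p q r s := by
  induction k generalizing p q r s with
  | zero => simp [transCoef_zero]
  | succ k ih =>
    have h1 := ih (p - 1) q r (s - 1)
    have h2 := ih p (q - 1) (r - 1) s
    rw [sub_add_cancel] at h1 h2
    rw [transCoef_succ, transCoef_succ, transCoef_succ, add_sub_cancel_right,
      add_sub_cancel_right]
    push_cast
    linear_combination p * s * h1 - q * r * h2

theorem transCoef_lower (k : ℕ) (p q r s : ℂ) :
    p * transCoef k (p - 1) (q + 1) r s + r * transCoef k p q (r - 1) (s + 1) =
      (p + r - k) * transCoef k p q r s := by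
  -- The lowering relation is the raising relation with the two variables exchanged, up to a sign
  -- `(-1)^k` that cancels.
  have h := transCoef_raise k q p s r
  rw [transCoef_swap k (p - 1) (q + 1), transCoef_swap k p q (r - 1), transCoef_swap k p q r s] at h
  have h1 : ((-1 : ℂ) ^ k) * (-1) ^ k = 1 := by rw [← mul_pow]; simp
  linear_combination (-1) ^ k * h - (p * transCoef k (p - 1) (q + 1) r s +
    r * transCoef k p q (r - 1) (s + 1) - (p + r - k) * transCoef k p q r s) * h1

theorem transCoef_eq_zero_left {k p r : ℕ} (h : p + r < k) (q s : ℂ) :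
    transCoef k p q r s = 0 := by
  refine Finset.sum_eq_zero fun j hj => ?_
  rw [Finset.mem_range] at hj
  rcases lt_or_ge p (k - j) with h1 | h1
  · rw [fallP_natCast_eq_zero h1]
    simp
  · rw [fallP_natCast_eq_zero (show r < j by omega)]
    simp

theorem transCoef_eq_zero_right {k q s : ℕ} (h : q + s < k) (p r : ℂ) :
    transCoef k p q r s = 0 := by
  have := transCoef_swap k q p s r
  rw [this, transCoef_eq_zero_left h]
  simp

theorem transCoef_pure (k : ℕ) (q r : ℂ) :
    transCoef k 0 q r 0 = (-1) ^ k * (fallP q k * fallP r k) := by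
  rw [transCoef, Finset.sum_eq_single k]
  · simp
  · intro j hj hjk
    rw [Finset.mem_range] at hj
    have := fallP_natCast_eq_zero (m := 0) (n := k - j) (by omega)
    rw [Nat.cast_zero] at this
    rw [this]
    simp
  · simp

/-- The structure constants of the product of two symmetrized monomials. -/
noncomputable def prodCoef (σ : ℂ) (k p q r s : ℕ) : ℂ :=
  (1 / 2) ^ k * Rcoef k p q r s * Psi k (((p : ℂ) + q) / 2) (((r : ℂ) + s) / 2) σ

theorem prodCoef_eq (σ : ℂ) {k p q r s m n : ℕ} (hm : p + q = 2 * m) (hn : r + s = 2 * n) :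
    prodCoef σ k p q r s = (1 / 2) ^ k / k.factorial * Psi k m n σ * transCoef k p q r s := by
  have hm' : ((p : ℂ) + q) / 2 = m := by
    have : ((p + q : ℕ) : ℂ) = (2 * m : ℕ) := by rw [hm]
    push_cast at this
    rw [this]; ring
  have hn' : ((r : ℂ) + s) / 2 = n := by
    have : ((r + s : ℕ) : ℂ) = (2 * n : ℕ) := by rw [hn]
    push_cast at this
    rw [this]; ring
  rw [prodCoef, Rcoef_eq, hm', hn']
  ring

theorem prodCoef_eq_zero (σ : ℂ) {k p q r s : ℕ} (h : p + r < k ∨ q + s < k) :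
    prodCoef σ k p q r s = 0 := by
  rw [prodCoef, Rcoef_eq]
  rcases h with h | h
  · rw [transCoef_eq_zero_left h]; simp
  · rw [transCoef_eq_zero_right h]; simp

end TransvectantCoefficients

/-- Reindexing for a three-term recursion: the `k`-th summands `a`, `b`, `d` land in degrees `k`, `k
+ 1`, `k + 2`, and the coefficients beyond the range vanish. -/
theorem sum_three_term {M : Type} [AddCommGroup M] {a b d c : ℕ → M} {N : ℕ}
    (h0 : c 0 = a 0) (h1 : c 1 = a 1 + b 0) (h2 : ∀ k < N, c (k + 2) = a (k + 2) + b (k + 1) + d k)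
    (ha : a N = 0) (ha' : a (N + 1) = 0) (hb : b N = 0) :
    ∑ k ∈ Finset.range N, (a k + b k + d k) = ∑ k ∈ Finset.range (N + 2), c k := by
  rw [Finset.sum_range_succ' _ (N + 1), Finset.sum_range_succ' _ N, h0, zero_add, h1,
    Finset.sum_congr rfl fun k hk => h2 k (Finset.mem_range.1 hk)]
  have e1 : ∑ k ∈ Finset.range N, a k = ∑ k ∈ Finset.range N, a (k + 2) + a 1 + a 0 := by
    have := Finset.sum_range_succ' a (N + 1)
    rw [Finset.sum_range_succ' _ N, Finset.sum_range_succ, Finset.sum_range_succ, ha, ha', add_zero,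
      add_zero] at this
    exact this
  have e2 : ∑ k ∈ Finset.range N, b k = ∑ k ∈ Finset.range N, b (k + 1) + b 0 := by
    have := Finset.sum_range_succ' b N
    rwa [Finset.sum_range_succ, hb, add_zero] at this
  simp only [Finset.sum_add_distrib]
  rw [e1, e2]
  abel

/-! ### The product formula for symmetrized monomials. -/

section Product

variable {K : Type} [CommRing K] [Algebra ℂ K] {A : Type} [Ring A] [Algebra K A]
variable {x : Fin 3 → A} {t : K} {σ : ℂ}

theorem powerCoef_eq_zero (σ : ℂ) {k m n : ℕ} (h : 2 * m < k ∨ 2 * n < k) :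
    powerCoef σ k m n = 0 := by
  have e : ∀ m : ℕ, 2 * (m : ℂ) = ((2 * m : ℕ) : ℂ) := fun m => by push_cast; rfl
  rw [powerCoef, e, e]
  rcases h with h | h
  · rw [fallP_natCast_eq_zero h]; simp
  · rw [fallP_natCast_eq_zero h]; simp

theorem powerCoef_eq_prodCoef (σ : ℂ) (k m n : ℕ) :
    powerCoef σ k m n = prodCoef σ k 0 (2 * m) (2 * n) 0 := by
  rw [prodCoef_eq σ (zero_add _) (add_zero _), powerCoef]
  push_cast
  rw [transCoef_pure, show (-1 / 2 : ℂ) = (1 / 2) * (-1) by norm_num, mul_pow]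
  ring

/-- The product of a power of `x¹¹` and a power of `x⁰⁰`. -/
theorem ScaledTriple.bot_mul_top (hx : ScaledTriple x t (algebraMap ℂ K (σ * (σ + 1)))) (m n : ℕ) :
    symMon K x 0 (2 * m) * symMon K x (2 * n) 0 = ∑ k ∈ Finset.range (2 * m + 1),
      (t ^ k * algebraMap ℂ K (powerCoef σ k m n)) • symMon K x (2 * n - k) (2 * m - k) := by
  induction m with
  | zero => simp [powerCoef_zero]
  | succ m ih =>
    have e : symMon K x 0 (2 * (m + 1)) * symMon K x (2 * n) 0 =
        x 2 * (symMon K x 0 (2 * m) * symMon K x (2 * n) 0) := by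
      rw [symMon_bot, symMon_bot, pow_succ', mul_assoc]
    rw [e, ih, Finset.mul_sum, show 2 * (m + 1) + 1 = 2 * m + 1 + 2 by ring]
    set g : ℕ → A := fun k => symMon K x (2 * n - k) (2 * m + 2 - k) with hg
    -- Left multiplication by `x¹¹` sends the `k`-th term to the terms `k`, `k + 1`, `k + 2` of the
    -- next sum.
    have hterm : ∀ k ∈ Finset.range (2 * m + 1),
        x 2 * ((t ^ k * algebraMap ℂ K (powerCoef σ k m n)) •
          symMon K x (2 * n - k) (2 * m - k)) =
        (t ^ k * algebraMap ℂ K (powerCoef σ k m n)) • g k +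
        (t ^ (k + 1) * algebraMap ℂ K (-(2 * n - k) * powerCoef σ k m n)) • g (k + 1) +
        (t ^ (k + 2) * algebraMap ℂ K (lowCoef (σ * (σ + 1)) ((n : ℂ) + m - k) *
          ((2 * n - k) * (2 * n - k - 1)) / 4 * powerCoef σ k m n)) • g (k + 2) := by
      intro k hk
      rw [Finset.mem_range] at hk
      rcases lt_or_ge (2 * n) k with h | h
      -- When `2 n < k` the label `2 n - k` is truncated, but its coefficient is zero.
      · rw [powerCoef_eq_zero σ (Or.inr h)]
        simp
      · rw [mul_smul_comm, hx.two_mul_symMon (m := n + m - k) (by omega)]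
        simp only [hg]
        rw [show 2 * m - k + 2 = 2 * m + 2 - k by omega,
          show 2 * n - k - 1 = 2 * n - (k + 1) by omega,
          show 2 * m - k + 1 = 2 * m + 2 - (k + 1) by omega,
          show 2 * n - k - 2 = 2 * n - (k + 2) by omega,
          show 2 * m - k = 2 * m + 2 - (k + 2) by omega]
        have c1 : ((2 * n - k : ℕ) : K) = algebraMap ℂ K (2 * n - k) := by
          rw [← map_natCast (algebraMap ℂ K), Nat.cast_sub h]
          push_cast; rfl
        rw [c1, Nat.cast_sub (by omega), Nat.cast_sub h]
        simp only [Nat.cast_mul, Nat.cast_add, Nat.cast_ofNat]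
        rw [smul_add, smul_sub, smul_smul, smul_smul, neg_mul, map_neg, map_mul,
          map_mul (algebraMap ℂ K) _ (powerCoef σ k m n)]
        module
    rw [Finset.sum_congr rfl hterm]
    refine (sum_three_term
      (a := fun k => (t ^ k * algebraMap ℂ K (powerCoef σ k m n)) • g k)
      (b := fun k => (t ^ (k + 1) * algebraMap ℂ K (-(2 * n - k) * powerCoef σ k m n)) • g (k + 1))
      (d := fun k => (t ^ (k + 2) * algebraMap ℂ K (lowCoef (σ * (σ + 1)) ((n : ℂ) + m - k) *
          ((2 * n - k) * (2 * n - k - 1)) / 4 * powerCoef σ k m n)) • g (k + 2))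
      ?_ ?_ ?_ ?_ ?_ ?_).trans (Finset.sum_congr rfl fun k _ => rfl)
    · simp [powerCoef_zero, hg, mul_add]
    · simp only [hg, powerCoef_one, powerCoef_zero, ← add_smul, ← mul_add, ← map_add, zero_add,
        pow_one, Nat.cast_zero]
      push_cast
      rw [show 2 * (m + 1) = 2 * m + 2 by ring]
      congr 3
      ring
    · intro k _
      simp only [hg]
      rw [show 2 * (m + 1) = 2 * m + 2 by ring, ← add_smul, ← add_smul]
      congr 1
      rw [show k + 1 + 1 = k + 2 by ring, ← mul_add, ← mul_add, ← map_add, ← map_add, Nat.cast_succ, Nat.cast_succ, powerCoef_recursion]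
      congr 2
      ring
    · simp only [powerCoef_eq_zero σ (Or.inl (show 2 * m < 2 * m + 1 by omega))]
      simp
    · simp only [powerCoef_eq_zero σ (Or.inl (show 2 * m < 2 * m + 1 + 1 by omega))]
      simp
    · simp only [powerCoef_eq_zero σ (Or.inl (show 2 * m < 2 * m + 1 by omega))]
      simp

/-- The right-hand side of the product formula. -/
noncomputable def prodSum (x : Fin 3 → A) (t : K) (σ : ℂ) (N p q r s : ℕ) : A :=
  ∑ k ∈ Finset.range N,
    (t ^ k * algebraMap ℂ K (prodCoef σ k p q r s)) • symMon K x (p + r - k) (q + s - k)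

theorem prodSum_eq (x : Fin 3 → A) (t : K) (σ : ℂ) {N N' p q r s : ℕ} (h : p + r < N ∨ q + s < N)
    (h' : N ≤ N') : prodSum x t σ N' p q r s = prodSum x t σ N p q r s := by
  refine (Finset.sum_subset (Finset.range_subset_range.2 h') fun k _ hk => ?_).symm
  rw [Finset.mem_range, not_lt] at hk
  rw [prodCoef_eq_zero σ (by omega)]
  simp

/-- In `transCoef_raise` with `s = 0` the term raising the second factor drops out. -/
theorem prodCoef_raise (σ : ℂ) {k p q r m n : ℕ} (hm : p + (q + 1) = 2 * m) (hn : r = 2 * n) :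
    ((q + 1 : ℕ) : ℂ) * prodCoef σ k (p + 1) q r 0 =
      ((q + 1 : ℕ) - k) * prodCoef σ k p (q + 1) r 0 := by
  rw [prodCoef_eq σ (show p + 1 + q = 2 * m by omega) (show r + 0 = 2 * n by omega),
    prodCoef_eq σ hm (show r + 0 = 2 * n by omega)]
  have := transCoef_raise k p (q + 1) r 0
  push_cast at this ⊢
  rw [add_sub_cancel_right] at this
  linear_combination (1 / 2) ^ k / k.factorial * Psi k m n σ * this

theorem prodCoef_lower (σ : ℂ) {k p q r s m n : ℕ} (hm : p + q = 2 * m)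
    (hn : r + 1 + s = 2 * n) :
    (p : ℂ) * prodCoef σ k (p - 1) (q + 1) (r + 1) s + (r + 1) * prodCoef σ k p q r (s + 1) =
      (p + (r + 1) - k) * prodCoef σ k p q (r + 1) s := by
  rw [prodCoef_eq σ hm hn, prodCoef_eq σ hm (show r + (s + 1) = 2 * n by omega)]
  have := transCoef_lower k p q (r + 1) s
  rw [add_sub_cancel_right] at this
  rcases p with _ | p
  · push_cast at this ⊢
    linear_combination (1 / 2) ^ k / k.factorial * Psi k m n σ * this
  · rw [prodCoef_eq σ (show p + 1 - 1 + (q + 1) = 2 * m by omega) hn]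
    push_cast at this ⊢
    rw [add_sub_cancel_right] at this
    linear_combination (1 / 2) ^ k / k.factorial * Psi k m n σ * this

/-- Equivariance of the right-hand side of the product formula under commutation with `x⁰⁰`,
matching the Leibniz rule on the left-hand side. -/
theorem prodSum_raise (hx : ScaledTriple x t (algebraMap ℂ K (σ * (σ + 1)))) {N p q r m n : ℕ}
    (hm : p + (q + 1) = 2 * m) (hn : r = 2 * n) :
    x 0 * prodSum x t σ N p (q + 1) r 0 - prodSum x t σ N p (q + 1) r 0 * x 0 =
      t • (((2 * (q + 1) : ℕ) : K) • prodSum x t σ N (p + 1) q r 0) := by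
  rw [prodSum, prodSum, Finset.mul_sum, Finset.sum_mul, ← Finset.sum_sub_distrib, Finset.smul_sum,
    Finset.smul_sum]
  refine Finset.sum_congr rfl fun k _ => ?_
  have h := prodCoef_raise σ (k := k) hm hn
  have h' := congrArg (algebraMap ℂ K) h
  simp only [map_mul, map_natCast, map_sub] at h'
  rw [mul_smul_comm, smul_mul_assoc, ← smul_sub]
  -- Outside the range the labels are truncated and the commutator formula is unavailable, but the
  -- coefficient vanishes.
  by_cases hk : p + r < k ∨ q + 1 + 0 < k
  · rw [prodCoef_eq_zero σ hk, map_zero, mul_zero] at h'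
    rw [prodCoef_eq_zero σ hk, map_zero, mul_zero, zero_smul]
    push_cast at h' ⊢
    linear_combination (norm := module) (-2 * t * t ^ k) •
      (h' • symMon K x (p + 1 + r - k) (q + 0 - k))
  · rw [hx.comm_zero_symMon (m := m + n - k) (by omega)]
    rw [show p + r - k + 1 = p + 1 + r - k by omega, show q + 1 + 0 - k - 1 = q + 0 - k by omega,
      Nat.cast_sub (by omega)]
    push_cast at h' ⊢
    linear_combination (norm := module) (-2 * t * t ^ k) •
      (h' • symMon K x (p + 1 + r - k) (q + 0 - k))

theorem prodSum_lower (hx : ScaledTriple x t (algebraMap ℂ K (σ * (σ + 1)))) {N p q r s m n : ℕ}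
    (hm : p + q = 2 * m) (hn : r + 1 + s = 2 * n) :
    x 2 * prodSum x t σ N p q (r + 1) s - prodSum x t σ N p q (r + 1) s * x 2 =
      t • ((-2 * p : K) • prodSum x t σ N (p - 1) (q + 1) (r + 1) s +
        (-2 * (r + 1) : K) • prodSum x t σ N p q r (s + 1)) := by
  rw [prodSum, prodSum, prodSum, Finset.mul_sum, Finset.sum_mul, ← Finset.sum_sub_distrib,
    Finset.smul_sum, Finset.smul_sum, ← Finset.sum_add_distrib, Finset.smul_sum]
  refine Finset.sum_congr rfl fun k _ => ?_
  have h := prodCoef_lower σ (k := k) hm hn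
  have h' := congrArg (algebraMap ℂ K) h
  simp only [map_mul, map_natCast, map_sub, map_add, map_one] at h'
  rw [mul_smul_comm, smul_mul_assoc, ← smul_sub]
  -- The truncated `p - 1` at `p = 0` is harmless because of the factor `p`.
  have e1 : (p : K) • (symMon K x (p - 1 + (r + 1) - k) (q + 1 + s - k)) =
      (p : K) • symMon K x (p + r - k) (q + (s + 1) - k) := by
    rcases p with _ | p
    · simp
    · rw [show p + 1 - 1 + (r + 1) - k = p + 1 + r - k by omega,
        show q + 1 + s - k = q + (s + 1) - k by omega]
  set P := symMon K x (p + r - k) (q + (s + 1) - k)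
  by_cases hk : p + (r + 1) < k ∨ q + s < k
  · rw [prodCoef_eq_zero σ hk, map_zero, mul_zero] at h'
    rw [prodCoef_eq_zero σ hk, map_zero, mul_zero, zero_smul]
    linear_combination (norm := module) (2 * t * t ^ k) • (h' • P) +
      (2 * t * t ^ k * algebraMap ℂ K (prodCoef σ k (p - 1) (q + 1) (r + 1) s)) • e1
  · rw [hx.comm_two_symMon (m := m + n - k) (by omega)]
    rw [show p + (r + 1) - k - 1 = p + r - k by omega,
      show q + s - k + 1 = q + (s + 1) - k by omega, Nat.cast_sub (by omega)]
    push_cast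
    linear_combination (norm := module) (2 * t * t ^ k) • (h' • P) +
      (2 * t * t ^ k * algebraMap ℂ K (prodCoef σ k (p - 1) (q + 1) (r + 1) s)) • e1

/-- The product of two symmetrized monomials. -/
theorem ScaledTriple.symMon_mul_symMon (hx : ScaledTriple x t (algebraMap ℂ K (σ * (σ + 1))))
    (ht : ∀ a b : A, t • a = t • b → a = b) {p q r s m n N : ℕ} (hm : p + q = 2 * m)
    (hn : r + s = 2 * n) (hN : 2 * m + 2 * n < N) :
    symMon K x p q * symMon K x r s = prodSum x t σ N p q r s := by
  -- Two ladders reach every pair of labels. For `s = 0` the second factor commutes with `x⁰⁰`, so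
  -- commuting with `x⁰⁰` raises `p` from the extremal pair; commuting with `x¹¹` then raises `s`.
  induction s generalizing p q r with
  | zero =>
    obtain rfl : r = 2 * n := by omega
    induction p generalizing q with
    | zero =>
      obtain rfl : q = 2 * m := by omega
      rw [hx.bot_mul_top, prodSum_eq (N := 2 * m + 1) x t σ (by omega) (by omega)]
      refine Finset.sum_congr rfl fun k _ => ?_
      rw [powerCoef_eq_prodCoef, zero_add, add_zero]
    | succ p ih =>
      have h1 := ih (q := q + 1) (by omega)
      -- The commutator gives the desired monomial multiplied by `2 t (q + 1)`; the integer is a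
      -- unit and `ht` cancels `t`.
      refine natCast_smul_cancel (K := K) (n := 2 * (q + 1)) (by omega) (ht _ _ ?_)
      rw [← prodSum_raise hx (m := m) (n := n) (by omega) rfl, ← h1]
      have h2 := hx.comm_zero_symMon (m := m) (p := p) (q := q + 1) (by omega)
      have h3 := hx.comm_zero_symMon (m := n) (p := 2 * n) (q := 0) (by omega)
      rw [Nat.add_sub_cancel] at h2
      have h4 : x 0 * (symMon K x p (q + 1) * symMon K x (2 * n) 0) -
          symMon K x p (q + 1) * symMon K x (2 * n) 0 * x 0 =
          (x 0 * symMon K x p (q + 1) - symMon K x p (q + 1) * x 0) * symMon K x (2 * n) 0 +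
          symMon K x p (q + 1) * (x 0 * symMon K x (2 * n) 0 - symMon K x (2 * n) 0 * x 0) := by
        noncomm_ring
      rw [h4, h2, h3, smul_mul_assoc]
      push_cast
      simp only [mul_zero, zero_smul, add_zero, smul_smul]
      congr 1
      ring
  | succ s ih =>
    have h1 := ih (p := p) (q := q) (r := r + 1) hm (by omega)
    have h2 : (p : K) • (symMon K x (p - 1) (q + 1) * symMon K x (r + 1) s) =
        (p : K) • prodSum x t σ N (p - 1) (q + 1) (r + 1) s := by
      rcases p with _ | p
      · simp
      · rw [ih (by omega) (by omega)]
    refine natCast_smul_cancel (K := K) (n := 2 * (r + 1)) (by omega) (ht _ _ ?_)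
    have h3 := prodSum_lower hx (N := N) hm (r := r) (s := s) (n := n) (by omega)
    rw [← h1] at h3
    have h4 := hx.comm_two_symMon hm
    have h5 := hx.comm_two_symMon (m := n) (p := r + 1) (q := s) (by omega)
    rw [Nat.add_sub_cancel] at h5
    have h6 : x 2 * (symMon K x p q * symMon K x (r + 1) s) -
        symMon K x p q * symMon K x (r + 1) s * x 2 =
        (x 2 * symMon K x p q - symMon K x p q * x 2) * symMon K x (r + 1) s +
        symMon K x p q * (x 2 * symMon K x (r + 1) s - symMon K x (r + 1) s * x 2) := by
      noncomm_ring
    rw [h6, h4, h5, smul_mul_assoc, mul_smul_comm] at h3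
    push_cast at h3 ⊢
    linear_combination (norm := module) -h3 - (2 * t) • h2

end Product

/-! ### The span of the symmetrized monomials is the generated algebra. -/

section Span

open Polynomial

variable {K : Type} [CommRing K] [Algebra ℂ K] {A : Type} [Ring A] [Algebra K A]
variable {x : Fin 3 → A} {t : K} {μ : ℂ}

theorem smul_mem_iff_of_natCast {S : Submodule K A} {n : ℕ} (hn : n ≠ 0) {a : A}
    (h : (n : K) • a ∈ S) : a ∈ S := by
  have h1 : (algebraMap ℂ K ((n : ℂ)⁻¹)) * (n : K) = 1 := by
    rw [← map_natCast (algebraMap ℂ K), ← map_mul, inv_mul_cancel₀ (Nat.cast_ne_zero.2 hn),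
      map_one]
  have h2 := S.smul_mem (algebraMap ℂ K ((n : ℂ)⁻¹)) h
  rwa [smul_smul, h1, one_smul] at h2

variable (K x) in
/-- The span of the symmetrized monomials of even degree. -/
noncomputable def symSpan : Submodule K A :=
  Submodule.span K {a | ∃ p q m : ℕ, p + q = 2 * m ∧ a = symMon K x p q}

theorem symMon_mem {p q m : ℕ} (h : p + q = 2 * m) : symMon K x p q ∈ symSpan K x :=
  Submodule.subset_span ⟨p, q, m, h, rfl⟩

theorem one_mem_symSpan : (1 : A) ∈ symSpan K x := by
  rw [← symMon_zero_zero K x]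
  exact symMon_mem (m := 0) rfl

variable (K) in
/-- Polynomials all of whose coefficients lie in a submodule. -/
def CoeffsIn (S : Submodule K A) (P : A[X]) : Prop := ∀ i, P.coeff i ∈ S

theorem coeffsIn_genPoly_pow (m : ℕ) : CoeffsIn K (symSpan K x) (genPoly x ^ m) := by
  intro i
  rcases lt_or_ge (2 * m) i with h | h
  · rw [coeff_genPoly_pow_eq_zero x h]
    exact zero_mem _
  · rw [coeff_genPoly_pow K x]
    exact Submodule.smul_mem _ _ (symMon_mem (m := m) (by omega))

theorem CoeffsIn.derivative {S : Submodule K A} {P : A[X]} (h : CoeffsIn K S P) :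
    CoeffsIn K S (derivative P) := fun i => by
  rw [coeff_derivative_smul (K := K)]
  exact S.smul_mem _ (h _)

theorem CoeffsIn.X_mul {S : Submodule K A} {P : A[X]} (h : CoeffsIn K S P) :
    CoeffsIn K S (X * P) := fun i => by
  rcases i with _ | i
  · simp
  · rw [coeff_X_mul]; exact h i

theorem symMon_mem_of_mul_mem {S : Submodule K A} (hx : ∀ m, CoeffsIn K S (genPoly x ^ m))
    {p q m : ℕ} (h : p + q = 2 * m) : symMon K x p q ∈ S := by
  rw [symMon, h, Nat.mul_div_cancel_left m two_pos]
  exact S.smul_mem _ (hx m q)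

theorem ScaledTriple.coeffsIn_h_mul (hx : ScaledTriple x t (algebraMap ℂ K μ)) (m : ℕ) :
    CoeffsIn K (symSpan K x) (Polynomial.derivative (genPoly x) * genPoly x ^ m) := fun i => by
  refine smul_mem_iff_of_natCast (K := K) (Nat.succ_ne_zero m) ?_
  rw [← coeff_smul, Nat.cast_succ, hx.h_mul_pow, coeff_sub, coeff_smul]
  exact sub_mem ((coeffsIn_genPoly_pow _).derivative i)
    (Submodule.smul_mem _ _ (coeffsIn_genPoly_pow _ i))

theorem ScaledTriple.coeffsIn_two_mul (hx : ScaledTriple x t (algebraMap ℂ K μ)) (m : ℕ) :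
    CoeffsIn K (symSpan K x) (C (x 2) * genPoly x ^ m) := fun i => by
  rw [coeff_C_mul]
  rcases lt_or_ge (2 * m) i with h | h
  · rw [coeff_genPoly_pow_eq_zero x h, mul_zero]
    exact zero_mem _
  obtain ⟨p, hp⟩ : ∃ p, p + i = 2 * m := ⟨2 * m - i, by omega⟩
  rw [← choose_smul_symMon K x hp, mul_smul_comm, hx.two_mul_symMon hp]
  refine Submodule.smul_mem _ _ (add_mem (sub_mem ?_ ?_) ?_)
  · exact symMon_mem (m := m + 1) (by omega)
  · rcases p with _ | p
    · simp
    · exact Submodule.smul_mem _ _ (symMon_mem (m := m) (by omega))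
  · match p with
    | 0 | 1 => simp
    | p + 2 => exact Submodule.smul_mem _ _ (symMon_mem (m := m - 1) (by omega))

/-- The system `w'' = 2 x¹¹`, `w' = 2 x⁰¹ + 2 y x¹¹`, `w = x⁰⁰ + 2 y x⁰¹ + y² x¹¹` is triangular:
the case of `x¹¹` gives that of `x⁰¹`, and both give that of `x⁰⁰`. -/
theorem ScaledTriple.coeffsIn_gen_mul (hx : ScaledTriple x t (algebraMap ℂ K μ)) (j : Fin 3)
    (m : ℕ) : CoeffsIn K (symSpan K x) (C (x j) * genPoly x ^ m) := by
  have h2 := hx.coeffsIn_two_mul m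
  have h1 : CoeffsIn K (symSpan K x) (C (x 1) * genPoly x ^ m) := fun i => by
    refine smul_mem_iff_of_natCast (K := K) two_ne_zero ?_
    have e : (2 : K) • (C (x 1) * genPoly x ^ m) =
        Polynomial.derivative (genPoly x) * genPoly x ^ m -
          (2 : K) • (X * (C (x 2) * genPoly x ^ m)) := by
      rw [derivative_genPoly, monomial_zero_left, ← C_mul_X_eq_monomial, ← mul_assoc, X_mul_C,
        C_add, C_add]
      simp only [add_mul, two_smul]
      abel
    rw [← coeff_smul, Nat.cast_ofNat, e, coeff_sub, coeff_smul]
    exact sub_mem (hx.coeffsIn_h_mul m i) (Submodule.smul_mem _ _ (h2.X_mul i))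
  fin_cases j
  · intro i
    have e : C (x 0) * genPoly x ^ m = genPoly x ^ (m + 1) -
        (2 : K) • (X * (C (x 1) * genPoly x ^ m)) - X * (X * (C (x 2) * genPoly x ^ m)) := by
      rw [pow_succ', genPoly, monomial_zero_left, ← C_mul_X_eq_monomial,
        ← C_mul_X_pow_eq_monomial, ← mul_assoc X, ← mul_assoc X (C _), X_mul_C, X_mul_C,
        mul_assoc (C (x 2)), ← mul_assoc X (C _), X_mul_C, C_add, pow_two]
      simp only [add_mul, two_smul, mul_assoc]
      abel
    change (C (x 0) * genPoly x ^ m).coeff i ∈ _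
    rw [e, coeff_sub, coeff_sub, coeff_smul]
    exact sub_mem (sub_mem (coeffsIn_genPoly_pow _ i) (Submodule.smul_mem _ _ (h1.X_mul i)))
      (h2.X_mul.X_mul i)
  · exact h1
  · exact h2

/-- The span of the symmetrized monomials is a left ideal. -/
theorem ScaledTriple.gen_mul_mem (hx : ScaledTriple x t (algebraMap ℂ K μ)) (j : Fin 3) {a : A}
    (ha : a ∈ symSpan K x) : x j * a ∈ symSpan K x := by
  refine Submodule.span_induction (p := fun a _ => x j * a ∈ symSpan K x) ?_ ?_ ?_ ?_ ha
  · rintro _ ⟨p, q, m, h, rfl⟩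
    rw [symMon, h, Nat.mul_div_cancel_left m two_pos, mul_smul_comm, ← coeff_C_mul]
    exact Submodule.smul_mem _ _ (hx.coeffsIn_gen_mul j m q)
  · simp
  · intro a b _ _ ha hb
    rw [mul_add]
    exact add_mem ha hb
  · intro c a _ ha
    rw [mul_smul_comm]
    exact Submodule.smul_mem _ _ ha

/-- A subalgebra containing the generators contains the span of the symmetrized monomials. -/
theorem symSpan_le {S : Subalgebra K A} (h : ∀ j, x j ∈ S) :
    symSpan K x ≤ Subalgebra.toSubmodule S := by
  have hw : ∀ i, (genPoly x).coeff i ∈ S := fun i => by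
    rw [genPoly, coeff_add, coeff_add, coeff_monomial, coeff_monomial, coeff_monomial]
    refine add_mem (add_mem ?_ ?_) ?_ <;> split_ifs
    exacts [h 0, zero_mem _, add_mem (h 1) (h 1), zero_mem _, h 2, zero_mem _]
  have hm : ∀ m i, (genPoly x ^ m).coeff i ∈ S := by
    intro m
    induction m with
    | zero =>
      intro i
      rw [pow_zero, coeff_one]
      split_ifs
      exacts [one_mem _, zero_mem _]
    | succ m ih =>
      intro i
      rw [pow_succ, coeff_mul]
      exact sum_mem fun y _ => mul_mem (ih _) (hw _)
  refine Submodule.span_le.2 ?_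
  rintro _ ⟨p, q, m, h, rfl⟩
  exact symMon_mem_of_mul_mem (S := Subalgebra.toSubmodule S) hm h

/-- The span of the symmetrized monomials is the subalgebra generated by the triple. -/
theorem ScaledTriple.symSpan_eq (hx : ScaledTriple x t (algebraMap ℂ K μ)) :
    symSpan K x = Subalgebra.toSubmodule (Algebra.adjoin K (Set.range x)) := by
  refine le_antisymm (symSpan_le fun j => Algebra.subset_adjoin ⟨j, rfl⟩) fun a ha => ?_
  -- The span is stable under left multiplication by the whole algebra and contains `1`, hence
  -- contains the algebra.
  have h : ∀ b ∈ symSpan K x, a * b ∈ symSpan K x := by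
    refine Algebra.adjoin_induction (p := fun a _ => ∀ b ∈ symSpan K x, a * b ∈ symSpan K x)
      ?_ ?_ ?_ ?_ ha
    · rintro _ ⟨j, rfl⟩ b hb
      exact hx.gen_mul_mem j hb
    · intro r b hb
      rw [← Algebra.smul_def]
      exact Submodule.smul_mem _ _ hb
    · intro a a' _ _ h h' b hb
      rw [add_mul]
      exact add_mem (h b hb) (h' b hb)
    · intro a a' _ _ h h' b hb
      rw [mul_assoc]
      exact h _ (h' b hb)
  simpa using h 1 one_mem_symSpan

/-- The linear map sending the label `(p, q)` to the symmetrized monomial `u₀^p u₁^q`. -/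
noncomputable def symMap (K : Type) [CommRing K] [Algebra ℂ K] {A : Type} [Ring A] [Algebra K A]
    (x : Fin 3 → A) : (WIdx →₀ K) →ₗ[K] A :=
  Finsupp.linearCombination K fun i : WIdx => symMon K x i.1.1 i.1.2

theorem symMap_single (i : WIdx) (c : K) :
    symMap K x (Finsupp.single i c) = c • symMon K x i.1.1 i.1.2 :=
  Finsupp.linearCombination_single _ _ _

theorem range_symMap : LinearMap.range (symMap K x) = symSpan K x := by
  rw [symMap, Finsupp.range_linearCombination, symSpan]
  congr 1
  ext a
  constructor
  · rintro ⟨⟨⟨p, q⟩, m, h⟩, rfl⟩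
    exact ⟨p, q, m, by dsimp only at h; omega, rfl⟩
  · rintro ⟨p, q, m, h, rfl⟩
    exact ⟨⟨(p, q), m, by dsimp only; omega⟩, rfl⟩

variable {A' : Type} [Ring A'] [Algebra K A']

theorem map_symMon (f : A →ₐ[K] A') (p q : ℕ) :
    f (symMon K x p q) = symMon K (fun j => f (x j)) p q := by
  have h : (genPoly x).map (f : A →+* A') = genPoly fun j => f (x j) := by
    simp [genPoly]
  rw [symMon, symMon, ← h, ← Polynomial.map_pow, coeff_map, map_smul]
  rfl

theorem map_symMap (f : A →ₐ[K] A') (w : WIdx →₀ K) :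
    f (symMap K x w) = symMap K (fun j => f (x j)) w := by
  simp only [symMap, Finsupp.linearCombination_apply, Finsupp.sum, map_sum, map_smul, map_symMon]

end Span


/-! ### The Moyal algebra as a ring, and freeness from the classical limit. -/

section MoyalAlgebra

variable {A : Type} [CommRing A] [Algebra ℂ A]

/-- Commuting derivations, and a constant scaling the Poisson structure. -/
class MoyalData (d : Fin 2 → Derivation ℂ A A) (k : ℂ) : Prop where
  comm : ∀ f, d 0 (d 1 f) = d 1 (d 0 f)
  ne_zero : k ≠ 0

/-- Formal power series with the Moyal product. -/
def MoyalAlg (_d : Fin 2 → Derivation ℂ A A) (_k : ℂ) : Type := A⟦X⟧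

namespace MoyalAlg

variable (d : Fin 2 → Derivation ℂ A A) (k : ℂ)

noncomputable instance : AddCommGroup (MoyalAlg d k) := inferInstanceAs (AddCommGroup A⟦X⟧)

noncomputable instance : Module R (MoyalAlg d k) := inferInstanceAs (Module R A⟦X⟧)

/-- The identity map to the Moyal algebra. -/
noncomputable def of : A⟦X⟧ ≃ₗ[R] MoyalAlg d k := LinearEquiv.refl R A⟦X⟧

variable [hd : MoyalData d k]

noncomputable instance : Mul (MoyalAlg d k) :=
  ⟨fun f g => of d k (formalStar d (algebraMap ℂ A k) ((of d k).symm f) ((of d k).symm g))⟩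

noncomputable instance : One (MoyalAlg d k) := ⟨of d k 1⟩

theorem of_mul_of (f g : A⟦X⟧) :
    of d k f * of d k g = of d k (formalStar d (algebraMap ℂ A k) f g) := rfl

theorem one_def : (1 : MoyalAlg d k) = of d k 1 := rfl

noncomputable instance : Ring (MoyalAlg d k) :=
  { (inferInstance : AddCommGroup (MoyalAlg d k)) with
    mul_assoc := fun f g h => star_assoc hd.comm (fun a => (d a).map_algebraMap k) f g h
    one_mul := fun f => star_one_left d _ f
    mul_one := fun f => star_one_right d _ f
    left_distrib := fun f g h => star_add_right d _ f g h
    right_distrib := fun f g h => star_add_left d _ f g h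
    zero_mul := fun f => by
      have := star_smul_left d (algebraMap ℂ A k) 0 (0 : A⟦X⟧) f
      rw [zero_smul, zero_smul] at this
      exact this
    mul_zero := fun f => by
      have := star_smul_right d (algebraMap ℂ A k) 0 f (0 : A⟦X⟧)
      rw [zero_smul, zero_smul] at this
      exact this }

noncomputable instance : Algebra R (MoyalAlg d k) :=
  Algebra.ofModule (fun r f g => star_smul_left d _ r f g) (fun r f g => star_smul_right d _ r f g)

/-- The classical limit `𝔮 = 0`. -/
noncomputable def classical : MoyalAlg d k →+* A where
  toFun f := PowerSeries.coeff 0 ((of d k).symm f)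
  map_one' := by
    rw [one_def, LinearEquiv.symm_apply_apply]
    simp
  map_mul' f g := coeff_zero_star d _ _ _
  map_zero' := by simp
  map_add' f g := by simp

theorem classical_smul (r : R) (f : MoyalAlg d k) :
    classical d k (r • f) = PowerSeries.coeff 0 r • classical d k f := by
  change PowerSeries.coeff 0 ((of d k).symm (r • f)) = _ • PowerSeries.coeff 0 ((of d k).symm f)
  rw [map_smul]
  change PowerSeries.coeff 0 (PowerSeries.map (algebraMap ℂ A) r * _) = _
  rw [PowerSeries.coeff_mul, Finset.Nat.antidiagonal_zero, Finset.sum_singleton,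
    PowerSeries.coeff_map, ← Algebra.smul_def]

/-- `𝔮(λ)`. -/
noncomputable def param (k : ℂ) : R := PowerSeries.C k * qq

theorem param_smul (f : A⟦X⟧) : param k • f = qkap (algebraMap ℂ A k) * f := by
  change PowerSeries.map (algebraMap ℂ A) (PowerSeries.C k * PowerSeries.X) * f = _
  rw [map_mul, PowerSeries.map_X, PowerSeries.map_C, qkap, mul_comm (PowerSeries.C _)]

theorem mul_sub_mul (f g : A⟦X⟧) : of d k f * of d k g - of d k g * of d k f =
    param k • of d k (formalBracket d (algebraMap ℂ A k) f g) := by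
  rw [of_mul_of, of_mul_of, ← map_sub, star_sub_star, ← param_smul, map_smul]

theorem X_smul_cancel {f : MoyalAlg d k} (h : (PowerSeries.X : R) • f = 0) : f = 0 := by
  have h1 : PowerSeries.map (algebraMap ℂ A) PowerSeries.X * (of d k).symm f = 0 := h
  rw [PowerSeries.map_X] at h1
  refine PowerSeries.ext fun n => ?_
  have h2 := congrArg (PowerSeries.coeff (n + 1)) h1
  rw [PowerSeries.coeff_succ_X_mul] at h2
  exact h2

/-- `𝔮(λ)` is a unit times the variable of the power series ring, so it acts injectively. This
allows division of commutators by it. -/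
theorem param_smul_cancel {f g : MoyalAlg d k} (h : param k • f = param k • g) : f = g := by
  have h1 : param k • (f - g) = 0 := by rw [smul_sub, h, sub_self]
  rw [param, mul_smul] at h1
  have h2 := congrArg (fun y => (PowerSeries.C k⁻¹ : R) • y) h1
  simp only [smul_smul, smul_zero] at h2
  rw [← mul_assoc, ← map_mul, inv_mul_cancel₀ hd.ne_zero, map_one, one_mul] at h2
  exact sub_eq_zero.1 (X_smul_cancel d k h2)

end MoyalAlg

section Injectivity

open Polynomial

variable {B : Type} [CommRing B] [Algebra ℂ B]

theorem coeff_linear_pow (a b : B) (n i : ℕ) :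
    ((C b * X + C a) ^ n).coeff i = a ^ (n - i) * (n.choose i : B) * b ^ i := by
  have h : (C b * X + C a) ^ n = ((X + C a) ^ n).comp (C b * X) := by simp
  rw [h, comp_C_mul_X_coeff, coeff_X_add_C_pow]

/-- The classical limit of a symmetrized monomial. -/
theorem ringHom_symMon {A : Type} [Ring A] [Algebra R A] (ρ : A →+* B)
    (hρ : ∀ (r : R) f, ρ (r • f) = PowerSeries.coeff 0 r • ρ f) {x : Fin 3 → A} {u v : B}
    (h0 : ρ (x 0) = u ^ 2) (h1 : ρ (x 1) = u * v) (h2 : ρ (x 2) = v ^ 2) {p q m : ℕ}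
    (h : p + q = 2 * m) : ρ (symMon R x p q) = u ^ p * v ^ q := by
  have hw : (genPoly x).map ρ = (C v * X + C u) ^ 2 := by
    rw [genPoly, Polynomial.map_add, Polynomial.map_add, map_monomial, map_monomial, map_monomial,
      map_add, h0, h1, h2, monomial_zero_left, ← C_mul_X_eq_monomial, ← C_mul_X_pow_eq_monomial]
    simp only [map_pow, map_mul, map_add]
    ring
  have hc := Nat.choose_pos (show q ≤ p + q by omega)
  rw [symMon, hρ, ← coeff_map, Polynomial.map_pow, hw, ← pow_mul, h, Nat.mul_div_cancel_left m two_pos,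
    coeff_linear_pow, ← h, Nat.add_sub_cancel, Algebra.algebraMap_eq_smul_one]
  have e : PowerSeries.coeff 0 (((((p + q).choose q : ℕ) : ℂ)⁻¹) • (1 : R)) =
      (((p + q).choose q : ℕ) : ℂ)⁻¹ := by simp
  rw [e, mul_right_comm, mul_comm, Algebra.smul_def, ← mul_assoc, ← map_natCast (algebraMap ℂ B),
    ← map_mul, inv_mul_cancel₀ (Nat.cast_ne_zero.2 hc.ne'), map_one, one_mul]

/-- Freeness over `ℂ⟦𝔮⟧` from freeness in the classical limit. -/
theorem linearCombination_injective {A : Type} [Ring A] [Algebra R A] (ρ : A →+* B)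
    (hρ : ∀ (r : R) f, ρ (r • f) = PowerSeries.coeff 0 r • ρ f)
    (hX : ∀ f : A, (PowerSeries.X : R) • f = 0 → f = 0) {ι : Type} (v : ι → A)
    (hv : LinearIndependent ℂ fun i => ρ (v i)) :
    Function.Injective (Finsupp.linearCombination R v) := by
  rw [injective_iff_map_eq_zero]
  have key : ∀ (n : ℕ) (w : ι →₀ R), Finsupp.linearCombination R v w = 0 →
      ∀ i, PowerSeries.coeff n (w i) = 0 := by
    -- Modulo `𝔮` a relation becomes one over `ℂ` in the classical limit, so its constant terms
    -- vanish.
    have h0 : ∀ w : ι →₀ R, Finsupp.linearCombination R v w = 0 →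
        ∀ i, PowerSeries.coeff 0 (w i) = 0 := by
      intro w hw i
      have h1 := congrArg ρ hw
      rw [Finsupp.linearCombination_apply, Finsupp.sum, map_sum, map_zero] at h1
      simp only [hρ] at h1
      by_cases hi : i ∈ w.support
      · exact linearIndependent_iff'.1 hv w.support (fun i => PowerSeries.coeff 0 (w i)) h1 i hi
      · rw [Finsupp.notMem_support_iff.1 hi, map_zero]
    intro n
    induction n with
    | zero => exact h0
    | succ n ih =>
      intro w hw i
      -- All coefficients are then divisible by `𝔮`; dividing gives a relation with indices shifted
      -- down by one.
      let w' : ι →₀ R := Finsupp.mapRange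
        (fun r : R => (PowerSeries.mk fun n => PowerSeries.coeff (n + 1) r : R)) (by ext; simp) w
      have hw' : w = (PowerSeries.X : R) • w' := by
        ext j n
        rw [Finsupp.smul_apply, smul_eq_mul, Finsupp.mapRange_apply]
        rcases n with _ | n
        · rw [h0 w hw j]; simp
        · rw [PowerSeries.coeff_succ_X_mul, PowerSeries.coeff_mk]
      rw [hw', map_smul] at hw
      have h2 := ih w' (hX _ hw) i
      rwa [Finsupp.mapRange_apply, PowerSeries.coeff_mk] at h2
  intro w hw
  ext i n
  exact key n w hw i

end Injectivity

end MoyalAlgebra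

/-! ### Independence of the monomials on the punctured fibre. -/

section FibreMonomials

/-- The fibre coordinates as functions on the punctured fibre. -/
noncomputable def fibCoord (a : Fin 2) : SmoothFn Fib := linFn Fib (ContinuousLinearMap.proj a)

/-- A relation is a polynomial vanishing off the origin. Multiplied by the first coordinate it
vanishes on all of `ℂ²`, hence is the zero polynomial. -/
theorem linearIndependent_fibre_monomials :
    LinearIndependent ℂ fun i : WIdx => fibCoord 0 ^ i.1.1 * fibCoord 1 ^ i.1.2 := by
  rw [linearIndependent_iff']
  intro s g hg i hi
  let e : WIdx → (Fin 2 →₀ ℕ) := fun i => Finsupp.single 0 i.1.1 + Finsupp.single 1 i.1.2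
  have he : Function.Injective e := by
    rintro ⟨⟨a, b⟩, h⟩ ⟨⟨a', b'⟩, h'⟩ heq
    have h0 := DFunLike.congr_fun heq 0
    have h1 := DFunLike.congr_fun heq 1
    simp [e] at h0 h1
    simp [h0, h1]
  let P : MvPolynomial (Fin 2) ℂ := ∑ i ∈ s, MvPolynomial.monomial (e i) (g i)
  have hP : MvPolynomial.X 0 * P = 0 := by
    refine MvPolynomial.funext fun z => ?_
    rw [map_mul, map_zero, MvPolynomial.eval_X]
    by_cases hz : z 0 = 0
    · rw [hz, zero_mul]
    · have hz' : z ∈ Fib := fun h => hz (by rw [h]; rfl)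
      have h1 := congrFun (congrArg Subtype.val hg) ⟨z, hz'⟩
      rw [AddSubmonoidClass.coe_finsetSum, Finset.sum_apply] at h1
      have h2 : MvPolynomial.eval z P = 0 := by
        rw [map_sum]
        refine Eq.trans (Finset.sum_congr rfl fun j _ => ?_) h1
        rw [MvPolynomial.eval_monomial, Finsupp.prod_fintype _ _ (by simp), Fin.prod_univ_two]
        have e0 : e j 0 = j.1.1 := by simp [e]
        have e1 : e j 1 = j.1.2 := by simp [e]
        rw [e0, e1]
        rfl
      rw [h2, mul_zero]
  have hP' : P = 0 := (mul_eq_zero.1 hP).resolve_left (MvPolynomial.X_ne_zero 0)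
  have h3 := congrArg (MvPolynomial.coeff (e i)) hP'
  rw [MvPolynomial.coeff_sum, MvPolynomial.coeff_zero, Finset.sum_eq_single i] at h3
  · simpa using h3
  · intro j _ hj
    rw [MvPolynomial.coeff_monomial, if_neg fun h => hj (he h)]
  · intro h; exact absurd hi h

end FibreMonomials


/-! ### Triples from symmetric generators. -/

theorem contract_eq {A : Type} [AddCommGroup A] (m : A → A → A) (T : Fin 2 → Fin 2 → A) :
    contract m T = m (T 0 0) (T 1 1) + m (T 1 1) (T 0 0) - m (T 0 1) (T 1 0) -
      m (T 1 0) (T 0 1) := by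
  simp [contract, eps, Fin.sum_univ_two]
  abel

theorem C_half_mul_two : (PowerSeries.C (1 / 2 : ℂ) : R) * 2 = 1 := by
  rw [← map_ofNat (PowerSeries.C (R := ℂ)) 2, ← map_mul]
  norm_num

theorem neg_eight_mul_C : (-8 : R) * PowerSeries.C (-1 / 8 : ℂ) = 1 := by
  rw [← map_ofNat (PowerSeries.C (R := ℂ)) 8, ← map_neg, ← map_mul]
  norm_num

section GenericCommutators

variable {K : Type} [CommRing K] {M : Type} [Ring M] [Algebra K M] {x : Fin 3 → M} {t z : K}

theorem commutator_combination (hx : ScaledTriple x t z) (a b : Fin 3 → K) :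
    (a 0 • x 0 + a 1 • x 1 + a 2 • x 2) * (b 0 • x 0 + b 1 • x 1 + b 2 • x 2) -
      (b 0 • x 0 + b 1 • x 1 + b 2 • x 2) * (a 0 • x 0 + a 1 • x 1 + a 2 • x 2) =
    (2 * t * (a 0 * b 1 - a 1 * b 0)) • x 0 + (4 * t * (a 0 * b 2 - a 2 * b 0)) • x 1 +
      (2 * t * (a 1 * b 2 - a 2 * b 1)) • x 2 := by
  have h01 := hx.comm01
  have h02 := hx.comm02
  have h12 := hx.comm12
  simp only [mul_add, add_mul, smul_mul_assoc, mul_smul_comm]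
  linear_combination (norm := module) (a 0 * b 1 - a 1 * b 0) • h01 +
    (a 0 * b 2 - a 2 * b 0) • h02 + (a 1 * b 2 - a 2 * b 1) • h12

/-- A triple from symmetric generators with the commutators of `sl_{2,t}`. -/
theorem ScaledTriple.of_symmetric {X : Fin 2 → Fin 2 → M} (hs : X 1 0 = X 0 1)
    (hc : ∀ a b d e, X a b * X d e - X d e * X a b =
      t • ((eps a d : K) • X b e + (eps a e : K) • X b d + (eps b d : K) • X a e +
        (eps b e : K) • X a d)) {e : K} (he : (-8 : K) * e = 1)
    (h : e • contract (fun f g => f * g) X = (t ^ 2 * z) • (1 : M)) :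
    ScaledTriple ![X 0 0, X 0 1, X 1 1] t z := by
  refine ⟨?_, ?_, ?_, ?_⟩
  · change X 0 0 * X 0 1 - X 0 1 * X 0 0 = (2 * t) • X 0 0
    rw [hc]
    simp [eps]
    module
  · change X 0 0 * X 1 1 - X 1 1 * X 0 0 = (4 * t) • X 0 1
    rw [hc]
    simp [eps]
    module
  · change X 0 1 * X 1 1 - X 1 1 * X 0 1 = (2 * t) • X 1 1
    rw [hc]
    simp [eps]
    module
  · change X 0 0 * X 1 1 + X 1 1 * X 0 0 - (2 : K) • (X 0 1 * X 0 1) = _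
    rw [contract_eq, hs] at h
    linear_combination (norm := module) (-8 : K) • h - he • (X 0 0 * X 1 1 + X 1 1 * X 0 0 -
      X 0 1 * X 0 1 - X 0 1 * X 0 1)

theorem ScaledTriple.casimir_eq (hx : ScaledTriple x t z) {e : K} (he : (-8 : K) * e = 1) :
    e • (x 0 * x 2 + x 2 * x 0 - x 1 * x 1 - x 1 * x 1) = (t ^ 2 * z) • (1 : M) := by
  have hc := hx.casimir
  linear_combination (norm := module) e • hc + (t ^ 2 * z) • (he • (1 : M))

theorem map_smul_contract {M' : Type} [Ring M'] [Algebra K M'] (f : M →ₐ[K] M') (e : K)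
    (X : Fin 2 → Fin 2 → M) : f (e • contract (fun a b => a * b) X) =
      e • contract (fun a b => a * b) fun a b => f (X a b) := by
  rw [map_smul, contract_eq, contract_eq]
  simp only [map_sub, map_add, map_mul]

end GenericCommutators

/-! ### The quotient of the enveloping algebra. -/

section Enveloping

attribute [local instance] LieRing.ofAssociativeRing

theorem xMat_symm (a b : Fin 2) : xMat a b = xMat b a := by
  refine Subtype.ext (Matrix.ext fun i j => ?_)
  simp only [xMat, Matrix.of_apply]
  ring

variable {t z : R} {M : Type} [Ring M] [Algebra R M] {x : Fin 3 → M}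

/-- The matrix underlying an element of `sl_{2,t}`. -/
noncomputable def slMat (v : ScaledLie t SL2) : Matrix (Fin 2) (Fin 2) R := ((toScaled t SL2).symm v).1

theorem slMat_one_one (v : ScaledLie t SL2) : slMat v 1 1 = -slMat v 0 0 := by
  have h : Matrix.trace (slMat v) = 0 := ((toScaled t SL2).symm v).2
  rw [Matrix.trace_fin_two] at h
  linear_combination h

theorem slMat_add (v w : ScaledLie t SL2) : slMat (v + w) = slMat v + slMat w := rfl

theorem slMat_smul (r : R) (v : ScaledLie t SL2) : slMat (r • v) = r • slMat v := rfl

theorem slMat_lie (v w : ScaledLie t SL2) :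
    slMat ⁅v, w⁆ = t • (slMat v * slMat w - slMat w * slMat v) := rfl

theorem slMat_ext {v w : ScaledLie t SL2} (h0 : slMat v 0 0 = slMat w 0 0)
    (h1 : slMat v 0 1 = slMat w 0 1) (h2 : slMat v 1 0 = slMat w 1 0) : v = w := by
  refine (toScaled t SL2).symm.injective (Subtype.ext (Matrix.ext fun i j => ?_))
  change slMat v i j = slMat w i j
  fin_cases i <;> fin_cases j
  · exact h0
  · exact h1
  · exact h2
  · change slMat v 1 1 = slMat w 1 1
    rw [slMat_one_one, slMat_one_one, h0]

theorem slMat_xMat (a b i j : Fin 2) : slMat (toScaled t SL2 (xMat a b)) i j =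
    (if i = a then (eps b j : R) else 0) + (if i = b then (eps a j : R) else 0) := rfl

/-- The Lie homomorphism from `sl_{2,t}` determined by a triple. -/
noncomputable def ScaledTriple.lieHom (hx : ScaledTriple x t z) : ScaledLie t SL2 →ₗ⁅R⁆ M where
  -- These are the coordinates of a traceless matrix in the basis `x⁰⁰ = 2 E`, `x⁰¹ = -H`, `x¹¹ = -2
  -- F`.
  toFun v := (PowerSeries.C (1 / 2) * slMat v 0 1) • x 0 + (-slMat v 0 0) • x 1 +
    (-(PowerSeries.C (1 / 2) * slMat v 1 0)) • x 2
  map_add' v w := by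
    simp only [slMat_add, Matrix.add_apply, mul_add, neg_add, add_smul]
    abel
  map_smul' r v := by
    simp only [slMat_smul, Matrix.smul_apply, smul_eq_mul, RingHom.id_apply, smul_add, smul_smul]
    congr 1
    · congr 1
      · congr 1
        ring
      · congr 1
        ring
    · congr 1
      ring
  map_lie' {v w} := by
    have h := commutator_combination hx
      ![PowerSeries.C (1 / 2) * slMat v 0 1, -slMat v 0 0, -(PowerSeries.C (1 / 2) * slMat v 1 0)]
      ![PowerSeries.C (1 / 2) * slMat w 0 1, -slMat w 0 0, -(PowerSeries.C (1 / 2) * slMat w 1 0)]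
    simp only [Matrix.cons_val_zero, Matrix.cons_val_one, Matrix.cons_val] at h
    change _ = (_ : M) * _ - _ * _
    rw [h]
    simp only [slMat_lie, Matrix.smul_apply, Matrix.sub_apply, Matrix.mul_apply, Fin.sum_univ_two,
      smul_eq_mul, slMat_one_one]
    have h2 := C_half_mul_two
    congr 1
    · congr 1
      · congr 1
        ring
      · congr 1
        linear_combination (t * (slMat v 0 1 * slMat w 1 0 - slMat v 1 0 * slMat w 0 1) *
          (PowerSeries.C (1 / 2) * 2 + 1)) * h2
    · congr 1
      ring

theorem ScaledTriple.lieHom_apply (hx : ScaledTriple x t z) (v : ScaledLie t SL2) :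
    hx.lieHom v = (PowerSeries.C (1 / 2) * slMat v 0 1) • x 0 + (-slMat v 0 0) • x 1 +
    (-(PowerSeries.C (1 / 2) * slMat v 1 0)) • x 2 := rfl

theorem ScaledTriple.lieHom_xMat (hx : ScaledTriple x t z) :
    hx.lieHom (toScaled t SL2 (xMat 0 0)) = x 0 ∧ hx.lieHom (toScaled t SL2 (xMat 0 1)) = x 1 ∧
      hx.lieHom (toScaled t SL2 (xMat 1 1)) = x 2 := by
  have h2 := C_half_mul_two
  refine ⟨?_, ?_, ?_⟩ <;>
  · rw [hx.lieHom_apply]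
    simp only [slMat_xMat]
    simp [eps, one_add_one_eq_two, -one_div, h2]
    try rw [show (PowerSeries.C (1 / 2) : R) * (-1 + -1) = -1 by linear_combination -h2, neg_smul,
      one_smul, neg_neg]

theorem lie_xMat (t : R) (a b d e : Fin 2) :
    ⁅toScaled t SL2 (xMat a b), toScaled t SL2 (xMat d e)⁆ =
      t • ((eps a d : R) • toScaled t SL2 (xMat b e) + (eps a e : R) • toScaled t SL2 (xMat b d) +
        (eps b d : R) • toScaled t SL2 (xMat a e) + (eps b e : R) • toScaled t SL2 (xMat a d)) := by
  apply slMat_ext <;>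
  · simp only [slMat_lie, slMat_add, slMat_smul, Matrix.smul_apply, Matrix.sub_apply,
      Matrix.mul_apply, Matrix.add_apply, Fin.sum_univ_two, smul_eq_mul, slMat_xMat]
    fin_cases a <;> fin_cases b <;> fin_cases d <;> fin_cases e <;> simp [eps, -mul_eq_mul_left_iff] <;>
      ring

/-- The generators of the quotient of the enveloping algebra. -/
noncomputable def quotTriple (t z : R) : Fin 3 → UQuot t z :=
  ![xQuot t z 0 0, xQuot t z 0 1, xQuot t z 1 1]

theorem xU_commutator (t : R) (a b d e : Fin 2) : xU t a b * xU t d e - xU t d e * xU t a b =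
    t • ((eps a d : R) • xU t b e + (eps a e : R) • xU t b d + (eps b d : R) • xU t a e +
      (eps b e : R) • xU t a d) := by
  simp only [xU]
  rw [← LieRing.of_associative_ring_bracket, ← LieHom.map_lie, lie_xMat]
  simp only [map_smul, map_add]

theorem casimir_quot (t z : R) :
    RingQuot.mkAlgHom R (fun x y : USL2 t => x = casimir t ∧ y = algebraMap R (USL2 t) z)
      (casimir t) = algebraMap R (UQuot t z) z := by
  rw [RingQuot.mkAlgHom_rel (S := R) (s := fun x y : USL2 t => x = casimir t ∧
    y = algebraMap R (USL2 t) z) ⟨rfl, rfl⟩, AlgHom.commutes]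

theorem scaledTriple_quot (t m : R) : ScaledTriple (quotTriple t (t ^ 2 * m)) t m := by
  have hc : ∀ a b d e : Fin 2, xQuot t (t ^ 2 * m) a b * xQuot t (t ^ 2 * m) d e -
      xQuot t (t ^ 2 * m) d e * xQuot t (t ^ 2 * m) a b =
      t • ((eps a d : R) • xQuot t (t ^ 2 * m) b e + (eps a e : R) • xQuot t (t ^ 2 * m) b d +
      (eps b d : R) • xQuot t (t ^ 2 * m) a e + (eps b e : R) • xQuot t (t ^ 2 * m) a d) := by
    intro a b d e
    simp only [xQuot]
    rw [← map_mul, ← map_mul, ← map_sub, xU_commutator]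
    simp only [map_smul, map_add]
  refine ScaledTriple.of_symmetric (X := xQuot t (t ^ 2 * m)) ?_ hc neg_eight_mul_C ?_
  · rw [xQuot, xU, xMat_symm]
    rfl
  · exact (map_smul_contract _ _ _).symm.trans ((casimir_quot t (t ^ 2 * m)).trans
      (Algebra.algebraMap_eq_smul_one _))

/-- The universal property lifts the inclusion of the Lie algebra to a map into the subalgebra;
followed by the embedding it is the identity, by uniqueness. -/
theorem UEA_adjoin {L : Type} [LieRing L] [LieAlgebra R L] :
    Algebra.adjoin R (Set.range (UniversalEnvelopingAlgebra.ι R (L := L))) = ⊤ := by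
  set S := Algebra.adjoin R (Set.range (UniversalEnvelopingAlgebra.ι R (L := L)))
  let f : L →ₗ⁅R⁆ S :=
    { toFun := fun v => ⟨UniversalEnvelopingAlgebra.ι R v, Algebra.subset_adjoin ⟨v, rfl⟩⟩
      map_add' := fun v w => Subtype.ext (by simp)
      map_smul' := fun r v => Subtype.ext (by simp)
      map_lie' := fun {v w} => Subtype.ext
        (LieHom.map_lie (UniversalEnvelopingAlgebra.ι R) v w) }
  have h : S.val.comp (UniversalEnvelopingAlgebra.lift R f) = AlgHom.id R _ := by
    refine UniversalEnvelopingAlgebra.hom_ext R (LieHom.ext fun v => ?_)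
    exact congrArg Subtype.val (UniversalEnvelopingAlgebra.lift_ι_apply R f v)
  refine eq_top_iff.2 fun a _ => ?_
  have h1 : ((UniversalEnvelopingAlgebra.lift R f a : S) : UniversalEnvelopingAlgebra R L) = a :=
    AlgHom.congr_fun h a
  rw [← h1]
  exact (UniversalEnvelopingAlgebra.lift R f a).2

theorem quot_adjoin (t z : R) : Algebra.adjoin R (Set.range (quotTriple t z)) = ⊤ := by
  set S := Algebra.adjoin R (Set.range (quotTriple t z))
  let π := RingQuot.mkAlgHom R (fun x y : USL2 t => x = casimir t ∧ y = algebraMap R (USL2 t) z)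
  have h1 : (⊤ : Subalgebra R (USL2 t)) ≤ S.comap π := by
    rw [← UEA_adjoin]
    refine Algebra.adjoin_le ?_
    rintro _ ⟨v, rfl⟩
    have hv : v = (PowerSeries.C (1 / 2) * slMat v 0 1) • toScaled t SL2 (xMat 0 0) +
        (-slMat v 0 0) • toScaled t SL2 (xMat 0 1) +
        (-(PowerSeries.C (1 / 2) * slMat v 1 0)) • toScaled t SL2 (xMat 1 1) := by
      have h2 := C_half_mul_two
      apply slMat_ext <;>
      · simp only [slMat_add, slMat_smul, Matrix.smul_apply, Matrix.add_apply, smul_eq_mul,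
          slMat_xMat]
        simp [eps, -one_div]
        try linear_combination (-slMat v 0 1) * h2
        try linear_combination (-slMat v 1 0) * h2
    have hg : ∀ j, quotTriple t z j ∈ S := fun j => Algebra.subset_adjoin ⟨j, rfl⟩
    change π (UniversalEnvelopingAlgebra.ι R v) ∈ S
    rw [hv]
    simp only [map_add, map_smul]
    exact add_mem (add_mem (Subalgebra.smul_mem _ (hg 0) _) (Subalgebra.smul_mem _ (hg 1) _))
      (Subalgebra.smul_mem _ (hg 2) _)
  refine eq_top_iff.2 fun a _ => ?_
  obtain ⟨b, rfl⟩ := RingQuot.mkAlgHom_surjective R _ a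
  exact h1 (Algebra.mem_top (x := b))

/-- The homomorphism from the quotient of the enveloping algebra determined by a triple. -/
theorem ScaledTriple.exists_algHom {m : R} (hx : ScaledTriple x t m) :
    ∃ φ : UQuot t (t ^ 2 * m) →ₐ[R] M, ∀ j, φ (quotTriple t (t ^ 2 * m) j) = x j := by
  let F := UniversalEnvelopingAlgebra.lift R hx.lieHom
  have hF : ∀ a b, F (xU t a b) = hx.lieHom (toScaled t SL2 (xMat a b)) := fun a b =>
    UniversalEnvelopingAlgebra.lift_ι_apply R _ _
  obtain ⟨h0, h1, h2⟩ := hx.lieHom_xMat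
  refine ⟨RingQuot.liftAlgHom R ⟨F, ?_⟩, ?_⟩
  · rintro a b ⟨rfl, rfl⟩
    rw [AlgHom.commutes, casimir.eq_1, map_smul, contract_eq, map_sub, map_sub, map_add, map_mul,
      map_mul, map_mul, map_mul, hF, hF, hF, hF, xMat_symm 1 0, h0, h1, h2,
      Algebra.algebraMap_eq_smul_one]
    exact hx.casimir_eq neg_eight_mul_C
  · intro j
    fin_cases j
    · exact (RingQuot.liftAlgHom_mkAlgHom_apply R F _ _).trans ((hF _ _).trans h0)
    · exact (RingQuot.liftAlgHom_mkAlgHom_apply R F _ _).trans ((hF _ _).trans h1)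
    · exact (RingQuot.liftAlgHom_mkAlgHom_apply R F _ _).trans ((hF _ _).trans h2)

/-- The quotient of the enveloping algebra is the algebra generated by a triple whose symmetrized
monomials are linearly independent. -/
theorem ScaledTriple.exists_injective_algHom {μ : ℂ}
    (hx : ScaledTriple x t (algebraMap ℂ R μ)) (hinj : Function.Injective (symMap R x)) :
    ∃ φ : UQuot t (t ^ 2 * algebraMap ℂ R μ) →ₐ[R] M,
      (∀ j, φ (quotTriple t (t ^ 2 * algebraMap ℂ R μ) j) = x j) ∧ Function.Injective φ ∧
      LinearMap.range φ.toLinearMap = symSpan R x := by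
  obtain ⟨φ, hφ⟩ := hx.exists_algHom
  have hq := scaledTriple_quot t (algebraMap ℂ R μ)
  set y := quotTriple t (t ^ 2 * algebraMap ℂ R μ)
  have hcomp : ∀ w, φ (symMap R y w) = symMap R x w := fun w => by
    rw [map_symMap]
    exact congrArg (fun z => symMap R z w) (funext hφ)
  -- The quotient is itself generated by a triple, so its own symmetrized monomials span it; their
  -- images are independent, which forces injectivity below.
  have hsurj : ∀ a, ∃ w, symMap R y w = a := fun a => by
    have : a ∈ symSpan R y := by
      rw [hq.symSpan_eq, quot_adjoin]
      trivial
    rwa [← range_symMap] at this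
  refine ⟨φ, hφ, ?_, ?_⟩
  · rw [injective_iff_map_eq_zero]
    intro a ha
    obtain ⟨w, rfl⟩ := hsurj a
    rw [hcomp] at ha
    rw [(injective_iff_map_eq_zero _).1 hinj w ha, map_zero]
  · rw [← range_symMap]
    ext a
    constructor
    · rintro ⟨b, rfl⟩
      obtain ⟨w, rfl⟩ := hsurj b
      exact ⟨w, (hcomp w).symm⟩
    · rintro ⟨w, rfl⟩
      exact ⟨symMap R y w, hcomp w⟩

end Enveloping

/-! ### The commutator and the Lie algebra `W(μ; t)`. -/

section WLie

theorem sum_range_two_mul {M : Type} [AddCommMonoid M] (f : ℕ → M) (n : ℕ) :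
    ∑ k ∈ Finset.range (2 * n), f k = ∑ l ∈ Finset.range n, (f (2 * l) + f (2 * l + 1)) := by
  induction n with
  | zero => simp
  | succ n ih => rw [Nat.mul_succ, Finset.sum_range_succ, Finset.sum_range_succ, ih,
      Finset.sum_range_succ, add_assoc]

theorem Psi_comm (k : ℕ) (m n σ : ℂ) : Psi k n m σ = Psi k m n σ := by
  rw [Psi, Psi, fourF3, fourF3]
  refine tsum_congr fun j => ?_
  rw [add_comm n m]
  congr 1
  ring

/-- `Ψ` is symmetric and `R_k` has parity `(-1)^k` under exchange of the factors, so only odd orders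
survive in a commutator. -/
theorem prodCoef_comm (σ : ℂ) (k p q r s : ℕ) :
    prodCoef σ k r s p q = (-1) ^ k * prodCoef σ k p q r s := by
  rw [prodCoef, prodCoef, Psi_comm, Rcoef_eq, Rcoef_eq, transCoef_comm]
  ring

section Commutator

variable {K : Type} [CommRing K] [Algebra ℂ K] {A : Type} [Ring A] [Algebra K A]
variable {x : Fin 3 → A} {t : K} {σ : ℂ}

theorem ScaledTriple.symMon_mul_symMon_of_lt (hx : ScaledTriple x t (algebraMap ℂ K (σ * (σ + 1))))
    (ht : ∀ a b : A, t • a = t • b → a = b) {p q r s m n N : ℕ} (hm : p + q = 2 * m)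
    (hn : r + s = 2 * n) (hN : p + r < N) :
    symMon K x p q * symMon K x r s = prodSum x t σ N p q r s := by
  rw [hx.symMon_mul_symMon ht hm hn (N := 2 * m + 2 * n + 1 + N) (by omega)]
  exact prodSum_eq x t σ (Or.inl hN) (by omega)

theorem ScaledTriple.symMon_commutator (hx : ScaledTriple x t (algebraMap ℂ K (σ * (σ + 1))))
    (ht : ∀ a b : A, t • a = t • b → a = b) {p q r s m n : ℕ} (hm : p + q = 2 * m)
    (hn : r + s = 2 * n) :
    symMon K x p q * symMon K x r s - symMon K x r s * symMon K x p q =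
      ∑ l ∈ Finset.range (p + r + 1),
        (t ^ (2 * l + 1) * algebraMap ℂ K (2 * prodCoef σ (2 * l + 1) p q r s)) •
          symMon K x (p + r - (2 * l + 1)) (q + s - (2 * l + 1)) := by
  rw [hx.symMon_mul_symMon_of_lt ht hm hn (N := 2 * (p + r + 1)) (by omega),
    hx.symMon_mul_symMon_of_lt ht hn hm (N := 2 * (p + r + 1)) (by omega), prodSum, prodSum,
    ← Finset.sum_sub_distrib, sum_range_two_mul]
  refine Finset.sum_congr rfl fun l _ => ?_
  rw [prodCoef_comm σ (2 * l) p q, prodCoef_comm σ (2 * l + 1) p q, add_comm r p, add_comm s q]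
  have h1 : (-1 : ℂ) ^ (2 * l) = 1 := by rw [pow_mul]; simp
  have h2 : (-1 : ℂ) ^ (2 * l + 1) = -1 := by rw [pow_succ, h1]; simp
  rw [h1, h2, one_mul, sub_self, zero_add, ← sub_smul, ← mul_sub, ← map_sub]
  congr 3
  ring

end Commutator

theorem wBasisBracket_eq (σ : ℂ) (t : R) (x y : WIdx) : wBasisBracket σ t x y =
    ∑ ℓ ∈ Finset.range (x.1.1 + y.1.1 + 1),
      if h : 2 * ℓ + 1 ≤ x.1.1 + y.1.1 ∧ 2 * ℓ + 1 ≤ x.1.2 + y.1.2 then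
        Finsupp.single (⟨(x.1.1 + y.1.1 - (2 * ℓ + 1), x.1.2 + y.1.2 - (2 * ℓ + 1)), by
          obtain ⟨u, hu⟩ := x.2
          obtain ⟨v, hv⟩ := y.2
          exact ⟨u + v - (2 * ℓ + 1), by dsimp only; omega⟩⟩ : WIdx)
          (t ^ (2 * ℓ) * algebraMap ℂ R (2 ^ (2 * ℓ + 1) *
            prodCoef σ (2 * ℓ + 1) x.1.1 x.1.2 y.1.1 y.1.2))
      else 0 := by
  refine Finset.sum_congr rfl fun ℓ _ => ?_
  split_ifs
  · congr 2
    change PowerSeries.C _ = PowerSeries.C _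
    rw [prodCoef, ← mul_assoc, ← mul_assoc, ← mul_pow]
    norm_num
  · rfl

/-- The bracket of `W(μ; t)` as a bilinear map. -/
noncomputable def wBilin (σ : ℂ) (t : R) : WMod →ₗ[R] WMod →ₗ[R] WMod :=
  Finsupp.linearCombination R fun i => Finsupp.linearCombination R fun j => wBasisBracket σ t i j

theorem wBracket_eq (σ : ℂ) (t : R) (x y : WMod) : wBracket σ t x y = wBilin σ t x y := by
  rw [wBracket, wBilin, Finsupp.linearCombination_apply, Finsupp.sum, Finsupp.sum,
    LinearMap.sum_apply]
  refine Finset.sum_congr rfl fun i _ => ?_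
  rw [LinearMap.smul_apply, Finsupp.linearCombination_apply, Finsupp.smul_sum]
  exact Finset.sum_congr rfl fun j _ => (smul_smul _ _ _).symm

theorem wBilin_single (σ : ℂ) (t : R) (i j : WIdx) :
    wBilin σ t (Finsupp.single i 1) (Finsupp.single j 1) = wBasisBracket σ t i j := by
  simp [wBilin, Finsupp.linearCombination_single]

/-- Half the degree of a label. -/
def halfDeg (i : WIdx) : ℕ := (i.1.1 + i.1.2) / 2

theorem two_mul_halfDeg (i : WIdx) : i.1.1 + i.1.2 = 2 * halfDeg i := by
  obtain ⟨m, h⟩ := i.2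
  rw [halfDeg]
  omega

variable {M : Type} [Ring M] [Algebra R M] {x : Fin 3 → M} {t t' : R} {σ : ℂ}

/-- Rescaled symmetrized monomials. -/
noncomputable def scaledMap (x : Fin 3 → M) (c s : ℂ) : WMod →ₗ[R] M :=
  Finsupp.linearCombination R fun i : WIdx =>
    algebraMap ℂ R (c * s⁻¹ ^ halfDeg i) • symMon R x i.1.1 i.1.2

theorem scaledMap_single (x : Fin 3 → M) (c s : ℂ) (i : WIdx) (r : R) :
    scaledMap x c s (Finsupp.single i r) =
      r • algebraMap ℂ R (c * s⁻¹ ^ halfDeg i) • symMon R x i.1.1 i.1.2 :=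
  Finsupp.linearCombination_single _ _ _

/-- The diagonal rescaling of the labels. -/
noncomputable def diagScale (c s : ℂ) : WMod →ₗ[R] WMod :=
  Finsupp.linearCombination R fun i : WIdx =>
    Finsupp.single i (algebraMap ℂ R (c * s⁻¹ ^ halfDeg i))

theorem scaledMap_eq (x : Fin 3 → M) (c s : ℂ) (w : WMod) :
    scaledMap x c s w = symMap R x (diagScale c s w) := by
  rw [← LinearMap.comp_apply]
  congr 1
  refine Finsupp.lhom_ext fun i r => ?_
  rw [scaledMap_single, LinearMap.comp_apply, diagScale, Finsupp.linearCombination_single,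
    map_smul, symMap_single]

theorem diagScale_inv {c s : ℂ} (hc : c ≠ 0) (hs : s ≠ 0) (w : WMod) :
    diagScale c⁻¹ s⁻¹ (diagScale c s w) = w := by
  rw [← LinearMap.comp_apply]
  refine LinearMap.congr_fun (f := diagScale c⁻¹ s⁻¹ ∘ₗ diagScale c s) (g := LinearMap.id)
    (Finsupp.lhom_ext fun i r => ?_) w
  rw [LinearMap.comp_apply, diagScale, diagScale, Finsupp.linearCombination_single, map_smul,
    Finsupp.linearCombination_single, Finsupp.smul_single, Finsupp.smul_single, smul_eq_mul,
    smul_eq_mul, ← map_mul, LinearMap.id_apply]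
  have : c * s⁻¹ ^ halfDeg i * (c⁻¹ * s⁻¹⁻¹ ^ halfDeg i) = 1 := by
    rw [inv_inv, inv_pow]
    field_simp
  rw [this, map_one, mul_one]

theorem scaledMap_injective (h : Function.Injective (symMap R x)) {c s : ℂ} (hc : c ≠ 0)
    (hs : s ≠ 0) : Function.Injective (scaledMap x c s) := by
  intro v w hvw
  rw [scaledMap_eq, scaledMap_eq] at hvw
  have h1 := congrArg (diagScale c⁻¹ s⁻¹) (h hvw)
  rwa [diagScale_inv hc hs, diagScale_inv hc hs] at h1

theorem range_scaledMap (x : Fin 3 → M) {c s : ℂ} (hc : c ≠ 0) (hs : s ≠ 0) :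
    LinearMap.range (scaledMap x c s) = symSpan R x := by
  rw [← range_symMap]
  ext a
  constructor
  · rintro ⟨w, rfl⟩
    exact ⟨_, (scaledMap_eq x c s w).symm⟩
  · rintro ⟨w, rfl⟩
    refine ⟨diagScale c⁻¹ s⁻¹ w, ?_⟩
    have := diagScale_inv (inv_ne_zero hc) (inv_ne_zero hs) w
    rw [inv_inv, inv_inv] at this
    rw [scaledMap_eq, this]

/-- The commutator of rescaled symmetrized monomials. -/
theorem ScaledTriple.scaledMap_commutator (hx : ScaledTriple x t (algebraMap ℂ R (σ * (σ + 1))))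
    (ht : ∀ a b : M, t • a = t • b → a = b) {c s : ℂ} (hs : s ≠ 0)
    (htt : t = algebraMap ℂ R (2 * s) * t') (v w : WMod) :
    scaledMap x c s v * scaledMap x c s w - scaledMap x c s w * scaledMap x c s v =
      t • scaledMap x c s (algebraMap ℂ R (c * s⁻¹) • wBracket σ t' v w) := by
  rw [wBracket_eq]
  let B₁ : WMod →ₗ[R] WMod →ₗ[R] M := LinearMap.mk₂ R
    (fun v w => scaledMap x c s v * scaledMap x c s w - scaledMap x c s w * scaledMap x c s v)
    (fun v v' w => by rw [map_add]; noncomm_ring)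
    (fun r v w => by
      rw [map_smul, smul_mul_assoc, mul_smul_comm, ← smul_sub])
    (fun v w w' => by rw [map_add]; noncomm_ring)
    (fun r v w => by
      rw [map_smul, smul_mul_assoc, mul_smul_comm, ← smul_sub])
  let B₂ : WMod →ₗ[R] WMod →ₗ[R] M := (wBilin σ t').compr₂
    ((t * algebraMap ℂ R (c * s⁻¹)) • scaledMap x c s)
  have key : B₁ = B₂ := by
    refine Finsupp.lhom_ext' fun i => LinearMap.ext_ring (Finsupp.lhom_ext' fun j =>
      LinearMap.ext_ring ?_)
    change scaledMap x c s (Finsupp.single i 1) * scaledMap x c s (Finsupp.single j 1) -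
      scaledMap x c s (Finsupp.single j 1) * scaledMap x c s (Finsupp.single i 1) =
      (t * algebraMap ℂ R (c * s⁻¹)) •
        scaledMap x c s (wBilin σ t' (Finsupp.single i 1) (Finsupp.single j 1))
    rw [wBilin_single, wBasisBracket_eq, map_sum, scaledMap_single, scaledMap_single, one_smul,
      one_smul, smul_mul_smul_comm, smul_mul_smul_comm, mul_comm (algebraMap ℂ R _), ← smul_sub,
      hx.symMon_commutator ht (two_mul_halfDeg i) (two_mul_halfDeg j), Finset.smul_sum,
      Finset.smul_sum]
    refine Finset.sum_congr rfl fun l _ => ?_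
    split_ifs with h
    · rw [scaledMap_single, smul_smul, smul_smul, smul_smul]
      congr 1
      -- The order `2 l + 1` term lowers the total half-degree by `2 l + 1`.
      have hd : halfDeg i + halfDeg j = (i.1.1 + j.1.1 - (2 * l + 1) +
          (i.1.2 + j.1.2 - (2 * l + 1))) / 2 + (2 * l + 1) := by
        have := two_mul_halfDeg i
        have := two_mul_halfDeg j
        omega
      change _ = t * algebraMap ℂ R (c * s⁻¹) * (t' ^ (2 * l) * _) * algebraMap ℂ R (c *
        s⁻¹ ^ ((i.1.1 + j.1.1 - (2 * l + 1) + (i.1.2 + j.1.2 - (2 * l + 1))) / 2))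
      set D := (i.1.1 + j.1.1 - (2 * l + 1) + (i.1.2 + j.1.2 - (2 * l + 1))) / 2
      have e1 : t ^ (2 * l + 1) = t * (algebraMap ℂ R ((2 * s) ^ (2 * l)) * t' ^ (2 * l)) := by
        rw [pow_succ', map_pow, ← mul_pow, ← htt]
      -- This drop leaves `s⁻¹ ^ (2 l + 1)`, of which `s ^ (2 l)` from `t ^ (2 l) = (2 s t') ^ (2
      -- l)` cancels all but one power; hence the overall factor `c s⁻¹` in front of the bracket.
      have e2 : c * s⁻¹ ^ halfDeg j * (c * s⁻¹ ^ halfDeg i) * ((2 * s) ^ (2 * l) * 2) =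
          c * s⁻¹ * (2 ^ (2 * l + 1) * (c * s⁻¹ ^ D)) := by
        have e3 : s⁻¹ ^ halfDeg j * s⁻¹ ^ halfDeg i = s⁻¹ ^ D * s⁻¹ ^ (2 * l) * s⁻¹ := by
          rw [← pow_add, ← pow_add, ← pow_succ, add_comm (halfDeg j), hd, add_assoc]
        have e4 : s⁻¹ ^ (2 * l) * s ^ (2 * l) = 1 := by
          rw [← mul_pow, inv_mul_cancel₀ hs, one_pow]
        rw [mul_pow, pow_succ]
        linear_combination (c ^ 2 * 2 ^ (2 * l) * s ^ (2 * l) * 2) * e3 +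
          (c ^ 2 * 2 ^ (2 * l) * 2 * s⁻¹ ^ D * s⁻¹) * e4
      have e5 := congrArg (algebraMap ℂ R) e2
      rw [e1]
      simp only [map_mul] at e5 ⊢
      linear_combination (t * t' ^ (2 * l) *
        algebraMap ℂ R (prodCoef σ (2 * l + 1) i.1.1 i.1.2 j.1.1 j.1.2)) * e5
    · rw [prodCoef_eq_zero σ (by omega)]
      simp
  have h := LinearMap.congr_fun (LinearMap.congr_fun key v) w
  rw [map_smul, smul_smul]
  exact h

/-- The algebra generated by a triple, with the rescaled commutator as Lie bracket, is `W(μ; t')`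
up to rescaling. -/
theorem ScaledTriple.exists_lieEquiv (hx : ScaledTriple x t (algebraMap ℂ R (σ * (σ + 1))))
    (ht : ∀ a b : M, t • a = t • b → a = b) (hinj : Function.Injective (symMap R x))
    {c s : ℂ} (hc : c ≠ 0) (hs : s ≠ 0) (htt : t = algebraMap ℂ R (2 * s) * t') :
    ∃ L : symSpan R x ≃ₗ[R] WMod,
      (∀ f g h : symSpan R x, (f * g - g * f : M) = t • (h : M) →
        L h = algebraMap ℂ R (c * s⁻¹) • wBracket σ t' (L f) (L g)) ∧
      ∀ f : symSpan R x, (f : M) = 1 → L f =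
        Finsupp.single ⟨(0, 0), 0, rfl⟩ (algebraMap ℂ R c⁻¹) := by
  let E : WMod ≃ₗ[R] symSpan R x := (LinearEquiv.ofInjective _ (scaledMap_injective hinj hc hs)).trans
    (LinearEquiv.ofEq _ _ (range_scaledMap x hc hs))
  have hE : ∀ w, (E w : M) = scaledMap x c s w := fun w => rfl
  refine ⟨E.symm, fun f g h hfg => ?_, fun f hf => ?_⟩
  · rw [LinearEquiv.symm_apply_eq]
    refine Subtype.ext (ht _ _ ?_)
    rw [← hfg, hE, ← hx.scaledMap_commutator ht hs htt, ← hE, ← hE, LinearEquiv.apply_symm_apply,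
      LinearEquiv.apply_symm_apply]
  · rw [LinearEquiv.symm_apply_eq]
    refine Subtype.ext ?_
    rw [hf, hE, scaledMap_single, smul_smul, ← map_mul]
    simp [halfDeg, hc]

end WLie

/-! ### The wedges of `W_{1+∞}` and `W_∞`. -/

section Wedge

theorem phiCoef_eq (l : ℕ) (m n σ : ℂ) :
    phiCoef l (m + 1) (n + 1) σ = Psi (2 * l + 1) m n σ := by
  rw [phiCoef, Psi]
  push_cast
  congr 1 <;> ring

theorem Ncoef_eq (l : ℕ) (p q m n : ℂ) : Ncoef l p q m n =
    transCoef (2 * l + 1) (p - 1 + m) (p - 1 - m) (q - 1 + n) (q - 1 - n) := by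
  rw [Ncoef, transCoef]
  refine Finset.sum_congr rfl fun i _ => ?_
  rw [smul_eq_mul]
  ring

/-- With spin `m + 1` and mode `a - m`, the arguments `p - 1 ± mode` of the falling factorials are
exactly `a` and `b`. The factor `1/2` is the one in the normalization of `fCoef`. -/
theorem fCoef_eq (σ : ℂ) (l : ℕ) {a b c d m n : ℕ} (hm : a + b = 2 * m) (hn : c + d = 2 * n) :
    fCoef l (m + 1 : ℕ) (n + 1 : ℕ) ((a : ℤ) - m : ℤ) ((c : ℤ) - n : ℤ) σ =
      1 / 2 * (2 ^ (2 * l + 1) * prodCoef σ (2 * l + 1) a b c d) := by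
  have hm' := congrArg (Nat.cast (R := ℂ)) hm
  have hn' := congrArg (Nat.cast (R := ℂ)) hn
  push_cast at hm' hn'
  rw [prodCoef_eq σ hm hn, fCoef, Ncoef_eq]
  push_cast
  rw [phiCoef_eq, show (m : ℂ) + 1 - 1 + (a - m) = a by ring,
    show (m : ℂ) + 1 - 1 - (a - m) = b by linear_combination -hm',
    show (n : ℂ) + 1 - 1 + (c - n) = c by ring,
    show (n : ℂ) + 1 - 1 - (c - n) = d by linear_combination -hn', one_div_pow]
  have := Nat.factorial_ne_zero (2 * l + 1)
  field_simp

theorem transCoef_succ_unit_left (k : ℕ) (r s : ℂ) : transCoef (k + 1) 0 0 r s = 0 := by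
  rw [transCoef_succ]; ring

theorem transCoef_succ_unit_right (k : ℕ) (p q : ℂ) : transCoef (k + 1) p q 0 0 = 0 := by
  rw [transCoef_succ]; ring

/-- A complete contraction is an invariant pairing, which vanishes between different degrees; under
`p + r = q + s` the degrees `p + q` and `r + s` agree only if `q = r`. -/
theorem transCoef_top_eq_zero {k p q r s : ℕ} (h1 : p + r = k) (h2 : q + s = k) (h : q ≠ r) :
    transCoef k p q r s = 0 := by
  refine Finset.sum_eq_zero fun j hj => ?_
  rw [Finset.mem_range] at hj
  rcases lt_or_ge p (k - j) with h3 | h3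
  · rw [fallP_natCast_eq_zero h3]; simp
  rcases lt_or_ge r j with h4 | h4
  · rw [fallP_natCast_eq_zero h4]; simp
  rcases lt_or_ge q j with h5 | h5
  · rw [fallP_natCast_eq_zero h5]; simp
  · rw [fallP_natCast_eq_zero (show s < k - j by omega)]; simp

variable (p₀ : ℕ)

/-- The spin and mode number of a label. -/
def wedgeIdx (i : WIdx) (h : p₀ ≤ halfDeg i + 1) : HIdx p₀ :=
  (⟨halfDeg i + 1, h⟩, (i.1.1 : ℤ) - halfDeg i)

/-- The generator `W^p_m` corresponding to a label (zero if the spin is too small). -/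
noncomputable def wedgeVec (i : WIdx) : HIdx p₀ →₀ R :=
  if h : p₀ ≤ halfDeg i + 1 then Finsupp.single (wedgeIdx p₀ i h) 1 else 0

/-- The linear map sending a label to the corresponding generator `W^p_m`. -/
noncomputable def wedgeFst : WMod →ₗ[R] HIdx p₀ →₀ R :=
  Finsupp.linearCombination R (wedgeVec p₀)

theorem wedgeFst_single (i : WIdx) (r : R) :
    wedgeFst p₀ (Finsupp.single i r) = r • wedgeVec p₀ i :=
  Finsupp.linearCombination_single _ _ _

theorem wedgeIdx_injective {i j : WIdx} {hi : p₀ ≤ halfDeg i + 1} {hj : p₀ ≤ halfDeg j + 1}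
    (h : wedgeIdx p₀ i hi = wedgeIdx p₀ j hj) : i = j := by
  have h1 : halfDeg i + 1 = halfDeg j + 1 := congrArg (fun x : HIdx p₀ => x.1.1) h
  have h2 : (i.1.1 : ℤ) - halfDeg i = (j.1.1 : ℤ) - halfDeg j :=
    congrArg (fun x : HIdx p₀ => x.2) h
  have hi := two_mul_halfDeg i
  have hj := two_mul_halfDeg j
  exact Subtype.ext (Prod.ext (by omega) (by omega))

theorem wedgeFst_apply (w : WMod) (i : WIdx) (h : p₀ ≤ halfDeg i + 1) :
    wedgeFst p₀ w (wedgeIdx p₀ i h) = w i := by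
  have key : Finsupp.lapply (wedgeIdx p₀ i h) ∘ₗ wedgeFst p₀ = (Finsupp.lapply i : WMod →ₗ[R] R) := by
    refine Finsupp.lhom_ext fun j r => ?_
    rw [LinearMap.comp_apply, wedgeFst_single, map_smul, Finsupp.lapply_apply, Finsupp.lapply_apply,
      wedgeVec]
    by_cases hij : j = i
    · subst hij
      rw [dif_pos h, Finsupp.single_eq_same, Finsupp.single_eq_same, smul_eq_mul, mul_one]
    · rw [Finsupp.single_eq_of_ne (Ne.symm hij)]
      split_ifs with hj
      · rw [Finsupp.single_eq_of_ne fun h' => hij (wedgeIdx_injective p₀ h').symm, smul_zero]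
      · simp
  exact LinearMap.congr_fun key w

/-- The bracket of `W_{1+∞}` or `W_∞` as a bilinear map. -/
noncomputable def hBilin (σ : ℂ) (k : ℕ → ℂ) (t : R) :
    (HIdx p₀ →₀ R) →ₗ[R] (HIdx p₀ →₀ R) →ₗ[R] HMod p₀ :=
  Finsupp.linearCombination R fun i =>
    Finsupp.linearCombination R fun j => hBasisBracket p₀ σ k t i j

theorem hBracket_eq (σ : ℂ) (k : ℕ → ℂ) (t : R) (x y : HMod p₀) :
    hBracket p₀ σ k t x y = hBilin p₀ σ k t x.1 y.1 := by
  rw [hBracket, hBilin, Finsupp.linearCombination_apply, Finsupp.sum, Finsupp.sum,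
    LinearMap.sum_apply]
  refine Finset.sum_congr rfl fun i _ => ?_
  rw [LinearMap.smul_apply, Finsupp.linearCombination_apply, Finsupp.smul_sum]
  exact Finset.sum_congr rfl fun j _ => (smul_smul _ _ _).symm

theorem sum_range_eq_of_vanish {M : Type} [AddCommMonoid M] {f g : ℕ → M} {m n : ℕ}
    (hf : ∀ k, m ≤ k → f k = 0) (hg : ∀ k, n ≤ k → g k = 0) (h : ∀ k, f k = g k) :
    ∑ k ∈ Finset.range m, f k = ∑ k ∈ Finset.range n, g k := by
  have e1 : ∑ k ∈ Finset.range m, f k = ∑ k ∈ Finset.range (m + n), f k :=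
    Finset.sum_subset (Finset.range_subset_range.2 (by omega)) fun k _ hk =>
      hf k (by rwa [Finset.mem_range, not_lt] at hk)
  have e2 : ∑ k ∈ Finset.range n, g k = ∑ k ∈ Finset.range (m + n), g k :=
    Finset.sum_subset (Finset.range_subset_range.2 (by omega)) fun k _ hk =>
      hg k (by rwa [Finset.mem_range, not_lt] at hk)
  rw [e1, e2, Finset.sum_congr rfl fun k _ => h k]

theorem wBasisBracket_unit_left (σ : ℂ) (t : R) {i : WIdx} (hi : halfDeg i = 0) (j : WIdx) :
    wBasisBracket σ t i j = 0 := by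
  have h1 := two_mul_halfDeg i
  have hj := two_mul_halfDeg j
  have h2 : i.1.1 = 0 := by omega
  have h3 : i.1.2 = 0 := by omega
  rw [wBasisBracket_eq]
  refine Finset.sum_eq_zero fun l _ => ?_
  split_ifs
  · have h : prodCoef σ (2 * l + 1) i.1.1 i.1.2 j.1.1 j.1.2 = 0 := by
      rw [prodCoef_eq σ h1 hj, h2, h3, Nat.cast_zero, transCoef_succ_unit_left, mul_zero]
    rw [h]
    simp
  · rfl

theorem wBasisBracket_unit_right (σ : ℂ) (t : R) (i : WIdx) {j : WIdx} (hj : halfDeg j = 0) :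
    wBasisBracket σ t i j = 0 := by
  have h1 := two_mul_halfDeg j
  have hi := two_mul_halfDeg i
  have h2 : j.1.1 = 0 := by omega
  have h3 : j.1.2 = 0 := by omega
  rw [wBasisBracket_eq]
  refine Finset.sum_eq_zero fun l _ => ?_
  split_ifs
  · have h : prodCoef σ (2 * l + 1) i.1.1 i.1.2 j.1.1 j.1.2 = 0 := by
      rw [prodCoef_eq σ hi h1, h2, h3, Nat.cast_zero, transCoef_succ_unit_right, mul_zero]
    rw [h]
    simp
  · rfl

/-- The label of the unit. -/
def unitIdx : WIdx := ⟨(0, 0), 0, rfl⟩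

/-- The unit can only come from a complete contraction of odd order `2 l + 1`. A nonzero one would
need both degrees equal to `2 l + 1`, but labels have even degree. -/
theorem wBasisBracket_apply_unit (σ : ℂ) (t : R) (i j : WIdx) :
    wBasisBracket σ t i j unitIdx = 0 := by
  have hi := two_mul_halfDeg i
  have hj := two_mul_halfDeg j
  rw [wBasisBracket_eq, Finsupp.finsetSum_apply]
  refine Finset.sum_eq_zero fun l _ => ?_
  split_ifs with h
  · rw [Finsupp.single_apply]
    split_ifs with h'
    · have h1 : i.1.1 + j.1.1 - (2 * l + 1) = 0 := congrArg (fun x : WIdx => x.1.1) h'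
      have h2 : i.1.2 + j.1.2 - (2 * l + 1) = 0 := congrArg (fun x : WIdx => x.1.2) h'
      rw [prodCoef_eq σ hi hj, transCoef_top_eq_zero (by omega) (by omega) (by omega)]
      simp
    · rfl
  · rfl

theorem wBracket_apply_unit (σ : ℂ) (t : R) (v w : WMod) : wBracket σ t v w unitIdx = 0 := by
  rw [wBracket, Finsupp.sum, Finsupp.finsetSum_apply]
  refine Finset.sum_eq_zero fun i _ => ?_
  rw [Finsupp.sum, Finsupp.finsetSum_apply]
  refine Finset.sum_eq_zero fun j _ => ?_
  rw [Finsupp.smul_apply, wBasisBracket_apply_unit, smul_zero]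

/-- Spin `(a + b)/2 + 1` and mode `(a - b)/2` turn `fCoef` into half the structure constant of `W(μ;
t)`. Terms of spin below `p₀` are omitted from the bracket and killed by `wedgeVec` alike. -/
theorem hBasisBracket_wedge (σ : ℂ) (k : ℕ → ℂ) (t : R) (i j : WIdx)
    (hi : p₀ ≤ halfDeg i + 1) (hj : p₀ ≤ halfDeg j + 1) :
    hBasisBracket p₀ σ k t (wedgeIdx p₀ i hi) (wedgeIdx p₀ j hj) =
      (algebraMap ℂ R (1 / 2) • wedgeFst p₀ (wBasisBracket σ t i j), 0) := by
  have ei := two_mul_halfDeg i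
  have ej := two_mul_halfDeg j
  refine Prod.ext ?_ ?_
  · rw [wBasisBracket_eq, map_sum, Finset.smul_sum]
    refine sum_range_eq_of_vanish (fun l hl => ?_) (fun l hl => ?_) fun l => ?_
    · rw [dif_neg]
      change halfDeg i + 1 + (halfDeg j + 1) + 1 ≤ l at hl
      change ¬ (p₀ + (2 * l + 2) ≤ halfDeg i + 1 + (halfDeg j + 1))
      omega
    · rw [dif_neg (by omega), map_zero, smul_zero]
    · by_cases hc : 2 * l + 1 ≤ i.1.1 + j.1.1 ∧ 2 * l + 1 ≤ i.1.2 + j.1.2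
      · rw [dif_pos hc, wedgeFst_single, wedgeVec]
        have hd : (i.1.1 + j.1.1 - (2 * l + 1) + (i.1.2 + j.1.2 - (2 * l + 1))) / 2 + (2 * l + 1) =
            halfDeg i + halfDeg j := by omega
        by_cases h : p₀ + (2 * l + 2) ≤ (wedgeIdx p₀ i hi).1.1 + (wedgeIdx p₀ j hj).1.1
        · have h' : p₀ + (2 * l + 2) ≤ halfDeg i + 1 + (halfDeg j + 1) := h
          rw [dif_pos h, dif_pos (by rw [halfDeg]; dsimp only; omega), Finsupp.smul_single,
            Finsupp.smul_single]
          congr 1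
          · refine Prod.ext (Subtype.ext ?_) ?_
            · change halfDeg i + 1 + (halfDeg j + 1) - (2 * l + 2) =
                (i.1.1 + j.1.1 - (2 * l + 1) + (i.1.2 + j.1.2 - (2 * l + 1))) / 2 + 1
              omega
            · change (i.1.1 : ℤ) - halfDeg i + ((j.1.1 : ℤ) - halfDeg j) =
                ((i.1.1 + j.1.1 - (2 * l + 1) : ℕ) : ℤ) - (((i.1.1 + j.1.1 - (2 * l + 1) +
                  (i.1.2 + j.1.2 - (2 * l + 1))) / 2 : ℕ) : ℤ)
              omega
          · have hf := fCoef_eq σ l ei ej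
            change t ^ (2 * l) * algebraMap ℂ R (fCoef l (halfDeg i + 1 : ℕ) (halfDeg j + 1 : ℕ)
              ((i.1.1 : ℤ) - halfDeg i : ℤ) ((j.1.1 : ℤ) - halfDeg j : ℤ) σ) = _
            rw [hf, map_mul, smul_eq_mul, smul_eq_mul, mul_one, mul_left_comm]
        · have h' : ¬ (p₀ + (2 * l + 2) ≤ halfDeg i + 1 + (halfDeg j + 1)) := h
          rw [dif_neg h, dif_neg (by rw [halfDeg]; dsimp only; omega), smul_zero, smul_zero]
      · rw [dif_neg hc, map_zero, smul_zero]
        split_ifs with h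
        · have hf := fCoef_eq σ l ei ej
          change Finsupp.single _ (t ^ (2 * l) * algebraMap ℂ R
            (fCoef l (halfDeg i + 1 : ℕ) (halfDeg j + 1 : ℕ)
              ((i.1.1 : ℤ) - halfDeg i : ℤ) ((j.1.1 : ℤ) - halfDeg j : ℤ) σ)) = _
          rw [hf, prodCoef_eq_zero σ (by omega)]
          simp
        · rfl
  · change (if _ then _ else (0 : R)) = 0
    split_ifs with h
    -- Inside the wedge the mode lies in the range of the product, so one factor is zero.
    · rw [Finset.prod_eq_zero (i := (i.1.1 : ℤ) - halfDeg i)]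
      · simp
      · rw [Finset.mem_Icc]
        change 1 - ((halfDeg i + 1 : ℕ) : ℤ) ≤ _ ∧ _ ≤ ((halfDeg i + 1 : ℕ) : ℤ) - 1
        omega
      · exact sub_self _
    · rfl

/-- On the wedge, the central term is absent, and the bracket is half that of `W(μ; t)`. -/
theorem hBilin_wedgeFst (hp : p₀ ≤ 2) (σ : ℂ) (k : ℕ → ℂ) (t : R) (v w : WMod) :
    hBilin p₀ σ k t (wedgeFst p₀ v) (wedgeFst p₀ w) =
      (algebraMap ℂ R (1 / 2) • wedgeFst p₀ (wBracket σ t v w), 0) := by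
  rw [wBracket_eq]
  have key : (hBilin p₀ σ k t).compl₁₂ (wedgeFst p₀) (wedgeFst p₀) =
      (wBilin σ t).compr₂ (LinearMap.inl R (HIdx p₀ →₀ R) R ∘ₗ
        (algebraMap ℂ R (1 / 2) • wedgeFst p₀)) := by
    refine Finsupp.lhom_ext' fun i => LinearMap.ext_ring (Finsupp.lhom_ext' fun j =>
      LinearMap.ext_ring ?_)
    change hBilin p₀ σ k t (wedgeFst p₀ (Finsupp.single i 1)) (wedgeFst p₀ (Finsupp.single j 1)) =
      (algebraMap ℂ R (1 / 2) • wedgeFst p₀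
        (wBilin σ t (Finsupp.single i 1) (Finsupp.single j 1)), 0)
    rw [wBilin_single, wedgeFst_single, wedgeFst_single, one_smul, one_smul, wedgeVec, wedgeVec]
    by_cases hi : p₀ ≤ halfDeg i + 1
    · by_cases hj : p₀ ≤ halfDeg j + 1
      · rw [dif_pos hi, dif_pos hj, ← hBasisBracket_wedge p₀ σ k t i j hi hj]
        simp [hBilin, Finsupp.linearCombination_single]
      -- As `p₀ ≤ 2`, a label whose spin is too small has degree zero, so it is the central unit.
      · rw [dif_neg hj, wBasisBracket_unit_right σ t i (by omega), map_zero, map_zero, smul_zero]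
        rfl
    · rw [dif_neg hi, wBasisBracket_unit_left σ t (by omega), map_zero, map_zero, smul_zero]
      rfl
  exact LinearMap.congr_fun (LinearMap.congr_fun key v) w

theorem range_wedge (hp : 1 ≤ p₀) :
    LinearMap.range (LinearMap.inl R (HIdx p₀ →₀ R) R ∘ₗ wedgeFst p₀) = wedge p₀ := by
  refine le_antisymm ?_ ?_
  · rintro _ ⟨w, rfl⟩
    induction w using Finsupp.induction_linear with
    | zero => rw [map_zero]; exact zero_mem _
    | add v w hv hw => rw [map_add]; exact add_mem hv hw
    | single i r =>
      rw [LinearMap.comp_apply, wedgeFst_single, map_smul]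
      refine Submodule.smul_mem _ _ ?_
      rw [wedgeVec]
      split_ifs with h
      · refine Submodule.subset_span ⟨_, ?_, ?_, rfl⟩
        · change 1 - ((halfDeg i + 1 : ℕ) : ℤ) ≤ (i.1.1 : ℤ) - halfDeg i
          omega
        · have := two_mul_halfDeg i
          change (i.1.1 : ℤ) - halfDeg i ≤ ((halfDeg i + 1 : ℕ) : ℤ) - 1
          omega
      · rw [map_zero]
        exact zero_mem _
  · refine Submodule.span_le.2 ?_
    rintro _ ⟨⟨⟨p, h⟩, m⟩, h1, h2, rfl⟩
    dsimp only at h1 h2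
    obtain ⟨a, ha⟩ := Int.eq_ofNat_of_zero_le (show 0 ≤ (p : ℤ) - 1 + m by omega)
    obtain ⟨b, hb⟩ := Int.eq_ofNat_of_zero_le (show 0 ≤ (p : ℤ) - 1 - m by omega)
    let i : WIdx := ⟨(a, b), p - 1, by dsimp only; omega⟩
    have hd : halfDeg i = p - 1 := by
      change (a + b) / 2 = p - 1
      omega
    refine ⟨Finsupp.single i 1, ?_⟩
    rw [LinearMap.comp_apply, wedgeFst_single, one_smul, wedgeVec, dif_pos (by omega)]
    change (Finsupp.single _ 1, (0 : R)) = _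
    congr 2
    refine Prod.ext (Subtype.ext ?_) ?_
    · change halfDeg i + 1 = p
      omega
    · change (a : ℤ) - halfDeg i = m
      omega

/-- `W(-1/4; t)` as the wedge of `W_{1+∞}`. -/
theorem exists_wedge_one : ∃ E : WMod ≃ₗ[R] wedge 1, ∀ w,
    (E w : HMod 1) = (wedgeFst 1 w, 0) := by
  have hinj : Function.Injective (LinearMap.inl R (HIdx 1 →₀ R) R ∘ₗ wedgeFst 1) := by
    intro v w h
    have h1 : wedgeFst 1 v = wedgeFst 1 w := congrArg Prod.fst h
    ext1 i
    rw [← wedgeFst_apply 1 v i (by omega), h1, wedgeFst_apply]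
  exact ⟨(LinearEquiv.ofInjective _ hinj).trans (LinearEquiv.ofEq _ _ (range_wedge 1 le_rfl)),
    fun w => rfl⟩

/-- `W(0; t)` as the wedge of `W_∞` plus a central line. -/
theorem exists_wedge_two {c : ℂ} (hc : c ≠ 0) : ∃ E : WMod ≃ₗ[R] wedge 2 × R, ∀ w,
    ((E w).1 : HMod 2) = (wedgeFst 2 w, 0) ∧ (E w).2 = algebraMap ℂ R c * w unitIdx := by
  have hmem : ∀ w : WMod, (LinearMap.inl R (HIdx 2 →₀ R) R ∘ₗ wedgeFst 2) w ∈ wedge 2 := fun w => by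
    rw [← range_wedge 2 one_le_two]
    exact ⟨w, rfl⟩
  let F : WMod →ₗ[R] wedge 2 × R :=
    ((LinearMap.inl R (HIdx 2 →₀ R) R ∘ₗ wedgeFst 2).codRestrict _ hmem).prod
      (algebraMap ℂ R c • Finsupp.lapply unitIdx)
  have hcc : algebraMap ℂ R c⁻¹ * algebraMap ℂ R c = 1 := by
    rw [← map_mul, inv_mul_cancel₀ hc, map_one]
  -- The unit has spin one and disappears from the wedge component; the second component records its
  -- coefficient.
  have hu : wedgeVec 2 unitIdx = 0 := dif_neg (by decide)
  have hF : Function.Bijective F := by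
    constructor
    · intro v w h
      have h1 : wedgeFst 2 v = wedgeFst 2 w :=
        congrArg (fun x : wedge 2 × R => (x.1 : HMod 2).1) h
      have h2 : algebraMap ℂ R c * v unitIdx = algebraMap ℂ R c * w unitIdx :=
        congrArg Prod.snd h
      ext1 i
      by_cases hi : 2 ≤ halfDeg i + 1
      · rw [← wedgeFst_apply 2 v i hi, h1, wedgeFst_apply]
      · have e : i = unitIdx := by
          have := two_mul_halfDeg i
          refine Subtype.ext (Prod.ext ?_ ?_)
          · change i.1.1 = 0
            omega
          · change i.1.2 = 0
            omega
        rw [e]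
        linear_combination (algebraMap ℂ R c⁻¹) * h2 - (v unitIdx - w unitIdx) * hcc
    · rintro ⟨⟨y, hy⟩, r⟩
      have hy' := hy
      rw [← range_wedge 2 one_le_two] at hy'
      obtain ⟨w, hw⟩ := hy'
      -- Adding a multiple of the unit adjusts the central component without changing the wedge
      -- component.
      refine ⟨w + Finsupp.single unitIdx (algebraMap ℂ R c⁻¹ * r - w unitIdx), ?_⟩
      refine Prod.ext (Subtype.ext ?_) ?_
      · change (LinearMap.inl R (HIdx 2 →₀ R) R ∘ₗ wedgeFst 2) _ = y
        rw [map_add, hw, LinearMap.comp_apply, wedgeFst_single, hu, smul_zero, map_zero, add_zero]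
      · change algebraMap ℂ R c *
          ((w + Finsupp.single unitIdx (algebraMap ℂ R c⁻¹ * r - w unitIdx) : WMod) unitIdx) = r
        rw [Finsupp.add_apply, Finsupp.single_eq_same]
        linear_combination r * hcc
  exact ⟨LinearEquiv.ofBijective F hF, fun w => ⟨rfl, rfl⟩⟩

end Wedge

/-! ### Even elements in algebras of canonically conjugate variables. -/

section Symmetrized

variable {K : Type} [CommRing K] {A : Type} [Ring A] [Algebra K A]

/-- The symmetrized products of two canonically conjugate variables. -/
def symProd (κ : K) (w : Fin 2 → A) (a b : Fin 2) : A := κ • (w a * w b + w b * w a)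

theorem symProd_comm (κ : K) (w : Fin 2 → A) (a b : Fin 2) : symProd κ w a b = symProd κ w b a := by
  rw [symProd, symProd, add_comm]

/-- The triple of symmetrized products of two elements. -/
def symTriple (κ : K) (w : Fin 2 → A) : Fin 3 → A :=
  ![symProd κ w 0 0, symProd κ w 0 1, symProd κ w 1 1]

/-- Symmetrized products of canonically conjugate variables form a triple with Casimir `-3/16`. -/
theorem scaledTriple_symProd {w : Fin 2 → A} {q κ e : K} (h : w 0 * w 1 - w 1 * w 0 = q • (1 : A))
    (he : 16 * e = -3) :
    ScaledTriple (symTriple κ w) (2 * κ * q) e := by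
  have h10 : w 1 * w 0 = w 0 * w 1 - q • (1 : A) := by rw [← h]; abel
  have e1 : ∀ y, w 1 * (w 0 * y) = w 0 * (w 1 * y) - q • y := fun y => by
    rw [← mul_assoc, h10, sub_mul, mul_assoc, smul_mul_assoc, one_mul]
  refine ⟨?_, ?_, ?_, ?_⟩
  · change symProd κ w 0 0 * symProd κ w 0 1 - symProd κ w 0 1 * symProd κ w 0 0 =
      (2 * (2 * κ * q)) • symProd κ w 0 0
    simp only [symProd, add_mul, mul_add, mul_assoc, e1, h10, mul_sub, sub_mul,
      mul_smul_comm, smul_mul_assoc, mul_one, one_mul]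
    module
  · change symProd κ w 0 0 * symProd κ w 1 1 - symProd κ w 1 1 * symProd κ w 0 0 =
      (4 * (2 * κ * q)) • symProd κ w 0 1
    simp only [symProd, add_mul, mul_add, mul_assoc, e1, h10, mul_sub,
      mul_smul_comm, smul_mul_assoc, mul_one]
    module
  · change symProd κ w 0 1 * symProd κ w 1 1 - symProd κ w 1 1 * symProd κ w 0 1 =
      (2 * (2 * κ * q)) • symProd κ w 1 1
    simp only [symProd, add_mul, mul_add, mul_assoc, e1, h10, mul_sub, sub_mul,
      mul_smul_comm, smul_mul_assoc, mul_one, one_mul]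
    module
  · change symProd κ w 0 0 * symProd κ w 1 1 + symProd κ w 1 1 * symProd κ w 0 0 -
      (2 : K) • (symProd κ w 0 1 * symProd κ w 0 1) = (-8 * (e * (2 * κ * q) ^ 2)) • (1 : A)
    simp only [symProd, add_mul, mul_add, mul_assoc, e1, h10, mul_sub, sub_mul,
      mul_smul_comm, smul_mul_assoc, mul_one, one_mul]
    linear_combination (norm := module) (2 * κ ^ 2 * q ^ 2) • (he • (1 : A))

theorem symProd_mem (κ : K) (w : Fin 2 → A) (a b : Fin 2) : symProd κ w a b ∈
    Algebra.adjoin K (Set.range (symTriple κ w)) := by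
  have h01 : symProd κ w 0 1 ∈ Algebra.adjoin K (Set.range (symTriple κ w)) :=
    Algebra.subset_adjoin ⟨1, rfl⟩
  fin_cases a <;> fin_cases b
  · exact Algebra.subset_adjoin ⟨0, rfl⟩
  · exact h01
  · change symProd κ w 1 0 ∈ _
    rwa [symProd_comm]
  · exact Algebra.subset_adjoin ⟨2, rfl⟩

/-- A product is half of anticommutator plus commutator; the former is a rescaled symmetrized
product, the latter a scalar. -/
theorem mul_mem_symTriple {w : Fin 2 → A} {q κ κ' h : K}
    (hw : w 0 * w 1 - w 1 * w 0 = algebraMap K A q) (hκ : κ' * κ = 1) (h2 : h * 2 = 1)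
    (a b : Fin 2) : w a * w b ∈ Algebra.adjoin K (Set.range (symTriple κ w)) := by
  set S := Algebra.adjoin K (Set.range (symTriple κ w))
  have h1 : w a * w b + w b * w a ∈ S := by
    have h := S.smul_mem (symProd_mem κ w a b) κ'
    rwa [symProd, smul_smul, hκ, one_smul] at h
  have h2' : w a * w b - w b * w a ∈ S := by
    fin_cases a <;> fin_cases b
    · change w 0 * w 0 - w 0 * w 0 ∈ S
      rw [sub_self]
      exact zero_mem _
    · exact hw ▸ S.algebraMap_mem q
    · have h := neg_mem (hw ▸ S.algebraMap_mem q : w 0 * w 1 - w 1 * w 0 ∈ S)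
      rwa [neg_sub] at h
    · change w 1 * w 1 - w 1 * w 1 ∈ S
      rw [sub_self]
      exact zero_mem _
  have h3 := S.smul_mem (add_mem h1 h2') h
  have e : h • (w a * w b + w b * w a + (w a * w b - w b * w a)) = w a * w b := by
    linear_combination (norm := module) h2 • (w a * w b)
  rwa [e] at h3

/-- The even part of an algebra generated by two canonically conjugate elements is generated by
their symmetrized products. -/
theorem equalizer_eq_adjoin_symTriple {w : Fin 2 → A} {q κ κ' h : K}
    (hw : w 0 * w 1 - w 1 * w 0 = algebraMap K A q) (hκ : κ' * κ = 1) (h2 : h * 2 = 1)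
    (hgen : Algebra.adjoin K (Set.range w) = ⊤) {flip : A →ₐ[K] A}
    (hf : ∀ a, flip (w a) = (-1 : K) • w a) :
    AlgHom.equalizer flip (AlgHom.id K A) = Algebra.adjoin K (Set.range (symTriple κ w)) := by
  have hmul := mul_mem_symTriple hw hκ h2
  set S := Algebra.adjoin K (Set.range (symTriple κ w)) with hS
  have hflip : ∀ v ∈ S, flip v = v := by
    have : S ≤ AlgHom.equalizer flip (AlgHom.id K A) := by
      refine Algebra.adjoin_le ?_
      have hs : ∀ a b, flip (symProd κ w a b) = symProd κ w a b := fun a b => by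
        simp only [symProd, map_smul, map_add, map_mul, hf, neg_smul, one_smul, neg_mul_neg]
      rintro _ ⟨j, rfl⟩
      fin_cases j
      exacts [hs 0 0, hs 0 1, hs 1 1]
    exact fun v hv => this hv
  -- Products of two generators lie in `S`, so right multiplication by a generator preserves the
  -- form `a + b w₀ + c w₁` with coefficients in `S`.
  have hdec : ∀ v : A, ∃ a ∈ S, ∃ b ∈ S, ∃ c ∈ S, v = a + b * w 0 + c * w 1 := by
    intro v
    have hv : v ∈ Algebra.adjoin K (Set.range w) := by
      rw [hgen]; trivial
    suffices h : ∀ y : A, (∃ a ∈ S, ∃ b ∈ S, ∃ c ∈ S, y = a + b * w 0 + c * w 1) →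
        ∃ a ∈ S, ∃ b ∈ S, ∃ c ∈ S, y * v = a + b * w 0 + c * w 1 by
      have h1 := h 1 ⟨1, one_mem _, 0, zero_mem _, 0, zero_mem _, by simp⟩
      rwa [one_mul] at h1
    refine Algebra.adjoin_induction (p := fun v _ => ∀ y : A,
      (∃ a ∈ S, ∃ b ∈ S, ∃ c ∈ S, y = a + b * w 0 + c * w 1) →
        ∃ a ∈ S, ∃ b ∈ S, ∃ c ∈ S, y * v = a + b * w 0 + c * w 1) ?_ ?_ ?_ ?_ hv
    · rintro _ ⟨j, rfl⟩ _ ⟨a, ha, b, hb, c, hc, rfl⟩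
      have hm : b * (w 0 * w j) + c * (w 1 * w j) ∈ S :=
        add_mem (mul_mem hb (hmul 0 j)) (mul_mem hc (hmul 1 j))
      have e : (a + b * w 0 + c * w 1) * w j = a * w j + (b * (w 0 * w j) + c * (w 1 * w j)) := by
        rw [add_mul, add_mul, mul_assoc, mul_assoc, add_assoc]
      rw [e]
      generalize b * (w 0 * w j) + c * (w 1 * w j) = m at hm
      fin_cases j
      · refine ⟨m, hm, a, ha, 0, zero_mem _, ?_⟩
        rw [zero_mul, add_zero, add_comm]
        rfl
      · refine ⟨m, hm, 0, zero_mem _, a, ha, ?_⟩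
        rw [zero_mul, add_zero, add_comm]
        rfl
    · rintro r _ ⟨a, ha, b, hb, c, hc, rfl⟩
      refine ⟨r • a, S.smul_mem ha r, r • b, S.smul_mem hb r, r • c, S.smul_mem hc r, ?_⟩
      rw [← Algebra.commutes, ← Algebra.smul_def, smul_add, smul_add, smul_mul_assoc,
        smul_mul_assoc]
    · rintro v v' _ _ hv hw y hy
      obtain ⟨a, ha, b, hb, c, hc, h⟩ := hv y hy
      obtain ⟨a', ha', b', hb', c', hc', h'⟩ := hw y hy
      refine ⟨a + a', add_mem ha ha', b + b', add_mem hb hb', c + c', add_mem hc hc', ?_⟩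
      rw [mul_add, h, h', add_mul, add_mul]
      abel
    · rintro v v' _ _ hv hw y hy
      rw [← mul_assoc]
      exact hw _ (hv y hy)
  refine le_antisymm (fun v hv => ?_) fun v hv => hflip v hv
  obtain ⟨a, ha, b, hb, c, hc, hd⟩ := hdec v
  have h1 : flip v = v := hv
  have h2' : flip v = a - b * w 0 - c * w 1 := by
    rw [hd, map_add, map_add, map_mul, map_mul, hflip a ha, hflip b hb, hflip c hc, hf, hf,
      neg_smul, neg_smul, one_smul, one_smul, mul_neg, mul_neg, sub_eq_add_neg, sub_eq_add_neg]
  -- The flip negates the odd part, so averaging an invariant element with its image leaves only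
  -- `a`.
  have h3 : (2 : K) • v = (2 : K) • a := by
    have e : v + v = v + flip v := by rw [h1]
    rw [two_smul, two_smul, e, h2', hd]
    abel
  have h4 : v = a := by
    linear_combination (norm := module) h • h3 - h2 • v + h2 • a
  rwa [h4]

end Symmetrized

/-! ### Transport along homomorphisms with independent images. -/

section Transport

variable {K : Type} [CommRing K] [Algebra ℂ K] {A : Type} [Ring A] [Algebra K A]

/-- An algebra homomorphism is invertible on the span of symmetrized monomials as soon as it maps
these to linearly independent elements. -/
theorem exists_symSpan_equiv {M : Type} [Ring M] [Algebra K M] (ρ : A →ₐ[K] M) {y : Fin 3 → A}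
    {x : Fin 3 → M} (hx : ∀ j, ρ (y j) = x j) (hinj : Function.Injective (symMap K x))
    {S : Subalgebra K A} (hS : Subalgebra.toSubmodule S = symSpan K y) :
    ∃ L : symSpan K x ≃ₗ[K] S, (∀ f : symSpan K x, (f : M) = 1 → L f = 1) ∧
      (∀ f g h : symSpan K x, (h : M) = f * g → L h = L f * L g) ∧
      ∀ (v : S) (f : symSpan K x), (f : M) = ρ v → L f = v := by
  have hcomp : ∀ w, ρ (symMap K y w) = symMap K x w := fun w => by
    rw [map_symMap]
    congr 2
    exact funext hx
  have hrange : ∀ v : S, ∃ w, symMap K y w = v := fun v => by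
    have h : (v : A) ∈ symSpan K y := hS ▸ v.2
    rwa [← range_symMap] at h
  have hmem : ∀ v : S, ρ v ∈ symSpan K x := fun v => by
    obtain ⟨w, hw⟩ := hrange v
    rw [← hw, hcomp, ← range_symMap]
    exact ⟨w, rfl⟩
  let F : S →ₗ[K] symSpan K x := (ρ.toLinearMap ∘ₗ S.val.toLinearMap).codRestrict _ hmem
  have hbij : Function.Bijective F := by
    constructor
    · intro v v' hv
      obtain ⟨w, hw⟩ := hrange v
      obtain ⟨w', hw'⟩ := hrange v'
      have h1 : ρ v = ρ v' := congrArg Subtype.val hv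
      rw [← hw, ← hw', hcomp, hcomp] at h1
      exact Subtype.ext (by rw [← hw, ← hw', hinj h1])
    · rintro ⟨y', hy⟩
      have hy' := hy
      rw [← range_symMap] at hy'
      obtain ⟨w, rfl⟩ := hy'
      have h : symMap K y w ∈ Subalgebra.toSubmodule S := by
        rw [hS, ← range_symMap]
        exact ⟨w, rfl⟩
      exact ⟨⟨_, h⟩, Subtype.ext (hcomp w)⟩
  have hinjM : ∀ v w : S, ρ v = ρ w → v = w := fun v w h => hbij.1 (Subtype.ext h)
  let E := LinearEquiv.ofBijective F hbij
  have hE : ∀ f, ρ (E.symm f : S) = f := fun f => congrArg Subtype.val (E.apply_symm_apply f)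
  refine ⟨E.symm, fun f hf => hinjM _ _ ?_, fun f g h hfg => hinjM _ _ ?_,
    fun v f hf => hinjM _ _ ?_⟩
  · rw [hE, hf]
    exact (map_one ρ).symm
  · rw [Subalgebra.coe_mul, map_mul, hE, hE, hE, hfg]
  · rw [hE, hf]

end Transport

/-! ### The Weyl algebra and the symplecton. -/

section WeylAlgebra

theorem weyl_adjoin : Algebra.adjoin R (Set.range wgen) = ⊤ := by
  set S := Algebra.adjoin R (Set.range wgen)
  let π := RingQuot.mkAlgHom R (fun x y : FreeAlgebra R (Fin 2) =>
    x = FreeAlgebra.ι R 0 * FreeAlgebra.ι R 1 - FreeAlgebra.ι R 1 * FreeAlgebra.ι R 0 ∧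
      y = algebraMap R _ qq)
  have h1 : (⊤ : Subalgebra R (FreeAlgebra R (Fin 2))) ≤ S.comap π := by
    rw [← FreeAlgebra.adjoin_range_ι]
    refine Algebra.adjoin_le ?_
    rintro _ ⟨a, rfl⟩
    exact Algebra.subset_adjoin ⟨a, rfl⟩
  refine eq_top_iff.2 fun a _ => ?_
  obtain ⟨b, rfl⟩ := RingQuot.mkAlgHom_surjective R _ a
  exact h1 (Algebra.mem_top (x := b))

/-- The Weyl algebra acts wherever there are canonically conjugate elements. -/
theorem exists_weyl_algHom {M : Type} [Ring M] [Algebra R M] {u : Fin 2 → M}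
    (h : u 0 * u 1 - u 1 * u 0 = qq • (1 : M)) :
    ∃ ρ : Weyl →ₐ[R] M, ∀ a, ρ (wgen a) = u a := by
  refine ⟨RingQuot.liftAlgHom R ⟨FreeAlgebra.lift R u, ?_⟩, fun a => ?_⟩
  · rintro x y ⟨rfl, rfl⟩
    rw [map_sub, map_mul, map_mul, FreeAlgebra.lift_ι_apply, FreeAlgebra.lift_ι_apply,
      AlgHom.commutes, h, Algebra.algebraMap_eq_smul_one]
  · exact (RingQuot.liftAlgHom_mkAlgHom_apply R _ _ _).trans (FreeAlgebra.lift_ι_apply _ _)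

theorem symplecton_eq {κ : ℂ} (hκ : κ ≠ 0) : symplecton =
    Algebra.adjoin R (Set.range (symTriple (PowerSeries.C (κ / 2) : R) wgen)) := by
  refine equalizer_eq_adjoin_symTriple (K := R) (A := Weyl) (w := wgen) (q := qq) wgen_comm (κ' := PowerSeries.C (κ / 2)⁻¹) ?_
    C_half_mul_two ?_ fun a => ?_
  · rw [← map_mul, inv_mul_cancel₀ (div_ne_zero hκ two_ne_zero), map_one]
  · exact weyl_adjoin
  · have h : weylFlip (wgen a) = FreeAlgebra.lift R (fun a => (-1 : R) • wgen a)
        (FreeAlgebra.ι R a) := RingQuot.liftAlgHom_mkAlgHom_apply R _ _ _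
    rw [h, FreeAlgebra.lift_ι_apply]

theorem scaledTriple_weyl (κ : ℂ) :
    ScaledTriple (symTriple (PowerSeries.C (κ / 2) : R) wgen) (PowerSeries.C κ * qq)
      (algebraMap ℂ R (-3 / 16)) := by
  have h : wgen 0 * wgen 1 - wgen 1 * wgen 0 = qq • (1 : Weyl) := by
    rw [wgen_comm, Algebra.algebraMap_eq_smul_one]
  have e : (PowerSeries.C κ * qq : R) = 2 * PowerSeries.C (κ / 2) * qq := by
    rw [← map_ofNat (PowerSeries.C (R := ℂ)) 2, ← map_mul, mul_div_cancel₀ _ two_ne_zero]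
  rw [e]
  refine scaledTriple_symProd h ?_
  rw [← map_ofNat (algebraMap ℂ R) 16, ← map_mul, ← map_ofNat (algebraMap ℂ R) 3, ← map_neg]
  norm_num

set_option maxHeartbeats 1000000 in
/-- The symplecton is the algebra generated by symmetrized products of canonically conjugate
elements, provided their symmetrized monomials are linearly independent. -/
theorem exists_symplecton_equiv {M : Type} [Ring M] [Algebra R M] {κ : ℂ} (hκ : κ ≠ 0)
    {u : Fin 2 → M} (hu : u 0 * u 1 - u 1 * u 0 = (PowerSeries.C κ * qq : R) • (1 : M))
    {X : Fin 2 → Fin 2 → M} (hX : ∀ a b, X a b = symProd (PowerSeries.C (1 / 2 : ℂ) : R) u a b)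
    (hinj : Function.Injective (symMap R ![X 0 0, X 0 1, X 1 1])) :
    ∃ L : symSpan R ![X 0 0, X 0 1, X 1 1] ≃ₗ[R] symplecton,
      (∀ f : symSpan R ![X 0 0, X 0 1, X 1 1], (f : M) = 1 → L f = 1) ∧
      (∀ f g h : symSpan R ![X 0 0, X 0 1, X 1 1], (h : M) = f * g → L h = L f * L g) ∧
      ∀ (a b : Fin 2) (f : symSpan R ![X 0 0, X 0 1, X 1 1]), (f : M) = X a b →
        (L f : Weyl) = (PowerSeries.C (κ / 2) : R) • (wgen a * wgen b + wgen b * wgen a) := by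
  -- The `u a` have commutator `κ 𝔮`; multiplied by a square root `r` of `κ⁻¹` they satisfy the Weyl
  -- relation with parameter `𝔮`.
  obtain ⟨r, hr⟩ := IsAlgClosed.exists_pow_nat_eq κ⁻¹ two_pos
  have hrk : r ^ 2 * κ = 1 := by rw [hr, inv_mul_cancel₀ hκ]
  obtain ⟨ρ, hρ⟩ := exists_weyl_algHom (u := fun a => (PowerSeries.C r : R) • u a) (by
    simp only [smul_mul_smul_comm]
    rw [← smul_sub, hu, smul_smul, ← mul_assoc, ← map_mul, ← map_mul, ← pow_two, hrk, map_one,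
      one_mul])
  have hρX : ∀ a b, ρ (symProd (PowerSeries.C (κ / 2) : R) wgen a b) = X a b := by
    intro a b
    rw [hX]
    simp only [symProd, map_smul, map_add, map_mul, hρ, smul_mul_smul_comm]
    rw [← smul_add, smul_smul, ← map_mul, ← map_mul]
    congr 2
    linear_combination hrk / 2
  have hspan : Subalgebra.toSubmodule symplecton =
      symSpan R (symTriple (PowerSeries.C (κ / 2) : R) wgen) := by
    rw [(scaledTriple_weyl κ).symSpan_eq, symplecton_eq hκ]
  have hρx : ∀ j, ρ (symTriple (PowerSeries.C (κ / 2) : R) wgen j) =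
      ![X 0 0, X 0 1, X 1 1] j := by
    intro j
    fin_cases j
    exacts [hρX 0 0, hρX 0 1, hρX 1 1]
  obtain ⟨L, h1, hm, hg⟩ := exists_symSpan_equiv (K := R) (A := Weyl) ρ hρx hinj hspan
  refine ⟨L, h1, hm, fun a b f hf => ?_⟩
  have h : symProd (PowerSeries.C (κ / 2) : R) wgen a b ∈ symplecton := by
    rw [symplecton_eq hκ]
    exact symProd_mem (K := R) (A := Weyl) _ _ a b
  have e : L f = (⟨_, h⟩ : symplecton) := hg ⟨_, h⟩ f (hf.trans (hρX a b).symm)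
  exact congrArg Subtype.val e

end WeylAlgebra

/-! ### The fibre algebra inside the Moyal algebra. -/

/-- The smallest submodule closed under a product is the algebra generated. -/
theorem map_sInf_eq_adjoin {K F M ι κ : Type} [CommRing K] [AddCommGroup F] [Module K F] [Ring M]
    [Algebra K M] (e : F ≃ₗ[K] M) {m : F → F → F} (hm : ∀ f g, e (m f g) = e f * e g) {o : F}
    (ho : e o = 1) {X : ι → ι → F} {x : κ → M} (hX : ∀ a b, ∃ j, e (X a b) = x j)
    (hx : ∀ j, ∃ a b, x j = e (X a b)) :
    (sInf {S : Submodule K F | o ∈ S ∧ (∀ a b, X a b ∈ S) ∧ ∀ f ∈ S, ∀ g ∈ S, m f g ∈ S}).map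
      e.toLinearMap = Subalgebra.toSubmodule (Algebra.adjoin K (Set.range x)) := by
  set N := sInf {S : Submodule K F | o ∈ S ∧ (∀ a b, X a b ∈ S) ∧ ∀ f ∈ S, ∀ g ∈ S, m f g ∈ S}
    with hN
  refine le_antisymm ?_ ?_
  · rw [Submodule.map_le_iff_le_comap]
    refine sInf_le ⟨?_, fun a b => ?_, fun f hf g hg => ?_⟩
    · change e o ∈ Algebra.adjoin K (Set.range x)
      rw [ho]
      exact one_mem _
    · obtain ⟨j, hj⟩ := hX a b
      change e (X a b) ∈ Algebra.adjoin K (Set.range x)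
      exact hj ▸ Algebra.subset_adjoin ⟨j, rfl⟩
    · change e (m f g) ∈ Algebra.adjoin K (Set.range x)
      rw [hm]
      exact mul_mem hf hg
  · have h1 : o ∈ N := Submodule.mem_sInf.2 fun _ hS => hS.1
    have h2 : ∀ a b, X a b ∈ N := fun a b => Submodule.mem_sInf.2 fun _ hS => hS.2.1 a b
    have h3 : ∀ f ∈ N, ∀ g ∈ N, m f g ∈ N := fun f hf g hg => Submodule.mem_sInf.2 fun S hS =>
      hS.2.2 f (Submodule.mem_sInf.1 hf S hS) g (Submodule.mem_sInf.1 hg S hS)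
    let S : Subalgebra K M := Submodule.toSubalgebra (N.map e.toLinearMap) ⟨o, h1, ho⟩ (by
      rintro _ _ ⟨f, hf, rfl⟩ ⟨g, hg, rfl⟩
      exact ⟨_, h3 f hf g hg, hm f g⟩)
    have hS : Algebra.adjoin K (Set.range x) ≤ S := by
      refine Algebra.adjoin_le ?_
      rintro _ ⟨j, rfl⟩
      obtain ⟨a, b, hj⟩ := hx j
      exact ⟨_, h2 a b, hj.symm⟩
    exact hS

section Fibre

/-- The coordinate derivations of a twistor fibre. -/
noncomputable def fibDer (a : Fin 2) : Derivation ℂ (SmoothFn Fib) (SmoothFn Fib) :=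
  delDer (Pi.single a 1)

theorem starFib_eq (α β l : Spinor) : starFib α β l =
    formalStar fibDer (algebraMap ℂ (SmoothFn Fib) (kapAt α β l)) := star_eq _ _

theorem bracketFib_eq (α β l : Spinor) : bracketFib α β l =
    formalBracket fibDer (algebraMap ℂ (SmoothFn Fib) (kapAt α β l)) := moyalBracket_eq _ _

theorem moyalData_fib {k : ℂ} (hk : k ≠ 0) : MoyalData fibDer k :=
  ⟨fun f => del_comm _ _ f, hk⟩

theorem kapAt_ne_zero {α β l : Spinor} (h1 : sp α l ≠ 0) (h2 : sp l β ≠ 0) : kapAt α β l ≠ 0 :=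
  mul_ne_zero h1 h2

theorem res_smul (l : Spinor) (hl : l ≠ 0) (r : R) (f : FormalFn PT) :
    res l hl (r • f) = r • res l hl f := by
  change PowerSeries.map _ (PowerSeries.map (algebraMap ℂ (SmoothFn PT)) r * f) =
    PowerSeries.map (algebraMap ℂ (SmoothFn Fib)) r * PowerSeries.map _ f
  rw [map_mul]
  congr 1

theorem res_qLam (α β l : Spinor) (hl : l ≠ 0) :
    res l hl (qLam α β) = algebraMap R (FormalFn Fib) (qAt α β l) := by
  rw [qLam, res_smul, qAt, mul_comm, map_mul, Algebra.smul_def]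
  congr 1
  change PowerSeries.map _ (PowerSeries.C _) = PowerSeries.map (algebraMap ℂ (SmoothFn Fib)) (PowerSeries.C _)
  rw [PowerSeries.map_C, PowerSeries.map_C]
  rfl

theorem res_contract (l : Spinor) (hl : l ≠ 0) {m : FormalFn PT → FormalFn PT → FormalFn PT}
    {m' : FormalFn Fib → FormalFn Fib → FormalFn Fib}
    (h : ∀ f g, res l hl (m f g) = m' (res l hl f) (res l hl g))
    (T : Fin 2 → Fin 2 → FormalFn PT) :
    res l hl (contract m T) = contract m' fun a b => res l hl (T a b) := by
  simp only [contract, map_sum, map_zsmul, h]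

theorem res_cSqLam (α β l : Spinor) (hl : l ≠ 0) (c : R) : res l hl (cSqLam α β c) =
    algebraMap R (FormalFn Fib) (c ^ 2 * PowerSeries.C (kapAt α β l ^ 2)) := by
  rw [cSqLam, res_smul, map_mul, Algebra.smul_def]
  congr 1
  change PowerSeries.map _ (PowerSeries.C _) = PowerSeries.map (algebraMap ℂ (SmoothFn Fib)) (PowerSeries.C _)
  rw [PowerSeries.map_C, PowerSeries.map_C]
  rfl

theorem fibre_casimir (α β : Spinor) {l : Spinor} (hl : l ≠ 0) {ct μ : ℂ} {c : R}
    (hμ : μ = (4 * ct ^ 2 - 3) / 16) (hc : c = PowerSeries.C ct * qq) :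
    (PowerSeries.C (-1 / 8) : R) • contract (starFib α β l) (XFib α β c l hl) =
      algebraMap R (FormalFn Fib) (qAt α β l ^ 2 * PowerSeries.C μ) := by
  have h := congrArg (res l hl) (contract_star_XX α β c)
  rw [contract_mul_XX, map_add, map_zsmul, res_smul, map_pow, res_qLam, res_cSqLam,
    res_contract l hl (res_star α β l hl)] at h
  change (PowerSeries.C (-1 / 8) : R) • contract (starFib α β l) (fun a b => res l hl (XX α β c a b)) = _
  rw [h, ← map_zsmul, ← map_pow, Algebra.smul_def, Algebra.smul_def, ← map_mul, ← map_add,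
    ← map_mul]
  congr 1
  have e1 : (PowerSeries.C (kapAt α β l ^ 2) : R) = PowerSeries.C (kapAt α β l) ^ 2 := map_pow _ _ _
  -- `-(1/8) (-2 c̃² + 3/2) = (4 c̃² - 3) / 16`, which is where the value of `μ` comes from.
  have e2 : (PowerSeries.C μ : R) = PowerSeries.C (-1 / 8) *
      (-2 * PowerSeries.C ct ^ 2 + PowerSeries.C (3 / 2)) := by
    rw [← map_ofNat (PowerSeries.C (R := ℂ)) 2, ← map_neg, ← map_pow, ← map_mul, ← map_add,
      ← map_mul, hμ]
    congr 1
    ring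
  rw [e1, e2, hc, qAt]
  simp only [zsmul_eq_mul]
  push_cast
  ring

theorem XX_symm (α β : Spinor) (c : R) (a b : Fin 2) : XX α β c a b = XX α β c b a := by
  rw [XX, XX, mul_comm (mu a), mul_comm (muHat a)]

/-- The generators of the fibre algebra in the Moyal algebra of the fibre. -/
noncomputable def fibGen (α β : Spinor) (c : R) (l : Spinor) (hl : l ≠ 0) (a b : Fin 2) :
    MoyalAlg fibDer (kapAt α β l) :=
  MoyalAlg.of fibDer (kapAt α β l) (XFib α β c l hl a b)

/-- The triple of generators of the fibre algebra. -/
noncomputable abbrev fibTriple (α β : Spinor) (c : R) (l : Spinor) (hl : l ≠ 0) :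
    Fin 3 → MoyalAlg fibDer (kapAt α β l) :=
  ![fibGen α β c l hl 0 0, fibGen α β c l hl 0 1, fibGen α β c l hl 1 1]

theorem fibGen_symm (α β : Spinor) (c : R) (l : Spinor) (hl : l ≠ 0) (a b : Fin 2) :
    fibGen α β c l hl a b = fibGen α β c l hl b a := by
  rw [fibGen, fibGen, XFib, XX_symm]
  rfl

theorem bracket_XFib (α β : Spinor) {l : Spinor} (hl : l ≠ 0) (c : R) (a b d e : Fin 2) :
    bracketFib α β l (XFib α β c l hl a b) (XFib α β c l hl d e) =
      (eps a d : R) • XFib α β c l hl b e + (eps a e : R) • XFib α β c l hl b d +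
        (eps b d : R) • XFib α β c l hl a e + (eps b e : R) • XFib α β c l hl a d := by
  have e : ∀ (n : ℤ) (f : FormalFn Fib), (n : R) • f = n • f := fun n f =>
    Int.cast_smul_eq_zsmul R n f
  simp only [XFib, ← res_bracket, bracket_XX, map_add, map_zsmul, e]

section

variable {α β l : Spinor} (hl : l ≠ 0) [hd : MoyalData fibDer (kapAt α β l)]

theorem fibGen_commutator (c : R) (a b d e : Fin 2) :
    fibGen α β c l hl a b * fibGen α β c l hl d e - fibGen α β c l hl d e * fibGen α β c l hl a b =
      qAt α β l • ((eps a d : R) • fibGen α β c l hl b e + (eps a e : R) • fibGen α β c l hl b d +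
        (eps b d : R) • fibGen α β c l hl a e + (eps b e : R) • fibGen α β c l hl a d) := by
  simp only [fibGen]
  rw [MoyalAlg.mul_sub_mul, ← bracketFib_eq, bracket_XFib]
  simp only [map_add, map_smul]
  rfl

theorem scaledTriple_fib {ct μ : ℂ} {c : R} (hμ : μ = (4 * ct ^ 2 - 3) / 16)
    (hc : c = PowerSeries.C ct * qq) :
    ScaledTriple (fibTriple α β c l hl) (qAt α β l) (algebraMap ℂ R μ) := by
  refine ScaledTriple.of_symmetric (fibGen_symm α β c l hl 1 0) (fibGen_commutator hl c)
    neg_eight_mul_C ?_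
  have h := congrArg (MoyalAlg.of fibDer (kapAt α β l)) (fibre_casimir α β hl hμ hc)
  rw [map_smul, Algebra.algebraMap_eq_smul_one, map_smul, ← MoyalAlg.one_def, starFib_eq] at h
  refine Eq.trans ?_ h
  congr 1

/-- The correction term carries `c²`, and `c` is divisible by `𝔮`, so it disappears in the classical
limit. -/
theorem classical_fibGen {ct : ℂ} {c : R} (hc : c = PowerSeries.C ct * qq) (a b : Fin 2) :
    MoyalAlg.classical fibDer (kapAt α β l) (fibGen α β c l hl a b) = fibCoord a * fibCoord b := by
  have h0 : PowerSeries.coeff 0 (cSqLam α β c) = 0 := by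
    change PowerSeries.coeff 0 (PowerSeries.map (algebraMap ℂ (SmoothFn PT)) (c ^ 2) * _) = 0
    simp [hc]
  have h : PowerSeries.coeff 0 (XX α β c a b) = mu a * mu b := by
    rw [XX, map_sub, PowerSeries.coeff_mul_C, h0, zero_mul, sub_zero, PowerSeries.coeff_zero_C]
  change PowerSeries.coeff 0 (res l hl (XX α β c a b)) = _
  rw [res, PowerSeries.coeff_map, h]
  exact map_mul (resFn l hl) _ _

/-- At `𝔮 = 0` symmetrized monomials become ordinary monomials in the fibre coordinates, which are
independent over `ℂ`; freeness over `ℂ⟦𝔮⟧` follows. -/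
theorem symMap_fibTriple_injective {ct : ℂ} {c : R} (hc : c = PowerSeries.C ct * qq) :
    Function.Injective (symMap R (fibTriple α β c l hl)) := by
  refine linearCombination_injective (MoyalAlg.classical fibDer (kapAt α β l))
    (MoyalAlg.classical_smul _ _) (fun f => MoyalAlg.X_smul_cancel _ _) _ ?_
  have h : (fun i : WIdx => MoyalAlg.classical fibDer (kapAt α β l)
      (symMon R (fibTriple α β c l hl) i.1.1 i.1.2)) =
      fun i => fibCoord 0 ^ i.1.1 * fibCoord 1 ^ i.1.2 := by
    funext i
    refine ringHom_symMon _ (MoyalAlg.classical_smul _ _) ?_ ?_ ?_ (even_iff_exists_two_mul.1 i.2).choose_spec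
    · exact (classical_fibGen hl hc 0 0).trans (pow_two _).symm
    · exact classical_fibGen hl hc 0 1
    · exact (classical_fibGen hl hc 1 1).trans (pow_two _).symm
  rw [h]
  exact linearIndependent_fibre_monomials

theorem of_starFib (f g : FormalFn Fib) : MoyalAlg.of fibDer (kapAt α β l) (starFib α β l f g) =
    MoyalAlg.of fibDer (kapAt α β l) f * MoyalAlg.of fibDer (kapAt α β l) g := by
  rw [MoyalAlg.of_mul_of, starFib_eq]

theorem of_bracketFib (f g : FormalFn Fib) :
    MoyalAlg.of fibDer (kapAt α β l) f * MoyalAlg.of fibDer (kapAt α β l) g -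
      MoyalAlg.of fibDer (kapAt α β l) g * MoyalAlg.of fibDer (kapAt α β l) f =
    qAt α β l • MoyalAlg.of fibDer (kapAt α β l) (bracketFib α β l f g) := by
  rw [MoyalAlg.mul_sub_mul, bracketFib_eq]
  rfl

/-- The fibre algebra is the span of the symmetrized monomials in the generators. -/
theorem map_fibAlg {ct μ : ℂ} {c : R} (hμ : μ = (4 * ct ^ 2 - 3) / 16)
    (hc : c = PowerSeries.C ct * qq) :
    (fibAlg α β c l hl).map (MoyalAlg.of fibDer (kapAt α β l)).toLinearMap =
      symSpan R (fibTriple α β c l hl) := by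
  rw [(scaledTriple_fib hl hμ hc).symSpan_eq]
  refine map_sInf_eq_adjoin _ of_starFib (MoyalAlg.one_def _ _).symm (fun a b => ?_) fun j => ?_
  · fin_cases a <;> fin_cases b
    exacts [⟨0, rfl⟩, ⟨1, rfl⟩, ⟨1, fibGen_symm α β c l hl 1 0⟩, ⟨2, rfl⟩]
  · fin_cases j
    exacts [⟨0, 0, rfl⟩, ⟨0, 1, rfl⟩, ⟨1, 1, rfl⟩]

/-- The fibre algebra inside the Moyal algebra of the fibre. -/
theorem exists_fibAlg_equiv {ct μ : ℂ} {c : R} (hμ : μ = (4 * ct ^ 2 - 3) / 16)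
    (hc : c = PowerSeries.C ct * qq) :
    ∃ E : fibAlg α β c l hl ≃ₗ[R] symSpan R (fibTriple α β c l hl),
      ∀ f, (E f : MoyalAlg fibDer (kapAt α β l)) = MoyalAlg.of fibDer (kapAt α β l) f :=
  ⟨((MoyalAlg.of fibDer (kapAt α β l)).submoduleMap (fibAlg α β c l hl)).trans
    (LinearEquiv.ofEq _ _ (map_fibAlg hl hμ hc)), fun _ => rfl⟩

end

end Fibre

/-! ### Star products of functions with constant derivatives. -/

section LinearFunctions

variable {A : Type} [CommRing A] [Algebra ℂ A] {d : Fin 2 → Derivation ℂ A A}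

theorem transvectant_linear {B : Type} [CommRing B] [Algebra ℂ B] {D : Fin 2 → Derivation ℂ B B}
    {f : B} (hf : ∀ a b, D a (D b f) = 0) (g : B) (k : ℕ) : transvectant D (k + 2) f g = 0 := by
  simp [transvectant_succ, hf]

/-- The symmetrized star product of functions with constant derivatives is their product. -/
theorem formalStar_add_formalStar (κ : A) {f g : A⟦X⟧}
    (hf : ∀ a b, formalDer (d a) (formalDer (d b) f) = 0)
    (hg : ∀ a b, formalDer (d a) (formalDer (d b) g) = 0) :
    formalStar d κ f g + formalStar d κ g f = (PowerSeries.C 2 : R) • (f * g) := by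
  have h : ∀ {f : A⟦X⟧} (g : A⟦X⟧), (∀ a b, formalDer (d a) (formalDer (d b) f) = 0) →
      formalStar d κ f g = f * g + (1 / 2 : ℂ) • (qkap κ * formalTransvectant d 1 f g) :=
    fun {f} g hf => by
      have h3 : ∀ k, 3 ≤ k → formalTransvectant d k f g = 0 := fun k hk => by
        obtain ⟨k, rfl⟩ := Nat.exists_eq_add_of_le' (Nat.le_of_succ_le hk)
        exact transvectant_linear hf g k
      rw [formalStar_eq_of_transvectant κ h3]
      have h2 : formalTransvectant d 2 f g = 0 := transvectant_linear hf g 0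
      rw [h2, mul_zero, smul_zero, add_zero]
  have hs : formalTransvectant d 1 g f = -formalTransvectant d 1 f g := by
    rw [formalTransvectant, transvectant_swap, pow_one, neg_one_mul]
  rw [h g hf, h f hg, hs, C_smul_formal, mul_neg, smul_neg, mul_comm g f, two_smul]
  abel

theorem formalBracket_linear (κ : A) {f : A⟦X⟧} (g : A⟦X⟧)
    (hf : ∀ a b, formalDer (d a) (formalDer (d b) f) = 0) :
    formalBracket d κ f g = formalTransvectant d 1 f g :=
  formalBracket_eq_poisson _ _ fun k hk => by
    obtain ⟨k, rfl⟩ := Nat.exists_eq_add_of_le' (Nat.le_of_succ_le hk)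
    exact transvectant_linear hf g k

end LinearFunctions

/-! ### The isomorphisms of the fibre algebra. -/

section FibreAlgebra

variable {α β l : Spinor} (hl : l ≠ 0) {ct μ : ℂ} {c : R}

theorem exists_quot_equiv_fibAlg (hk : kapAt α β l ≠ 0) (hμ : μ = (4 * ct ^ 2 - 3) / 16)
    (hc : c = PowerSeries.C ct * qq) :
    ∃ φ : UQuot (qAt α β l) (qAt α β l ^ 2 * PowerSeries.C μ) ≃ₗ[R] fibAlg α β c l hl,
      (φ 1 : FormalFn Fib) = 1 ∧
      (∀ x y, (φ (x * y) : FormalFn Fib) = starFib α β l (φ x) (φ y)) ∧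
      ∀ a b : Fin 2, (φ (xQuot _ _ a b) : FormalFn Fib) = XFib α β c l hl a b := by
  have := moyalData_fib hk
  obtain ⟨φ, hφ, hinj, hrange⟩ := (scaledTriple_fib hl hμ hc).exists_injective_algHom
    (symMap_fibTriple_injective (α := α) (β := β) hl hc)
  obtain ⟨E, hE⟩ := exists_fibAlg_equiv (α := α) (β := β) hl hμ hc
  let Φ := ((LinearEquiv.ofInjective φ.toLinearMap hinj).trans (LinearEquiv.ofEq _ _ hrange)).trans
    E.symm
  have hΦ : ∀ x, MoyalAlg.of fibDer (kapAt α β l) (Φ x) = φ x := fun x => by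
    rw [← hE]
    change (E (E.symm _) : MoyalAlg fibDer (kapAt α β l)) = _
    rw [LinearEquiv.apply_symm_apply]
    rfl
  have hcancel := (MoyalAlg.of fibDer (kapAt α β l)).injective
  refine ⟨Φ, hcancel ?_, fun x y => hcancel ?_, fun a b => hcancel ?_⟩
  · exact (hΦ 1).trans (map_one φ)
  · rw [of_starFib]
    exact (hΦ (x * y)).trans ((map_mul φ x y).trans (congrArg₂ (· * ·) (hΦ x) (hΦ y)).symm)
  · refine (hΦ _).trans ?_
    have hs : φ (xQuot _ _ 0 1) = fibGen α β c l hl 0 1 := hφ 1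
    fin_cases a <;> fin_cases b
    · exact hφ 0
    · exact hs
    · change φ (xQuot _ _ 1 0) = fibGen α β c l hl 1 0
      rw [fibGen_symm, ← hs, xQuot, xU, xMat_symm]
      rfl
    · exact hφ 2

/-- The fibre algebra as a Lie algebra. -/
theorem exists_lieEquiv_fibAlg (hk : kapAt α β l ≠ 0) (hμ : μ = (4 * ct ^ 2 - 3) / 16)
    (hc : c = PowerSeries.C ct * qq) {σ : ℂ} (hσ : σ * (σ + 1) = μ) {r s : ℂ} (hr : r ≠ 0)
    (hs : s ≠ 0) {t : R} (ht : qAt α β l = algebraMap ℂ R (2 * s) * t) :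
    ∃ L : fibAlg α β c l hl ≃ₗ[R] WMod,
      (∀ f g h : fibAlg α β c l hl, (h : FormalFn Fib) = bracketFib α β l f g →
        L h = algebraMap ℂ R (r * s⁻¹) • wBracket σ t (L f) (L g)) ∧
      ∀ f : fibAlg α β c l hl, (f : FormalFn Fib) = 1 → L f = Finsupp.single unitIdx (algebraMap ℂ R r⁻¹) := by
  have := moyalData_fib hk
  have hx := scaledTriple_fib (α := α) (β := β) hl hμ hc
  rw [← hσ] at hx
  obtain ⟨E, hE⟩ := exists_fibAlg_equiv (α := α) (β := β) hl hμ hc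
  obtain ⟨L, hL, h1⟩ := hx.exists_lieEquiv (fun a b => MoyalAlg.param_smul_cancel _ _)
    (symMap_fibTriple_injective hl hc) hr hs ht
  refine ⟨E.trans L, fun f g h hfg => hL _ _ _ ?_, fun f hf => h1 _ ?_⟩
  · change (E f : MoyalAlg fibDer (kapAt α β l)) * (E g : MoyalAlg fibDer (kapAt α β l)) -
      (E g : MoyalAlg fibDer (kapAt α β l)) * (E f : MoyalAlg fibDer (kapAt α β l)) =
      qAt α β l • (E h : MoyalAlg fibDer (kapAt α β l))
    rw [hE, hE, hE, hfg]
    exact of_bracketFib _ _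
  · change (E f : MoyalAlg fibDer (kapAt α β l)) = 1
    rw [hE, hf]
    rfl

/-- Closure under star gives only `𝔮(λ)` times the bracket. The explicit commutator formula shows
that the quotient by `𝔮(λ)` again lies in the algebra. -/
theorem bracketFib_mem_fibAlg (hk : kapAt α β l ≠ 0) (hμ : μ = (4 * ct ^ 2 - 3) / 16)
    (hc : c = PowerSeries.C ct * qq) {f g : FormalFn Fib} (hf : f ∈ fibAlg α β c l hl)
    (hg : g ∈ fibAlg α β c l hl) : bracketFib α β l f g ∈ fibAlg α β c l hl := by
  have := moyalData_fib hk
  -- Some `σ` with `σ (σ + 1) = μ` is needed to apply the formula; completing the square gives `σ =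
  -- r - 1/2`.
  obtain ⟨r, hr⟩ := IsAlgClosed.exists_pow_nat_eq (μ + 1 / 4) two_pos
  have hσ : (r - 1 / 2) * (r - 1 / 2 + 1) = μ := by linear_combination hr
  have hx := scaledTriple_fib (α := α) (β := β) hl hμ hc
  rw [← hσ] at hx
  have hmem := map_fibAlg (α := α) (β := β) hl hμ hc
  have h : ∀ f ∈ fibAlg α β c l hl, ∃ v, scaledMap (fibTriple α β c l hl) 1 (kapAt α β l / 2) v =
      MoyalAlg.of fibDer (kapAt α β l) f := fun f hf => by
    have : MoyalAlg.of fibDer (kapAt α β l) f ∈ symSpan R (fibTriple α β c l hl) :=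
      hmem ▸ ⟨f, hf, rfl⟩
    rwa [← range_scaledMap _ one_ne_zero (div_ne_zero hk two_ne_zero)] at this
  obtain ⟨v, hv⟩ := h f hf
  obtain ⟨w, hw⟩ := h g hg
  have hb := hx.scaledMap_commutator (t' := qq) (fun a b => MoyalAlg.param_smul_cancel _ _)
    (c := 1) (div_ne_zero hk two_ne_zero) (by rw [mul_div_cancel₀ _ two_ne_zero]; rfl) v w
  rw [hv, hw, of_bracketFib] at hb
  have hb' := MoyalAlg.param_smul_cancel _ _ hb
  have hm : MoyalAlg.of fibDer (kapAt α β l) (bracketFib α β l f g) ∈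
      symSpan R (fibTriple α β c l hl) := by
    rw [hb', ← range_scaledMap _ one_ne_zero (div_ne_zero hk two_ne_zero)]
    exact ⟨_, rfl⟩
  rw [← hmem] at hm
  obtain ⟨y, hy, e⟩ := hm
  rwa [(MoyalAlg.of fibDer (kapAt α β l)).injective e] at hy

theorem starFib_sub_starFib (hk : kapAt α β l ≠ 0) (f g : FormalFn Fib) :
    starFib α β l f g - starFib α β l g f = qAt α β l • bracketFib α β l f g := by
  have := moyalData_fib hk
  refine (MoyalAlg.of fibDer (kapAt α β l)).injective ?_
  rw [map_sub, of_starFib, of_starFib, of_bracketFib, map_smul]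

theorem fibDer_fibDer_fibCoord (a b e : Fin 2) :
    formalDer (fibDer a) (formalDer (fibDer b) (PowerSeries.C (fibCoord e))) = 0 := by
  rw [formalDer_C, formalDer_C, fibDer, fibDer, fibCoord, delDer_apply (Pi.single b 1),
    del_linFn, Derivation.map_algebraMap, map_zero]

theorem fibDer_fibCoord (a e : Fin 2) :
    formalDer (fibDer a) (PowerSeries.C (fibCoord e)) = if a = e then 1 else 0 := by
  have h : (Pi.single a 1 : Spinor) e = if a = e then 1 else 0 := by
    rw [Pi.single_apply]
    simp only [eq_comm]
  rw [formalDer_C, fibDer, fibCoord, delDer_apply, del_linFn]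
  change PowerSeries.C (algebraMap ℂ _ ((Pi.single a 1 : Spinor) e)) = _
  rw [h]
  split_ifs <;> simp

theorem exists_symplecton_equiv_fibAlg (hk : kapAt α β l ≠ 0) :
    ∃ L : fibAlg α β 0 l hl ≃ₗ[R] symplecton,
      (∀ f : fibAlg α β 0 l hl, (f : FormalFn Fib) = 1 → L f = 1) ∧
      (∀ f g h : fibAlg α β 0 l hl,
        (h : FormalFn Fib) = starFib α β l f g → L h = L f * L g) ∧
      ∀ (a b : Fin 2) (f : fibAlg α β 0 l hl), (f : FormalFn Fib) = XFib α β 0 l hl a b →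
        (L f : Weyl) = (PowerSeries.C (kapAt α β l / 2) : R) •
          (wgen a * wgen b + wgen b * wgen a) := by
  have := moyalData_fib hk
  have hc : (0 : R) = PowerSeries.C 0 * qq := by rw [map_zero, zero_mul]
  obtain ⟨E, hE⟩ := exists_fibAlg_equiv (α := α) (β := β) hl rfl hc
  -- At `c = 0` the generator is `μ^a μ^b`, and the symmetrized star product of two linear
  -- coordinates is their ordinary product.
  have hX : ∀ a b, fibGen α β 0 l hl a b = symProd (PowerSeries.C (1 / 2 : ℂ) : R)
      (fun a => MoyalAlg.of fibDer (kapAt α β l) (PowerSeries.C (fibCoord a))) a b := fun a b => by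
    have h0 : XX α β 0 a b = PowerSeries.C (mu a * mu b) := by
      rw [XX, cSqLam, zero_pow two_ne_zero, zero_smul, zero_mul, sub_zero]
    have h1 : XFib α β 0 l hl a b = PowerSeries.C (fibCoord a) * PowerSeries.C (fibCoord b) := by
      rw [XFib, h0, res, PowerSeries.map_C, ← map_mul]
      rfl
    rw [symProd, MoyalAlg.of_mul_of, MoyalAlg.of_mul_of, ← map_add,
      formalStar_add_formalStar _ (fun _ _ => fibDer_fibDer_fibCoord _ _ _)
        fun _ _ => fibDer_fibDer_fibCoord _ _ _, ← map_smul, smul_smul, ← map_mul,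
      one_div_mul_cancel two_ne_zero, map_one, one_smul, ← h1, fibGen]
  obtain ⟨L, h1, hm, hg⟩ := exists_symplecton_equiv hk (u := fun a =>
    MoyalAlg.of fibDer (kapAt α β l) (PowerSeries.C (fibCoord a))) (by
      rw [MoyalAlg.mul_sub_mul, formalBracket_linear _ _ fun _ _ => fibDer_fibDer_fibCoord _ _ _,
        formalTransvectant, transvectant_one]
      simp only [fibDer_fibCoord]
      norm_num
      rfl) hX (symMap_fibTriple_injective hl hc)
  refine ⟨E.trans L, fun f hf => h1 _ ?_, fun f g h hh => hm _ _ _ ?_, fun a b f hf => hg a b _ ?_⟩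
  · change (E f : MoyalAlg fibDer (kapAt α β l)) = 1
    rw [hE, hf]
    rfl
  · change (E h : MoyalAlg fibDer (kapAt α β l)) =
      (E f : MoyalAlg fibDer (kapAt α β l)) * (E g : MoyalAlg fibDer (kapAt α β l))
    rw [hE, hE, hE, hh, of_starFib]
  · change (E f : MoyalAlg fibDer (kapAt α β l)) = _
    rw [hE, hf]
    rfl

theorem exists_wedge_one_equiv_fibAlg (hk : kapAt α β l ≠ 0) (hμ : μ = (4 * ct ^ 2 - 3) / 16)
    (hc : c = PowerSeries.C ct * qq) (h : ct ^ 2 = -1 / 4) :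
    ∃ L : fibAlg α β c l hl ≃ₗ[R] wedge 1,
      ∀ f g h : fibAlg α β c l hl, (h : FormalFn Fib) = bracketFib α β l f g →
        (L h : HMod 1) = wOnePlusInfBracket (L f) (L g) := by
  have hs : kapAt α β l / 2 ≠ 0 := div_ne_zero hk two_ne_zero
  have hσ : (-1 / 2 : ℂ) * (-1 / 2 + 1) = μ := by
    rw [hμ, h]
    norm_num
  -- Taking `s = kapAt α β l / 2` turns the parameter `𝔮(λ)` into `𝔮`; the extra `1/2` in the other
  -- constant gives the bracket the factor `1/2` it has on the wedge.
  obtain ⟨L, hL, -⟩ := exists_lieEquiv_fibAlg hl hk hμ hc hσ (div_ne_zero hs two_ne_zero) hs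
    (t := qq) (by rw [mul_div_cancel₀ _ two_ne_zero]; rfl)
  obtain ⟨E, hE⟩ := exists_wedge_one
  refine ⟨L.trans E, fun f g h hfg => ?_⟩
  have e : kapAt α β l / 2 / 2 * (kapAt α β l / 2)⁻¹ = 1 / 2 := by
    field_simp
  have h1 := hL f g h hfg
  rw [e] at h1
  simp only [LinearEquiv.trans_apply, wOnePlusInfBracket]
  rw [hBracket_eq, hE, hE, hE, hBilin_wedgeFst _ one_le_two, h1, map_smul]

theorem exists_wedge_two_equiv_fibAlg (hk : kapAt α β l ≠ 0) (hμ : μ = (4 * ct ^ 2 - 3) / 16)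
    (hc : c = PowerSeries.C ct * qq) (h : ct ^ 2 = 3 / 4) :
    ∃ L : fibAlg α β c l hl ≃ₗ[R] wedge 2 × R,
      (∀ f : fibAlg α β c l hl, (f : FormalFn Fib) = 1 → L f = (0, 1)) ∧
      ∀ f g h : fibAlg α β c l hl, (h : FormalFn Fib) = bracketFib α β l f g →
        ((L h).1 : HMod 2) = wInfBracket (L f).1 (L g).1 ∧ (L h).2 = 0 := by
  have hs : kapAt α β l / 2 ≠ 0 := div_ne_zero hk two_ne_zero
  have hr := div_ne_zero hs two_ne_zero
  have hσ : (0 : ℂ) * (0 + 1) = μ := by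
    rw [hμ, h]
    norm_num
  obtain ⟨L, hL, hu⟩ := exists_lieEquiv_fibAlg hl hk hμ hc hσ hr hs
    (t := qq) (by rw [mul_div_cancel₀ _ two_ne_zero]; rfl)
  -- The same constant normalizes the central component, so that the unit goes to exactly `(0, 1)`.
  obtain ⟨E, hE⟩ := exists_wedge_two hr
  refine ⟨L.trans E, fun f hf => ?_, fun f g h hfg => ?_⟩
  · have h1 := hE (L f)
    rw [hu f hf] at h1
    have h0 : wedgeFst 2 (Finsupp.single unitIdx (algebraMap ℂ R (kapAt α β l / 2 / 2)⁻¹)) = 0 := by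
      rw [wedgeFst_single]
      rw [wedgeVec, dif_neg (by decide), smul_zero]
    rw [h0, Finsupp.single_eq_same, ← map_mul, mul_inv_cancel₀ hr, map_one, ← hu f hf] at h1
    exact Prod.ext (Subtype.ext h1.1) h1.2
  · have e : kapAt α β l / 2 / 2 * (kapAt α β l / 2)⁻¹ = 1 / 2 := by
      field_simp
    have h1 := hL f g h hfg
    rw [e] at h1
    simp only [LinearEquiv.trans_apply, wInfBracket]
    rw [hBracket_eq, (hE _).1, (hE _).1, (hE _).1, (hE _).2, hBilin_wedgeFst _ le_rfl, h1, map_smul]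
    refine ⟨rfl, ?_⟩
    -- Brackets have no component along the unit, hence none along the central line.
    rw [Finsupp.smul_apply, wBracket_apply_unit, smul_zero, mul_zero]

end FibreAlgebra

end MoyalEH

/-! ### Assembly of the main theorem. -/

open MoyalEH in
theorem mainTheorem3 (α β : Spinor) (hαβ : sp α β = 1) :
    -- `c` a finite complex number, or any formal power series in `𝔮`
    (∀ c : R,
      (∀ a b : Fin 2, IsHolo α β c (XX α β c a b)) ∧
      (∀ a b d e : Fin 2,
        bracketPT α β (XX α β c a b) (XX α β c d e) =
            eps a d • XX α β c b e + eps a e • XX α β c b d +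
              eps b d • XX α β c a e + eps b e • XX α β c a d ∧
        starPT α β (XX α β c a b) (XX α β c d e) - starPT α β (XX α β c d e) (XX α β c a b) =
            qLam α β * bracketPT α β (XX α β c a b) (XX α β c d e)) ∧
      contract (fun f g => f * g) (XX α β c) = (-2 : ℤ) • cSqLam α β c ∧
      contract (starPT α β) (XX α β c) =
        contract (fun f g => f * g) (XX α β c) +
          (PowerSeries.C (3 / 2) : R) • qLam α β ^ 2 ∧
      contract (starPT α β) (XX α β c) =
        (-2 : ℤ) • cSqLam α β c + (PowerSeries.C (3 / 2) : R) • qLam α β ^ 2) ∧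
    -- `c = 𝔮 c̃`, on a generic fibre
    (∀ (l : Spinor) (hl : l ≠ 0), sp α l ≠ 0 → sp l β ≠ 0 →
      ∀ (ct μ : ℂ) (c : R), μ = (4 * ct ^ 2 - 3) / 16 → c = PowerSeries.C ct * qq →
        -- the value of the Casimir
        (PowerSeries.C (-1 / 8) : R) • contract (starFib α β l) (XFib α β c l hl) =
          algebraMap R (FormalFn Fib) (qAt α β l ^ 2 * PowerSeries.C μ) ∧
        -- the fibre algebra is `U(sl_{2,𝔮(λ)}) / (C - 𝔮(λ)² μ)`
        (∃ φ : UQuot (qAt α β l) (qAt α β l ^ 2 * PowerSeries.C μ) ≃ₗ[R] fibAlg α β c l hl,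
          (φ 1 : FormalFn Fib) = 1 ∧
          (∀ x y, (φ (x * y) : FormalFn Fib) = starFib α β l (φ x) (φ y)) ∧
          ∀ a b : Fin 2, (φ (xQuot _ _ a b) : FormalFn Fib) = XFib α β c l hl a b) ∧
        -- the fibre algebra is closed under the bracket, which is the rescaled star-commutator
        (∀ f ∈ fibAlg α β c l hl, ∀ g ∈ fibAlg α β c l hl,
          bracketFib α β l f g ∈ fibAlg α β c l hl ∧
          starFib α β l f g - starFib α β l g f = qAt α β l • bracketFib α β l f g) ∧
        -- as a Lie algebra it is `W(μ; 𝔮(λ)) ≅ W(μ; 𝔮)`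
        (∀ σ : ℂ, σ * (σ + 1) = μ → ∀ t : R, t = qAt α β l ∨ t = qq →
          ∃ L : fibAlg α β c l hl ≃ₗ[R] WMod, ∀ f g h : fibAlg α β c l hl,
            (h : FormalFn Fib) = bracketFib α β l f g → L h = wBracket σ t (L f) (L g)) ∧
        -- `c̃ = 0`: the symplecton
        (ct = 0 → ∃ L : fibAlg α β c l hl ≃ₗ[R] symplecton,
          (∀ f : fibAlg α β c l hl, (f : FormalFn Fib) = 1 → L f = 1) ∧
          (∀ f g h : fibAlg α β c l hl,
            (h : FormalFn Fib) = starFib α β l f g → L h = L f * L g) ∧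
          ∀ (a b : Fin 2) (f : fibAlg α β c l hl), (f : FormalFn Fib) = XFib α β c l hl a b →
            (L f : Weyl) = (PowerSeries.C (kapAt α β l / 2) : R) •
              (wgen a * wgen b + wgen b * wgen a)) ∧
        -- `c̃² = -1/4`: the wedge of `W_{1+∞}`
        (ct ^ 2 = -1 / 4 → ∃ L : fibAlg α β c l hl ≃ₗ[R] wedge 1,
          ∀ f g h : fibAlg α β c l hl, (h : FormalFn Fib) = bracketFib α β l f g →
            (L h : HMod 1) = wOnePlusInfBracket (L f) (L g)) ∧
        -- `c̃² = 3/4`: the wedge of `W_∞`, plus the central line spanned by the unit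
        (ct ^ 2 = 3 / 4 → ∃ L : fibAlg α β c l hl ≃ₗ[R] wedge 2 × R,
          (∀ f : fibAlg α β c l hl, (f : FormalFn Fib) = 1 → L f = (0, 1)) ∧
          ∀ f g h : fibAlg α β c l hl, (h : FormalFn Fib) = bracketFib α β l f g →
            ((L h).1 : HMod 2) = wInfBracket (L f).1 (L g).1 ∧ (L h).2 = 0)) := by
  refine ⟨fun c => ⟨isHolo_XX α β c, fun a b d e => ⟨bracket_XX α β c a b d e,
    star_commutator_PT α β _ _⟩, contract_mul_XX α β c, contract_star_XX α β c, ?_⟩,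
    fun l hl h1 h2 ct μ c hμ hc => ?_⟩
  · rw [contract_star_XX, contract_mul_XX]
  have hk := kapAt_ne_zero h1 h2
  refine ⟨fibre_casimir α β hl hμ hc, exists_quot_equiv_fibAlg hl hk hμ hc,
    fun f hf g hg => ⟨bracketFib_mem_fibAlg hl hk hμ hc hf hg, starFib_sub_starFib hk f g⟩,
    fun σ hσ t ht => ?_, fun hct => ?_, exists_wedge_one_equiv_fibAlg hl hk hμ hc,
    exists_wedge_two_equiv_fibAlg hl hk hμ hc⟩
  -- Equal constants `c = s` keep the bracket unscaled. Then `s = 1/2` yields the parameter `𝔮(λ)`,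
  -- and `s = kapAt α β l / 2` yields `𝔮`.
  · have key : ∀ s : ℂ, s ≠ 0 → qAt α β l = algebraMap ℂ R (2 * s) * t →
        ∃ L : fibAlg α β c l hl ≃ₗ[R] WMod, ∀ f g h : fibAlg α β c l hl,
          (h : FormalFn Fib) = bracketFib α β l f g → L h = wBracket σ t (L f) (L g) := by
      intro s hs hst
      obtain ⟨L, hL, -⟩ := exists_lieEquiv_fibAlg hl hk hμ hc hσ hs hs hst
      refine ⟨L, fun f g h hfg => ?_⟩
      rw [hL f g h hfg, mul_inv_cancel₀ hs, map_one, one_smul]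
    rcases ht with rfl | rfl
    · exact key (1 / 2) (by norm_num) (by norm_num)
    · exact key (kapAt α β l / 2) (div_ne_zero hk two_ne_zero)
        (by rw [mul_div_cancel₀ _ two_ne_zero]; rfl)
  · have hc0 : c = 0 := by rw [hc, hct, map_zero, zero_mul]
    subst hc0
    exact exists_symplecton_equiv_fibAlg hl hk
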